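/- Let $\mathbb{H}^d=(\mathbb{R}\cup\{\otimes\})^d$, where $\otimes$ marks a missing entry, and call a point of $\mathbb{H}^d$ $\Delta$-missing if at most $\Delta$ of its entries are $\otimes$. For $x,y\in\mathbb{H}^d$ let $d(x,y)=\bigl(\sum_{i=1}^d|x_i-y_i|^2\bigr)^{1/2}$, where $|a-b|=0$ if $a=\otimes$ or $b=\otimes$. A 2-means clustering of $P=\{p_1,\dots,p_n\}\subset\mathbb{H}^d$ consists of a partition of $P$ into two (possibly empty) clusters $P_1,P_2$ and two centers $c_1,c_2\in\mathbb{R}^d$; its cost is $\sum_{t=1,2}\sum_{x\in P_t}d(x,c_t)^2$, and it is $(1+\epsilon)$-approximate if its cost is at most $(1+\epsilon)$ times the minimum cost over all 2-means clusterings of $P$. There are a constant $C>0$ and a single randomized algorithm (a real-RAM program with unit-cost arithmetic on real numbers and natural numbers, exact comparisons, indexed memory access and drawing of uniform random natural numbers below a given bound) such that the following holds for all integers $\Delta,d,n\ge 1$, every real $\epsilon>0$ and every set $P$ of $n$ $\Delta$-missing points in $\mathbb{H}^d$ (repetitions are allowed). On input $(\Delta,\epsilon,P)$ the algorithm always halts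 within $$2^{C\left(1+\max\{\Delta^4\log\Delta,\ \frac{\Delta}{\epsilon}\log\frac1\epsilon\}\right)}\,d\,n$$ steps, and with probability at least $1/2$ it outputs a $(1+\epsilon)$-approximate 2-means clustering of $P$. -/

import Mathlib

namespace MissingMeans

/-! ### Points with missing entries and the `k`-means cost -/

/-- `ℍ^d`: vectors of `d` real entries, some of which may be missing (`none`). -/
abbrev HPoint (d : ℕ) : Type := Fin d → Option ℝ

/-- At most `Δ` coordinates are missing. -/
def IsMissing {d : ℕ} (Δ : ℕ) (u : HPoint d) : Prop :=
  (Finset.univ.filter fun i => (u i).isNone).card ≤ Δ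

/-- `|a - b|`, with value `0` as soon as one of the two entries is missing. -/
def entryDist : Option ℝ → Option ℝ → ℝ
  | some a, some b => |a - b|
  | _, _ => 0

/-- The distance of two points of `ℍ^d` on a set of coordinates. -/
noncomputable def distOn {d : ℕ} (I : Finset (Fin d)) (x y : HPoint d) : ℝ :=
  √(∑ i ∈ I, entryDist (x i) (y i) ^ 2)

/-- A point of `ℝ^d` as a point of `ℍ^d` without missing entries. -/
def complete {d : ℕ} (c : Fin d → ℝ) : HPoint d := fun i => some (c i)

/-- The sum of the squared distances to `y` of the points of `P` with index in `S`. -/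
noncomputable def cost {n d : ℕ} (P : Fin n → HPoint d) (S : Finset (Fin n)) (y : HPoint d) : ℝ :=
  ∑ x ∈ S, distOn Finset.univ (P x) y ^ 2

/-- The cost of a clustering of `P`: `l` gives the partition (the cluster `t` consists of the points
with label `t`) and `c t ∈ ℝ^d` is the center of the cluster `t`. -/
noncomputable def clusterCost {n d k : ℕ} (P : Fin n → HPoint d) (l : Fin n → Fin k)
    (c : Fin k → Fin d → ℝ) : ℝ :=
  ∑ t, cost P (Finset.univ.filter fun x => l x = t) (complete (c t))

/-- The optimal `k`-means cost, over all partitions and all centers in `ℝ^d`. -/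
noncomputable def opt {n d : ℕ} (k : ℕ) (P : Fin n → HPoint d) : ℝ :=
  ⨅ q : (Fin n → Fin k) × (Fin k → Fin d → ℝ), clusterCost P q.1 q.2

/-! ### Randomized real-RAM programs

The memory consists of arrays of natural numbers and arrays of real numbers; a (fixed) program
mentions finitely many of them by name. Elementary operations are `+`, `-`, `*` on both sorts, `/` on
reals, conversion of naturals to reals, exact comparisons, indexed reading and writing, and the
drawing of a uniform random natural number below a given bound. There are no real constants other
than natural numbers, and there is no rounding. -/

structure Mem where
  nat : ℕ → ℕ → ℕ
  real : ℕ → ℕ → ℝ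

inductive NExp : Type
  | lit (k : ℕ)
  | get (a : ℕ) (i : NExp)
  | add (e f : NExp)
  | sub (e f : NExp)
  | mul (e f : NExp)

inductive RExp : Type
  | ofNat (e : NExp)
  | get (a : ℕ) (i : NExp)
  | add (e f : RExp)
  | sub (e f : RExp)
  | mul (e f : RExp)
  | div (e f : RExp)

inductive Test : Type
  | natLe (e f : NExp)
  | realLe (e f : RExp)
  | neg (b : Test)
  | and (b b' : Test)

inductive Cmd : Type
  | setNat (a : ℕ) (i e : NExp)
  | setReal (a : ℕ) (i : NExp) (e : RExp)
  | rand (a : ℕ) (i bound : NExp)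
  | seq (p q : Cmd)
  | ite (b : Test) (p q : Cmd)
  | loop (b : Test) (p : Cmd)

def NExp.eval (m : Mem) : NExp → ℕ
  | lit k => k
  | get a i => m.nat a (i.eval m)
  | add e f => e.eval m + f.eval m
  | sub e f => e.eval m - f.eval m
  | mul e f => e.eval m * f.eval m

noncomputable def RExp.eval (m : Mem) : RExp → ℝ
  | ofNat e => (e.eval m : ℝ)
  | get a i => m.real a (i.eval m)
  | add e f => e.eval m + f.eval m
  | sub e f => e.eval m - f.eval m
  | mul e f => e.eval m * f.eval m
  | div e f => e.eval m / f.eval m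

def Test.Holds (m : Mem) : Test → Prop
  | natLe e f => e.eval m ≤ f.eval m
  | realLe e f => e.eval m ≤ f.eval m
  | neg b => ¬ b.Holds m
  | and b b' => b.Holds m ∧ b'.Holds m

def Mem.setNat (m : Mem) (a i v : ℕ) : Mem :=
  { m with nat := Function.update m.nat a (Function.update (m.nat a) i v) }

noncomputable def Mem.setReal (m : Mem) (a i : ℕ) (v : ℝ) : Mem :=
  { m with real := Function.update m.real a (Function.update (m.real a) i v) }

/-- The uniform distribution on `{0, …, k - 1}` (the point mass at `0` if `k = 0`). -/
noncomputable def uniformBelow : ℕ → PMF ℕ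
  | 0 => PMF.pure 0
  | k + 1 => (PMF.uniformOfFintype (Fin (k + 1))).map fun i => (i : ℕ)

/-- A configuration: the commands that remain to be executed, in order, and the memory. -/
structure Config where
  todo : List Cmd
  mem : Mem

/-- The computation has ended. -/
def Config.Halted (s : Config) : Prop := s.todo = []

open Classical in
/-- One step of the computation. Each step executes one assignment, one random draw or one test, or
unfolds one sequential composition; the expressions in it are part of the program text, so that
counting steps is counting elementary operations up to a factor that depends on the program only. -/
noncomputable def step : Config → PMF Config
  | ⟨[], m⟩ => PMF.pure ⟨[], m⟩
  | ⟨.setNat a i e :: K, m⟩ => PMF.pure ⟨K, m.setNat a (i.eval m) (e.eval m)⟩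
  | ⟨.setReal a i e :: K, m⟩ => PMF.pure ⟨K, m.setReal a (i.eval m) (e.eval m)⟩
  | ⟨.rand a i b :: K, m⟩ =>
      (uniformBelow (b.eval m)).map fun v => ⟨K, m.setNat a (i.eval m) v⟩
  | ⟨.seq p q :: K, m⟩ => PMF.pure ⟨p :: q :: K, m⟩
  | ⟨.ite b p q :: K, m⟩ => PMF.pure (if b.Holds m then ⟨p :: K, m⟩ else ⟨q :: K, m⟩)
  | ⟨.loop b p :: K, m⟩ =>
      PMF.pure (if b.Holds m then ⟨p :: .loop b p :: K, m⟩ else ⟨K, m⟩)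

/-- The distribution of the configuration after `T` steps. -/
noncomputable def stepsFrom (s : Config) : ℕ → PMF Config
  | 0 => PMF.pure s
  | T + 1 => (stepsFrom s T).bind step

/-- The distribution of the configuration after `T` steps of the program `p` on the initial
memory `m`. -/
noncomputable def run (p : Cmd) (m : Mem) (T : ℕ) : PMF Config := stepsFrom ⟨[p], m⟩ T

/-! ### Input and output -/

/-- The input: the natural array `0` holds `n, d, Δ`, the real array `0` holds `ε`; the entry `j` of
the point `i` is at the position `i * d + j` of the real array `1`, and the natural array `1` holds
there `1` if the entry is present and `0` if it is missing. All other cells are `0`. -/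
noncomputable def inputMem {n d : ℕ} (Δ : ℕ) (ε : ℝ) (P : Fin n → HPoint d) : Mem where
  nat a r :=
    if a = 0 then (if r = 0 then n else if r = 1 then d else if r = 2 then Δ else 0)
    else if a = 1 then
      (if h : r < n * d then
        (if (P (Fin.divNat ⟨r, h⟩) (Fin.modNat ⟨r, h⟩)).isSome then 1 else 0) else 0)
    else 0
  real a r :=
    if a = 0 then (if r = 0 then ε else 0)
    else if a = 1 then
      (if h : r < n * d then (P (Fin.divNat ⟨r, h⟩) (Fin.modNat ⟨r, h⟩)).getD 0 else 0)
    else 0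

/-- The output in `m` is a clustering of `P` into two clusters of cost at most `(1 + ε)` times the
optimum: the label (`0` or `1`) of the point `i` is in the cell `i` of the natural array `2`, and the
coordinate `j` of the center of the cluster `t` is in the cell `t * d + j` of the real array `2`. -/
def IsApproxOutput {n d : ℕ} (ε : ℝ) (P : Fin n → HPoint d) (m : Mem) : Prop :=
  ∃ l : Fin n → Fin 2, (∀ i : Fin n, m.nat 2 i = l i) ∧
    clusterCost P l (fun t j => m.real 2 (t * d + j)) ≤ (1 + ε) * opt 2 P

end MissingMeans

open MissingMeans

open MissingMeans
set_option linter.unusedSimpArgs false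

namespace MissingMeans

/-! ### A program logic for randomized programs -/

/-! The algorithm is a randomized search over partial solutions, in the sample-and-prune style. Let
`q` be the least positive integer with `q * ε ≥ 1`, and fix an optimal clustering as the goal. A
partial solution knows some coordinates of the two centers, has assigned some points at a total cost
`b`, and keeps a list `R` of unassigned points. There are two moves.

Learning: guess a center and draw `64 * q` unassigned points. The mean of a uniform sample of size
`s` from a set exceeds the optimal cost of a coordinate by a factor of about `1 + O(1/s)` in
expectation, also when up to half of the sampled entries are missing (`sum_excess_le`,
`card_good_samples`). The first sample for a center settles all coordinates present in at least half
of the sample. Each sampled point misses at most `Δ` entries, so at most `2 * Δ` coordinates stay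
unknown (`card_rare_le`). Later samples settle one remaining coordinate each, so `4 * Δ + 2`
learning moves suffice (`learn_all`, `learn_one`). A sample consists of informative points with
probability `(4096 * Δ * q) ^ (-64 * q)` if a fraction `1 / (4096 * Δ * q)` of `R` is informative.

Peeling: if no such fraction exists, then only `|R| / (1024 * q)` points cannot be assigned to their
own center yet (`card_undetermined_le`). A point can be assigned to a center that is known at all
its present entries. Choose a pivot of central rank among the assignable points, ordered by cost,
and assign all points up to it greedily. The points assigned before their own center is usable cause
a debt of at most their number times the cost `w` of the pivot. Most remaining points cost at least
`w`, and the next peeling takes at least an eighth of them, so a slack of `1 / (4 * q)` times their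
cost repays the debt (`OnTrack.peel`). The debt is void when `R` is empty. The final cost is at most
`(1 + 1 / (4 * q)) ^ 2 ≤ 1 + ε` times the optimum.

The program cannot tell which move is right. At each level it opens a child level with a random
learning move, explores it completely, returns, peels, and repeats. Peeling removes a constant
fraction of the points, so the time of a search is linear in `n` (`time_push`). The cheapest
finished solution is recorded, and `Sound` guarantees that its recorded cost is honest whether or
not the guesses were right. Repeating the search as often as the inverse of its success probability
gives probability `1/2`.

Probabilities are handled in continuation-passing style: `Ok T Q e K m` bounds time and success
probability together, and a random draw averages the bounds of its branches. In `Explores` the value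
`v` of whatever comes after the search improves to `v + (1 - v) * w`, where `w` is the success
probability of the search, so no independence argument is needed. -/

theorem stepsFrom_succ (s : Config) (T : ℕ) :
    stepsFrom s (T + 1) = (step s).bind fun s' => stepsFrom s' T := by
  induction T with
  | zero => simp [stepsFrom]
  | succ T ih =>
    have h : stepsFrom s (T + 1 + 1) = (stepsFrom s (T + 1)).bind step := rfl
    rw [h, ih, PMF.bind_bind]
    rfl

/-- All computations from `s` have halted after `T` steps. -/
def Halts (T : ℕ) (s : Config) : Prop := ∀ s' ∈ (stepsFrom s T).support, s'.Halted

/-- The probability that the memory satisfies `Q` after `T` steps. -/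
noncomputable def prob (T : ℕ) (Q : Mem → Prop) (s : Config) : ℝ :=
  ((stepsFrom s T).toOuterMeasure {s' | Q s'.mem}).toReal

/-- From the commands `K` and the memory `m`, the computation halts within `T` steps, and `Q` holds at
the end with probability at least `e`. -/
def Ok (T : ℕ) (Q : Mem → Prop) (e : ℝ) (K : List Cmd) (m : Mem) : Prop :=
  Halts T ⟨K, m⟩ ∧ e ≤ prob T Q ⟨K, m⟩

theorem stepsFrom_nil (m : Mem) (T : ℕ) : stepsFrom ⟨[], m⟩ T = PMF.pure ⟨[], m⟩ := by
  induction T with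
  | zero => rfl
  | succ T ih => rw [stepsFrom, ih, PMF.pure_bind]; rfl

theorem prob_nonneg (T : ℕ) (Q : Mem → Prop) (s : Config) : 0 ≤ prob T Q s :=
  ENNReal.toReal_nonneg

theorem outer_ne_top (p : PMF Config) (A : Set Config) : p.toOuterMeasure A ≠ ⊤ := by
  refine ne_top_of_le_ne_top ENNReal.one_ne_top ?_
  calc p.toOuterMeasure A ≤ p.toOuterMeasure Set.univ := p.toOuterMeasure.mono (Set.subset_univ _)
    _ = 1 := by
      rw [PMF.toOuterMeasure_apply_eq_one_iff]; exact Set.subset_univ _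

/-- Halted configurations are fixed by `step`. Time bounds can therefore always be relaxed, which
lets branches of different length be merged. -/
theorem Halts.stepsFrom_succ_eq {T : ℕ} {s : Config} (h : Halts T s) :
    stepsFrom s (T + 1) = stepsFrom s T := by
  have h1 : stepsFrom s (T + 1) = (stepsFrom s T).bind step := rfl
  rw [h1]
  conv_rhs => rw [← PMF.bind_pure (stepsFrom s T)]
  ext y
  rw [PMF.bind_apply, PMF.bind_apply]
  refine tsum_congr fun x => ?_
  by_cases hx : x ∈ (stepsFrom s T).support
  · obtain ⟨K, m⟩ := x
    have : K = [] := h _ hx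
    subst this
    rfl
  · rw [PMF.mem_support_iff, not_not] at hx
    simp [hx]

theorem Ok.mono_time {T T' : ℕ} {Q : Mem → Prop} {e : ℝ} {K : List Cmd} {m : Mem}
    (h : Ok T Q e K m) (hT : T ≤ T') : Ok T' Q e K m := by
  induction T', hT using Nat.le_induction with
  | base => exact h
  | succ T' _ ih =>
    have := ih.1.stepsFrom_succ_eq
    refine ⟨fun s' hs' => ih.1 s' (this ▸ hs'), ?_⟩
    unfold prob
    rw [this]
    exact ih.2

theorem Ok.mono {T T' : ℕ} {Q : Mem → Prop} {e e' : ℝ} {K : List Cmd} {m : Mem}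
    (h : Ok T Q e K m) (hT : T ≤ T') (he : e' ≤ e) : Ok T' Q e' K m :=
  ⟨(h.mono_time hT).1, he.trans (h.mono_time hT).2⟩

/-- The alternative `e ≤ 0` covers runs that failed: they still have to halt, but promise nothing.
-/
theorem ok_nil {T : ℕ} {Q : Mem → Prop} {e : ℝ} {m : Mem} (he : e ≤ 1) (hQ : Q m ∨ e ≤ 0) :
    Ok T Q e [] m := by
  refine ⟨?_, ?_⟩
  · intro s' hs'
    rw [stepsFrom_nil, PMF.support_pure, Set.mem_singleton_iff] at hs'
    rw [hs']; rfl
  · rcases hQ with hQ | h0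
    · refine he.trans (le_of_eq ?_)
      unfold prob
      rw [stepsFrom_nil, (PMF.toOuterMeasure_apply_eq_one_iff _ _).2]
      · simp
      · intro s hs
        rw [PMF.support_pure, Set.mem_singleton_iff] at hs
        rw [hs]; exact hQ
    · exact h0.trans (prob_nonneg _ _ _)

theorem ok_of_pure {T : ℕ} {Q : Mem → Prop} {e : ℝ} {K K' : List Cmd} {m m' : Mem}
    (hs : step ⟨K, m⟩ = PMF.pure ⟨K', m'⟩) (h : Ok T Q e K' m') : Ok (T + 1) Q e K m := by
  have : stepsFrom ⟨K, m⟩ (T + 1) = stepsFrom ⟨K', m'⟩ T := by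
    rw [stepsFrom_succ, hs, PMF.pure_bind]
  refine ⟨fun s' hs' => h.1 s' (this ▸ hs'), ?_⟩
  unfold prob
  rw [this]
  exact h.2

/-- The law of total probability. All probability estimates for the program come from this rule,
since the other commands are deterministic. -/
theorem ok_rand {T : ℕ} {Q : Mem → Prop} {a : ℕ} {i b : NExp} {K : List Cmd} {m : Mem} {r : ℕ}
    (hr : b.eval m = r) (hpos : 0 < r) (f : ℕ → ℝ)
    (h : ∀ v < r, Ok T Q (f v) K (m.setNat a (i.eval m) v)) :
    Ok (T + 1) Q ((∑ v ∈ Finset.range r, f v) / r) (.rand a i b :: K) m := by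
  obtain ⟨k, rfl⟩ : ∃ k, r = k + 1 := ⟨r - 1, by omega⟩
  have hst : stepsFrom ⟨.rand a i b :: K, m⟩ (T + 1) =
      (PMF.uniformOfFintype (Fin (k + 1))).bind fun v =>
        stepsFrom ⟨K, m.setNat a (i.eval m) v⟩ T := by
    rw [stepsFrom_succ]
    have h1 : step ⟨.rand a i b :: K, m⟩ = (uniformBelow (k + 1)).map fun v =>
        (⟨K, m.setNat a (i.eval m) v⟩ : Config) := by simp only [step, hr]
    rw [h1, PMF.bind_map]
    have h2 : uniformBelow (k + 1) =
        (PMF.uniformOfFintype (Fin (k + 1))).bind fun i => PMF.pure (i : ℕ) := by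
      rw [uniformBelow]
      exact PMF.map_id _
    rw [h2, PMF.bind_bind]
    simp only [PMF.pure_bind, Function.comp]
  refine ⟨?_, ?_⟩
  · intro s' hs'
    rw [hst, PMF.mem_support_bind_iff] at hs'
    obtain ⟨v, -, hv⟩ := hs'
    exact (h v v.2).1 s' hv
  · unfold prob
    rw [hst, PMF.toOuterMeasure_bind_apply, tsum_fintype, ENNReal.toReal_sum]
    · rw [Finset.sum_range, Finset.sum_div]
      refine Finset.sum_le_sum fun v _ => ?_
      have := (h v v.2).2
      unfold prob at this
      rw [ENNReal.toReal_mul, PMF.uniformOfFintype_apply, div_eq_inv_mul]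
      simp only [Fintype.card_fin, ENNReal.toReal_inv, ENNReal.toReal_natCast]
      gcongr
    · intro v _
      refine ENNReal.mul_ne_top ?_ (outer_ne_top _ _)
      exact PMF.apply_ne_top _ _

/-- A Hoare triple in continuation-passing style: from `m` the command `c` ends within `t` steps in a
memory that satisfies `S`. -/
def Tri (c : Cmd) (m : Mem) (t : ℕ) (S : Mem → Prop) : Prop :=
  ∀ (K : List Cmd) (T : ℕ) (Q : Mem → Prop) (e : ℝ),
    (∀ m', S m' → Ok T Q e K m') → Ok (t + T) Q e (c :: K) m

theorem Tri.mono {c : Cmd} {m : Mem} {t t' : ℕ} {S S' : Mem → Prop} (h : Tri c m t S)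
    (ht : t ≤ t') (hS : ∀ m', S m' → S' m') : Tri c m t' S' := fun K T Q e hK =>
  (h K T Q e fun m' hm' => hK m' (hS m' hm')).mono_time (by omega)

theorem tri_setNat {a : ℕ} {i e : NExp} {m : Mem} {S : Mem → Prop}
    (h : S (m.setNat a (i.eval m) (e.eval m))) : Tri (.setNat a i e) m 1 S := fun K T Q v hK => by
  rw [add_comm]
  exact ok_of_pure (by simp [step]) (hK _ h)

theorem tri_setReal {a : ℕ} {i : NExp} {e : RExp} {m : Mem} {S : Mem → Prop}
    (h : S (m.setReal a (i.eval m) (e.eval m))) : Tri (.setReal a i e) m 1 S := fun K T Q v hK => by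
  rw [add_comm]
  exact ok_of_pure (by simp [step]) (hK _ h)

theorem tri_seq {p q : Cmd} {m : Mem} {t t' : ℕ} {S S' : Mem → Prop} (hp : Tri p m t S)
    (hq : ∀ m', S m' → Tri q m' t' S') : Tri (.seq p q) m (1 + t + t') S' := fun K T Q v hK => by
  have := hp (q :: K) (t' + T) Q v fun m' hm' => hq m' hm' K T Q v hK
  exact (ok_of_pure (by simp [step]) this).mono_time (by omega)

theorem tri_ite {b : Test} {p q : Cmd} {m : Mem} {t : ℕ} {S : Mem → Prop}
    (hp : b.Holds m → Tri p m t S) (hq : ¬ b.Holds m → Tri q m t S) :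
    Tri (.ite b p q) m (1 + t) S := fun K T Q v hK => by
  by_cases hb : b.Holds m
  · exact (ok_of_pure (by simp [step, hb]) (hp hb K T Q v hK)).mono_time (by omega)
  · exact (ok_of_pure (by simp [step, hb]) (hq hb K T Q v hK)).mono_time (by omega)

theorem tri_nat_seq {a : ℕ} {i e : NExp} {q : Cmd} {m : Mem} {t : ℕ} {S : Mem → Prop}
    (h : Tri q (m.setNat a (i.eval m) (e.eval m)) t S) : Tri (.seq (.setNat a i e) q) m (2 + t) S :=
  (tri_seq (tri_setNat (S := fun m' => m' = m.setNat a (i.eval m) (e.eval m)) rfl)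
    fun m' hm' => hm' ▸ h).mono (by omega) fun _ => id

theorem tri_real_seq {a : ℕ} {i : NExp} {e : RExp} {q : Cmd} {m : Mem} {t : ℕ} {S : Mem → Prop}
    (h : Tri q (m.setReal a (i.eval m) (e.eval m)) t S) :
    Tri (.seq (.setReal a i e) q) m (2 + t) S :=
  (tri_seq (tri_setReal (S := fun m' => m' = m.setReal a (i.eval m) (e.eval m)) rfl)
    fun m' hm' => hm' ▸ h).mono (by omega) fun _ => id

theorem ok_loop_true {T : ℕ} {Q : Mem → Prop} {e : ℝ} {b : Test} {p : Cmd} {K : List Cmd} {m : Mem}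
    (hb : b.Holds m) (h : Ok T Q e (p :: .loop b p :: K) m) : Ok (T + 1) Q e (.loop b p :: K) m :=
  ok_of_pure (by simp [step, hb]) h

theorem ok_loop_false {T : ℕ} {Q : Mem → Prop} {e : ℝ} {b : Test} {p : Cmd} {K : List Cmd} {m : Mem}
    (hb : ¬ b.Holds m) (h : Ok T Q e K m) : Ok (T + 1) Q e (.loop b p :: K) m :=
  ok_of_pure (by simp [step, hb]) h

theorem ok_seq {T : ℕ} {Q : Mem → Prop} {e : ℝ} {p q : Cmd} {K : List Cmd} {m : Mem}
    (h : Ok T Q e (p :: q :: K) m) : Ok (T + 1) Q e (.seq p q :: K) m :=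
  ok_of_pure (by simp [step]) h

theorem ok_ite_true {T : ℕ} {Q : Mem → Prop} {e : ℝ} {b : Test} {p q : Cmd} {K : List Cmd} {m : Mem}
    (hb : b.Holds m) (h : Ok T Q e (p :: K) m) : Ok (T + 1) Q e (.ite b p q :: K) m :=
  ok_of_pure (by simp [step, hb]) h

theorem ok_ite_false {T : ℕ} {Q : Mem → Prop} {e : ℝ} {b : Test} {p q : Cmd} {K : List Cmd} {m : Mem}
    (hb : ¬ b.Holds m) (h : Ok T Q e (q :: K) m) : Ok (T + 1) Q e (.ite b p q :: K) m :=
  ok_of_pure (by simp [step, hb]) h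

/-- A loop of which every round decreases a variant. -/
theorem tri_loop {b : Test} {p : Cmd} {N t : ℕ} (Inv : ℕ → Mem → Prop) {S : Mem → Prop}
    (hend : ∀ k m, Inv k m → ¬ b.Holds m → S m)
    (hlt : ∀ k m, Inv k m → b.Holds m → k < N)
    (hstep : ∀ k m, Inv k m → b.Holds m → Tri p m t (Inv (k + 1))) {m : Mem} {k : ℕ}
    (hk : k ≤ N) (h : Inv k m) : Tri (.loop b p) m ((N - k) * (t + 1) + 1) S := by
  intro K T Q v hK
  induction hr : N - k generalizing k m with
  | zero =>
    have hb : ¬ b.Holds m := fun hb => by have := hlt k m h hb; omega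
    exact (ok_loop_false hb (hK m (hend k m h hb))).mono_time (by omega)
  | succ r ih =>
    by_cases hb : b.Holds m
    · have := hlt k m h hb
      have h2 := hstep k m h hb (.loop b p :: K) (r * (t + 1) + 1 + T) Q v fun m' hm' =>
        ih (by omega) hm' (by omega)
      refine (ok_loop_true hb h2).mono_time (le_of_eq ?_)
      ring
    · exact (ok_loop_false hb (hK m (hend k m h hb))).mono_time (by nlinarith)

/-- `for c < bound do body`, the counter being the cell `0` of the natural array `c`. -/
def forN (c : ℕ) (bound : NExp) (body : Cmd) : Cmd :=
  .seq (.setNat c (.lit 0) (.lit 0))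
    (.loop (.natLe (.add (.get c (.lit 0)) (.lit 1)) bound)
      (.seq body (.setNat c (.lit 0) (.add (.get c (.lit 0)) (.lit 1)))))

/-- The body must leave the counter alone. The invariant is asked for after the increment, so that
it can mention the counter. The `3` per round pays for the test, the unfolding and the increment. -/
theorem tri_forN {c : ℕ} {bound : NExp} {body : Cmd} {m : Mem} (N t : ℕ) (Inv : ℕ → Mem → Prop)
    (h0 : Inv 0 (m.setNat c 0 0))
    (hb : ∀ k m, Inv k m → bound.eval m = N ∧ m.nat c 0 = k)
    (hstep : ∀ k m, k < N → Inv k m →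
      Tri body m t fun m' => m'.nat c 0 = k ∧ Inv (k + 1) (m'.setNat c 0 (k + 1))) :
    Tri (forN c bound body) m (N * (t + 3) + 3) (Inv N) := by
  have key : Tri (.loop (.natLe (.add (.get c (.lit 0)) (.lit 1)) bound)
      (.seq body (.setNat c (.lit 0) (.add (.get c (.lit 0)) (.lit 1))))) (m.setNat c 0 0)
      ((N - 0) * ((t + 2) + 1) + 1) (Inv N) := by
    refine tri_loop (fun k m => Inv k m ∧ k ≤ N) ?_ ?_ ?_ (Nat.zero_le _) ⟨h0, Nat.zero_le _⟩
    · rintro k m ⟨h, hk⟩ hnot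
      obtain ⟨h1, h2⟩ := hb k m h
      simp only [Test.Holds, NExp.eval, h1, h2] at hnot
      have : k = N := by omega
      exact this ▸ h
    · rintro k m ⟨h, hk⟩ hh
      obtain ⟨h1, h2⟩ := hb k m h
      simp only [Test.Holds, NExp.eval, h1, h2] at hh
      omega
    · rintro k m ⟨h, hk⟩ hh
      obtain ⟨h1, h2⟩ := hb k m h
      simp only [Test.Holds, NExp.eval, h1, h2] at hh
      refine (tri_seq (hstep k m hh h) fun m' hm' => tri_setNat (S := fun m => Inv (k + 1) m ∧
        k + 1 ≤ N) ?_).mono (by omega) fun _ => id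
      simp only [NExp.eval, hm'.1]
      exact ⟨hm'.2, hh⟩
  refine (tri_nat_seq key).mono ?_ fun _ => id
  simp only [Nat.sub_zero]
  ring_nf
  omega

/-! ### Reading the memory after a write, and framing. -/

theorem Mem.nat_setNat (m : Mem) (a i v b k : ℕ) :
    (m.setNat a i v).nat b k = if b = a ∧ k = i then v else m.nat b k := by
  by_cases h : b = a
  · subst h
    by_cases h' : k = i <;> simp [Mem.setNat, h']
  · simp [Mem.setNat, h]

theorem Mem.real_setReal (m : Mem) (a i : ℕ) (v : ℝ) (b k : ℕ) :
    (m.setReal a i v).real b k = if b = a ∧ k = i then v else m.real b k := by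
  by_cases h : b = a
  · subst h
    by_cases h' : k = i <;> simp [Mem.setReal, h']
  · simp [Mem.setReal, h]

theorem Mem.real_setNat (m : Mem) (a i v : ℕ) : (m.setNat a i v).real = m.real := rfl

theorem Mem.nat_setReal (m : Mem) (a i : ℕ) (v : ℝ) : (m.setReal a i v).nat = m.nat := rfl

/-- Only the natural arrays in `F` and the real arrays in `G` differ between `m` and `m'`. -/
def Frame (F G : List ℕ) (m m' : Mem) : Prop :=
  (∀ a, a ∉ F → m'.nat a = m.nat a) ∧ (∀ a, a ∉ G → m'.real a = m.real a)

theorem Frame.refl (F G : List ℕ) (m : Mem) : Frame F G m m := ⟨fun _ _ => rfl, fun _ _ => rfl⟩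

theorem Frame.setNat {F G : List ℕ} {m m' : Mem} (h : Frame F G m m') {a : ℕ} (ha : a ∈ F)
    (i v : ℕ) : Frame F G m (m'.setNat a i v) := by
  refine ⟨fun b hb => ?_, h.2⟩
  have : b ≠ a := fun e => hb (e ▸ ha)
  rw [← h.1 b hb]
  funext k
  simp [Mem.nat_setNat, this]

theorem Frame.setReal {F G : List ℕ} {m m' : Mem} (h : Frame F G m m') {a : ℕ} (ha : a ∈ G)
    (i : ℕ) (v : ℝ) : Frame F G m (m'.setReal a i v) := by
  refine ⟨h.1, fun b hb => ?_⟩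
  have : b ≠ a := fun e => hb (e ▸ ha)
  rw [← h.2 b hb]
  funext k
  simp [Mem.real_setReal, this]

theorem Frame.trans {F G F' G' : List ℕ} {m m' m'' : Mem} (h : Frame F G m m')
    (h' : Frame F' G' m' m'') (hF : F' ⊆ F) (hG : G' ⊆ G) : Frame F G m m'' :=
  ⟨fun a ha => (h'.1 a fun x => ha (hF x)).trans (h.1 a ha),
    fun a ha => (h'.2 a fun x => ha (hG x)).trans (h.2 a ha)⟩

/-! ### The mean of a uniform sample -/

/-- Additivity of the variance for independent centered draws, written without division. The shift
`c` makes the induction go through: the first draw is absorbed into it. -/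
theorem sum_sq_add_tuple {ι : Type*} [Fintype ι] (y : ι → ℝ) (hy : ∑ i, y i = 0) (s : ℕ) (c : ℝ) :
    Fintype.card ι * ∑ σ : Fin s → ι, (c + ∑ k, y (σ k)) ^ 2 =
      Fintype.card ι ^ s * (Fintype.card ι * c ^ 2 + s * ∑ i, y i ^ 2) := by
  induction s generalizing c with
  | zero => simp
  | succ s ih =>
    have h1 : ∑ σ : Fin (s + 1) → ι, (c + ∑ k, y (σ k)) ^ 2 =
        ∑ i, ∑ σ : Fin s → ι, ((c + y i) + ∑ k, y (σ k)) ^ 2 := by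
      rw [← (Fin.consEquiv fun _ : Fin (s + 1) => ι).sum_comp, Fintype.sum_prod_type]
      refine Finset.sum_congr rfl fun i _ => Finset.sum_congr rfl fun σ _ => ?_
      simp [Fin.consEquiv, Fin.sum_univ_succ, add_assoc]
    rw [h1, Finset.mul_sum]
    simp_rw [ih]
    rw [← Finset.mul_sum, Finset.sum_add_distrib, ← Finset.mul_sum]
    have h2 : ∑ i, (c + y i) ^ 2 = Fintype.card ι * c ^ 2 + ∑ i, y i ^ 2 := by
      have : ∀ i, (c + y i) ^ 2 = c ^ 2 + 2 * c * y i + y i ^ 2 := fun i => by ring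
      simp_rw [this]
      rw [Finset.sum_add_distrib, Finset.sum_add_distrib, ← Finset.mul_sum, hy]
      simp
    rw [h2]
    simp only [Finset.sum_const, Finset.card_univ, nsmul_eq_mul]
    push_cast
    ring

open Classical in
-- Markov's inequality at twice the mean, in counting form.
theorem card_le_two_mul_card_filter_of_sum_le {ι : Type*} [Fintype ι] (F : ι → ℝ) (hF : ∀ i, 0 ≤ F i)
    (B : ℝ) (hB : 0 ≤ B) (h : ∑ i, F i ≤ Fintype.card ι * B) :
    Fintype.card ι ≤ 2 * (Finset.univ.filter fun i => F i ≤ 2 * B).card := by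
  by_contra hc
  push Not at hc
  have hsplit := Finset.card_filter_add_card_filter_not (s := (Finset.univ : Finset ι))
    (fun i => F i ≤ 2 * B)
  rw [Finset.card_univ] at hsplit
  have hbad : Fintype.card ι < 2 * (Finset.univ.filter fun i => ¬ F i ≤ 2 * B).card := by omega
  set A := Finset.univ.filter fun i => ¬ F i ≤ 2 * B with hA
  have hne : A.Nonempty := by
    rw [← Finset.card_pos]; omega
  have h1 : ∑ _i ∈ A, 2 * B < ∑ i ∈ A, F i :=
    Finset.sum_lt_sum_of_nonempty hne fun i hi => by
      rw [hA, Finset.mem_filter] at hi; exact not_le.1 hi.2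
  have h2 : ∑ i ∈ A, F i ≤ ∑ i, F i :=
    Finset.sum_le_univ_sum_of_nonneg hF
  rw [Finset.sum_const, nsmul_eq_mul] at h1
  have h3 : (Fintype.card ι : ℝ) ≤ 2 * A.card := by exact_mod_cast hbad.le
  nlinarith

/-- The data of an instance: the number of coordinates, the present entries and their values. -/
structure Data where
  d : ℕ
  pr : ℕ → ℕ → Prop
  v : ℕ → ℕ → ℝ

namespace Data

open Classical in
/-- The number of the sample points that have the entry `j`. -/
noncomputable def cnt (I : Data) {s : ℕ} (σ : Fin s → ℕ) (j : ℕ) : ℕ :=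
  (Finset.univ.filter fun k => I.pr (σ k) j).card

open Classical in
/-- The mean of the entries `j` of the sample points that have it. -/
noncomputable def mean (I : Data) {s : ℕ} (σ : Fin s → ℕ) (j : ℕ) : ℝ :=
  (∑ k, if I.pr (σ k) j then I.v (σ k) j else 0) / I.cnt σ j

open Classical in
/-- The points of `A` with the entry `j`. -/
noncomputable def having (I : Data) (A : Finset ℕ) (j : ℕ) : Finset ℕ := A.filter fun x => I.pr x j

/-- The mean of the entries `j` in `A`. -/
noncomputable def avg (I : Data) (A : Finset ℕ) (j : ℕ) : ℝ :=
  (∑ x ∈ I.having A j, I.v x j) / (I.having A j).card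

/-- The cost of the coordinate `j` of the points of `A` for the center coordinate `c`. -/
noncomputable def coordCost (I : Data) (A : Finset ℕ) (j : ℕ) (c : ℝ) : ℝ :=
  ∑ x ∈ I.having A j, (I.v x j - c) ^ 2

theorem coordCost_nonneg (I : Data) (A : Finset ℕ) (j : ℕ) (c : ℝ) : 0 ≤ I.coordCost A j c :=
  Finset.sum_nonneg fun _ _ => sq_nonneg _

theorem sum_sub_avg (I : Data) (A : Finset ℕ) (j : ℕ) :
    ∑ x ∈ I.having A j, (I.v x j - I.avg A j) = 0 := by
  rw [Finset.sum_sub_distrib, Finset.sum_const, nsmul_eq_mul, avg]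
  by_cases h : I.having A j = ∅
  · simp [h]
  · have : ((I.having A j).card : ℝ) ≠ 0 := by
      simpa [Finset.card_eq_zero] using h
    field_simp
    ring

theorem coordCost_eq (I : Data) (A : Finset ℕ) (j : ℕ) (c : ℝ) :
    I.coordCost A j c = I.coordCost A j (I.avg A j) + (I.having A j).card * (c - I.avg A j) ^ 2 := by
  have h := I.sum_sub_avg A j
  have : ∀ x, (I.v x j - c) ^ 2 = (I.v x j - I.avg A j) ^ 2 +
      2 * (I.avg A j - c) * (I.v x j - I.avg A j) + (c - I.avg A j) ^ 2 := fun x => by ring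
  unfold coordCost
  simp_rw [this]
  rw [Finset.sum_add_distrib, Finset.sum_add_distrib, ← Finset.mul_sum, h]
  simp

theorem coordCost_avg_le (I : Data) (A : Finset ℕ) (j : ℕ) (c : ℝ) :
    I.coordCost A j (I.avg A j) ≤ I.coordCost A j c := by
  rw [I.coordCost_eq A j c]
  have : 0 ≤ ((I.having A j).card : ℝ) * (c - I.avg A j) ^ 2 := by positivity
  linarith

open Classical in
/-- The increase of the cost in the coordinate `j` when the sample mean replaces the mean, for samples
at least half of which have the entry `j`. -/
noncomputable def excess (I : Data) (A : Finset ℕ) {s : ℕ} (σ : Fin s → ℕ) (j : ℕ) : ℝ :=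
  if s ≤ 2 * I.cnt σ j then (I.having A j).card * (I.mean σ j - I.avg A j) ^ 2 else 0

theorem excess_nonneg (I : Data) (A : Finset ℕ) {s : ℕ} (σ : Fin s → ℕ) (j : ℕ) :
    0 ≤ I.excess A σ j := by
  unfold excess; split_ifs <;> positivity

open Classical in
-- Let `y` be the deviation from the mean, set to `0` at points without the entry. It is centered on
-- all of `A`, so samples may be drawn from `A` although some of its points miss the entry. The
-- deviation of the sample mean is the sum of the `y` divided by the number of present entries, and
-- the variance identity applies to the numerator.
theorem sum_excess_le (I : Data) (A : Finset ℕ) (s : ℕ) (hs : 0 < s) (j : ℕ) :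
    ∑ σ : Fin s → A, I.excess A (fun k => (σ k : ℕ)) j ≤
      (A.card : ℝ) ^ s * (4 / s * I.coordCost A j (I.avg A j)) := by
  set μ := I.avg A j with hμ
  set y : A → ℝ := fun x => if I.pr x j then I.v x j - μ else 0 with hy
  have hsum (g : ℕ → ℝ) : ∑ x : A, (if I.pr x j then g x else 0) = ∑ x ∈ I.having A j, g x := by
    rw [Finset.sum_coe_sort A (fun x => if I.pr x j then g x else 0), having, Finset.sum_filter]
  have hy0 : ∑ x, y x = 0 := (hsum fun x => I.v x j - μ).trans (I.sum_sub_avg A j)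
  have hy2 : ∑ x, y x ^ 2 = I.coordCost A j μ := by
    rw [coordCost, ← hsum fun x => (I.v x j - μ) ^ 2]
    refine Finset.sum_congr rfl fun x _ => ?_
    simp only [hy]; split_ifs <;> simp
  have hsR : (0 : ℝ) < s := by exact_mod_cast hs
  have hpt (σ : Fin s → A) : I.excess A (fun k => (σ k : ℕ)) j ≤
      A.card * (4 / (s : ℝ) ^ 2 * (0 + ∑ k, y (σ k)) ^ 2) := by
    unfold excess
    split_ifs with hc
    · have hcr : (s : ℝ) ≤ 2 * I.cnt (fun k => (σ k : ℕ)) j := by exact_mod_cast hc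
      set N : ℝ := ((I.cnt (fun k => (σ k : ℕ)) j : ℕ) : ℝ) with hN
      have hNpos : 0 < N := by linarith
      have hm : I.mean (fun k => (σ k : ℕ)) j - μ = (∑ k, y (σ k)) / N := by
        rw [mean, ← hN, eq_div_iff hNpos.ne', sub_mul, div_mul_cancel₀ _ hNpos.ne']
        have : μ * N = ∑ k : Fin s, if I.pr (σ k) j then μ else 0 := by
          rw [hN, cnt, ← Finset.sum_filter, Finset.sum_const, nsmul_eq_mul, mul_comm]
        rw [this, ← Finset.sum_sub_distrib]
        refine Finset.sum_congr rfl fun k _ => ?_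
        simp only [hy]; split_ifs <;> simp
      rw [hm, zero_add]
      have hle : ((I.having A j).card : ℝ) ≤ A.card := by
        exact_mod_cast Finset.card_filter_le _ _
      -- The factor `4` is the price of dividing by `N ≥ s / 2` instead of `s`.
      have h2 : ((∑ k, y (σ k)) / N) ^ 2 ≤ 4 / (s : ℝ) ^ 2 * (∑ k, y (σ k)) ^ 2 := by
        rw [div_pow, div_mul_eq_mul_div, div_le_div_iff₀ (by positivity) (by positivity)]
        have : (s : ℝ) ^ 2 ≤ 4 * N ^ 2 := by nlinarith
        nlinarith [sq_nonneg (∑ k, y (σ k))]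
      gcongr
    · positivity
  have key := sum_sq_add_tuple y hy0 s 0
  rw [Fintype.card_coe, hy2] at key
  calc _ ≤ ∑ σ : Fin s → A, A.card * (4 / (s : ℝ) ^ 2 * (0 + ∑ k, y (σ k)) ^ 2) :=
        Finset.sum_le_sum fun σ _ => hpt σ
    _ = 4 / (s : ℝ) ^ 2 * (A.card * ∑ σ : Fin s → A, (0 + ∑ k, y (σ k)) ^ 2) := by
        rw [← Finset.mul_sum, ← Finset.mul_sum]; ring
    _ = _ := by rw [key]; field_simp; ring

open Classical in
/-- At least half of the samples have small total excess. -/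
theorem card_good_samples (I : Data) (A J : Finset ℕ) (s : ℕ) (hs : 0 < s) :
    A.card ^ s ≤ 2 * (Finset.univ.filter fun σ : Fin s → A =>
      ∑ j ∈ J, I.excess A (fun k => (σ k : ℕ)) j ≤
        8 / s * ∑ j ∈ J, I.coordCost A j (I.avg A j)).card := by
  have h := card_le_two_mul_card_filter_of_sum_le
    (fun σ : Fin s → A => ∑ j ∈ J, I.excess A (fun k => (σ k : ℕ)) j)
    (fun σ => Finset.sum_nonneg fun j _ => I.excess_nonneg _ _ _)
    (4 / s * ∑ j ∈ J, I.coordCost A j (I.avg A j))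
    (mul_nonneg (by positivity) (Finset.sum_nonneg fun j _ => I.coordCost_nonneg _ _ _)) (by
      rw [Finset.sum_comm, Finset.mul_sum, Finset.mul_sum]
      refine Finset.sum_le_sum fun j _ => ?_
      simpa using I.sum_excess_le A s hs j)
  have e : ∀ x : ℝ, 2 * (4 / s * x) = 8 / s * x := fun x => by ring
  simp only [e, Fintype.card_fun, Fintype.card_coe, Fintype.card_fin] at h
  exact h

end Data

/-! ### Ranks in a finite set -/

open Classical in
-- The rank is strictly increasing in the key, hence injective on `F`, and it takes values between
-- `1` and the size of `F`.
theorem image_rank_eq_Icc {α : Type*} [LinearOrder α] (F : Finset ℕ) (key : ℕ → α)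
    (hkey : Function.Injective key) :
    F.image (fun p => (F.filter fun x => key x ≤ key p).card) = Finset.Icc 1 F.card := by
  have hinj : Set.InjOn (fun p => (F.filter fun x => key x ≤ key p).card) F := by
    have mono : ∀ p ∈ F, ∀ p' ∈ F, key p < key p' →
        (F.filter fun x => key x ≤ key p).card < (F.filter fun x => key x ≤ key p').card := by
      intro p hp p' hp' h
      refine Finset.card_lt_card ⟨fun x hx => ?_, fun hsub => ?_⟩
      · rw [Finset.mem_filter] at hx ⊢
        exact ⟨hx.1, hx.2.trans h.le⟩
      · have := hsub (Finset.mem_filter.2 ⟨hp', le_rfl⟩)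
        rw [Finset.mem_filter] at this
        exact absurd this.2 (not_le.2 h)
    intro p hp p' hp' h
    by_contra hne
    rcases lt_trichotomy (key p) (key p') with hlt | heq | hgt
    · exact absurd h (mono p hp p' hp' hlt).ne
    · exact hne (hkey heq)
    · exact absurd h (mono p' hp' p hp hgt).ne'
  refine Finset.eq_of_subset_of_card_le ?_ ?_
  · intro k hk
    obtain ⟨p, hp, rfl⟩ := Finset.mem_image.1 hk
    rw [Finset.mem_Icc]
    exact ⟨Finset.card_pos.2 ⟨p, Finset.mem_filter.2 ⟨hp, le_rfl⟩⟩, Finset.card_filter_le _ _⟩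
  · rw [Finset.card_image_of_injOn hinj]; simp

open Classical in
-- Each central rank is attained, and there are enough of them. The `+ 1` in the upper limit matters
-- for `r = 1`, where otherwise no rank would qualify and the last point could never be removed.
theorem card_central_rank {α : Type*} [LinearOrder α] (F : Finset ℕ) (key : ℕ → α)
    (hkey : Function.Injective key) (r : ℕ) (hr : 0 < r) (hF : ∀ k, 8 * k ≤ 7 * r + 1 → k ≤ F.card) :
    r ≤ 2 * (F.filter fun p => r ≤ 8 * (F.filter fun x => key x ≤ key p).card ∧
      8 * (F.filter fun x => key x ≤ key p).card ≤ 7 * r + 1).card := by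
  have hsub : Finset.Icc ((r + 7) / 8) ((7 * r + 1) / 8) ⊆
      (F.filter fun p => r ≤ 8 * (F.filter fun x => key x ≤ key p).card ∧
        8 * (F.filter fun x => key x ≤ key p).card ≤ 7 * r + 1).image
        (fun p => (F.filter fun x => key x ≤ key p).card) := by
    intro k hk
    rw [Finset.mem_Icc] at hk
    have hk' : k ∈ F.image (fun p => (F.filter fun x => key x ≤ key p).card) := by
      rw [image_rank_eq_Icc F key hkey, Finset.mem_Icc]
      exact ⟨by omega, hF k (by omega)⟩
    obtain ⟨p, hp, rfl⟩ := Finset.mem_image.1 hk'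
    exact Finset.mem_image.2 ⟨p, Finset.mem_filter.2 ⟨hp, by omega, by omega⟩, rfl⟩
  have h1 := (Finset.card_le_card hsub).trans Finset.card_image_le
  rw [Nat.card_Icc] at h1
  omega

/-! ### Partial solutions, learning and pruning -/

/-- A partial solution: the points not yet assigned, the known coordinates of the two centers, their
values, and the cost of the assigned points. -/
structure View where
  R : List ℕ
  kn : ℕ → ℕ → Prop
  u : ℕ → ℕ → ℝ
  b : ℝ

/-- What the search aims at: an optimal partition with its centers, and the accuracy `1 / q`. -/
structure Goal where
  q : ℕ
  Δ : ℕ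
  l : ℕ → ℕ
  c : ℕ → ℕ → ℝ

namespace Data

open Classical in
/-- The squared distance of the point `x` to the center `c`. -/
noncomputable def cst (I : Data) (c : ℕ → ℝ) (x : ℕ) : ℝ :=
  ∑ j ∈ Finset.range I.d, if I.pr x j then (I.v x j - c j) ^ 2 else 0

/-- The point `x` can be assigned to the center `t`: the coordinates it needs are known. -/
def Asg (I : Data) (W : View) (t x : ℕ) : Prop := ∀ j < I.d, I.pr x j → W.kn t j

def Okx (I : Data) (W : View) (x : ℕ) : Prop := I.Asg W 0 x ∨ I.Asg W 1 x

open Classical in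
/-- The cost of the best possible assignment of `x`. -/
noncomputable def wgt (I : Data) (W : View) (x : ℕ) : ℝ :=
  if I.Asg W 0 x then
    if I.Asg W 1 x ∧ I.cst (W.u 1) x ≤ I.cst (W.u 0) x then I.cst (W.u 1) x else I.cst (W.u 0) x
  else I.cst (W.u 1) x

/-- `x` is assignable and does not come after `p` in the order by weight. -/
def Bef (I : Data) (W : View) (x p : ℕ) : Prop :=
  I.Okx W x ∧ I.wgt W x ≤ I.wgt W p ∧ ¬ (I.wgt W p ≤ I.wgt W x ∧ p < x)

open Classical in
noncomputable def rank (I : Data) (W : View) (p : ℕ) : ℕ :=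
  (W.R.toFinset.filter fun x => I.Bef W x p).card

def GoodPivot (I : Data) (W : View) (p : ℕ) : Prop :=
  I.Okx W p ∧ W.R.toFinset.card ≤ 8 * I.rank W p ∧ 8 * I.rank W p ≤ 7 * W.R.toFinset.card + 1

open Classical in
/-- Assign the points up to the pivot `p`. -/
noncomputable def peel (I : Data) (W : View) (p : ℕ) : View where
  R := W.R.filter fun x => decide (¬ I.Bef W x p)
  kn := W.kn
  u := W.u
  b := W.b + ∑ x ∈ W.R.toFinset.filter (fun x => I.Bef W x p), I.wgt W x

open Classical in
/-- The number of the unknown coordinates below `j` of the center `t`. -/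
noncomputable def unl (W : View) (t j : ℕ) : ℕ := ((Finset.range j).filter fun i => ¬ W.kn t i).card

/-- The coordinate `j` of the center `t` is learned from the sample `σ`. -/
def Learns (I : Data) (W : View) (t h : ℕ) {s : ℕ} (σ : Fin s → ℕ) (j : ℕ) : Prop :=
  j < I.d ∧ ¬ W.kn t j ∧ (h = 0 ∨ h = unl W t j + 1) ∧ s ≤ 2 * I.cnt σ j

open Classical in
noncomputable def learn (I : Data) (W : View) (t h : ℕ) {s : ℕ} (σ : Fin s → ℕ) : View where
  R := W.R
  kn t' j := W.kn t' j ∨ (t' = t ∧ I.Learns W t h σ j)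
  u t' j := if t' = t ∧ I.Learns W t h σ j then I.mean σ j else W.u t' j
  b := W.b

open Classical in
noncomputable def coef (G : Goal) (f : ℕ → Prop) (t : ℕ) : ℝ :=
  if f t then 1 + 1 / (8 * G.q) else 1 + 1 / (4 * G.q)

open Classical in
/-- The prospective cost of the point `x`. -/
noncomputable def kap (I : Data) (G : Goal) (f : ℕ → Prop) (W : View) (x : ℕ) : ℝ :=
  ∑ j ∈ Finset.range I.d, if I.pr x j then
    (if W.kn (G.l x) j then (I.v x j - W.u (G.l x) j) ^ 2
      else coef G f (G.l x) * (I.v x j - G.c (G.l x) j) ^ 2) else 0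

/-- The point is assignable to its own center, at a cost of at least `w`. -/
def Heavy (I : Data) (G : Goal) (W : View) (w : ℝ) (x : ℕ) : Prop :=
  I.Asg W (G.l x) x ∧ w ≤ I.cst (W.u (G.l x)) x

open Classical in
/-- The partial solution can be completed to one of cost `tgt` by learning `k` times. The flag `f t`
tells that the center `t` has been learned from before. -/
structure OnTrack (I : Data) (G : Goal) (tgt : ℝ) (f : ℕ → Prop) (k : ℕ) (W : View) : Prop where
  none_known : ∀ t < 2, ¬ f t → ∀ j < I.d, ¬ W.kn t j
  few_unknown : ∀ t < 2, f t → unl W t I.d ≤ 2 * G.Δ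
  measure_le : ∑ t ∈ Finset.range 2, (if f t then unl W t I.d else 2 * G.Δ + 1) ≤ k
  potential : ∃ D ρ w : ℝ, 0 ≤ w ∧ D ≤ ρ * w / (1024 * G.q) ∧ ρ ≤ 16 * W.R.toFinset.card ∧
    (0 < D → ((W.R.toFinset.filter fun x => ¬ I.Heavy G W w x).card : ℝ) ≤ ρ / (1024 * G.q)) ∧
    W.b + (1 + 1 / (4 * G.q)) * ∑ x ∈ W.R.toFinset, I.kap G f W x ≤ tgt + D

/-- The unassigned points of the cluster `t`. -/
noncomputable def cluster (G : Goal) (W : View) (t : ℕ) : Finset ℕ :=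
  W.R.toFinset.filter fun x => G.l x = t

/-- A constant fraction of the unassigned points is informative. -/
def Learnable (I : Data) (G : Goal) (f : ℕ → Prop) (W : View) : Prop :=
  ∃ t < 2, (¬ f t ∧ W.R.toFinset.card ≤ 4096 * G.Δ * G.q * (cluster G W t).card) ∨
    (f t ∧ ∃ j < I.d, ¬ W.kn t j ∧
      W.R.toFinset.card ≤ 4096 * G.Δ * G.q * (I.having (cluster G W t) j).card)

/-! ### Costs, weights, and the analysis of peeling. -/

theorem cst_nonneg (I : Data) (c : ℕ → ℝ) (x : ℕ) : 0 ≤ I.cst c x :=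
  Finset.sum_nonneg fun j _ => by split_ifs <;> positivity

theorem coef_nonneg (G : Goal) (f : ℕ → Prop) (t : ℕ) : 0 ≤ coef G f t := by
  unfold coef; split_ifs <;> positivity

theorem kap_nonneg (I : Data) (G : Goal) (f : ℕ → Prop) (W : View) (x : ℕ) : 0 ≤ I.kap G f W x :=
  Finset.sum_nonneg fun j _ => by
    have := coef_nonneg G f (G.l x)
    split_ifs <;> positivity

theorem kap_eq_cst {I : Data} {G : Goal} (f : ℕ → Prop) {W : View} {x : ℕ}
    (h : I.Asg W (G.l x) x) : I.kap G f W x = I.cst (W.u (G.l x)) x := by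
  refine Finset.sum_congr rfl fun j hj => ?_
  split_ifs with h1 h2
  · rfl
  · exact absurd (h j (Finset.mem_range.1 hj) h1) h2
  · rfl

theorem cst_congr {I : Data} {W : View} {t x : ℕ} (h : I.Asg W t x) {c c' : ℕ → ℝ}
    (hc : ∀ j < I.d, W.kn t j → c j = c' j) : I.cst c x = I.cst c' x := by
  refine Finset.sum_congr rfl fun j hj => ?_
  split_ifs with h1
  · rw [hc j (Finset.mem_range.1 hj) (h j (Finset.mem_range.1 hj) h1)]
  · rfl

theorem wgt_le_of_asg {I : Data} {W : View} {t x : ℕ} (ht : t < 2) (h : I.Asg W t x) :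
    I.wgt W x ≤ I.cst (W.u t) x := by
  unfold wgt
  interval_cases t
  · split_ifs with h1
    · exact h1.2
    · exact le_rfl
  · split_ifs with h1 h2
    · exact le_rfl
    · have : ¬ I.cst (W.u 1) x ≤ I.cst (W.u 0) x := fun h' => h2 ⟨h, h'⟩
      exact (not_le.1 this).le
    · exact le_rfl

theorem exists_wgt_eq {I : Data} {W : View} {x : ℕ} (h : I.Okx W x) :
    ∃ t < 2, I.Asg W t x ∧ I.wgt W x = I.cst (W.u t) x := by
  unfold wgt
  split_ifs with h0 h1
  · exact ⟨1, by norm_num, h1.1, rfl⟩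
  · exact ⟨0, by norm_num, h0, rfl⟩
  · exact ⟨1, by norm_num, h.resolve_left h0, rfl⟩

theorem wgt_nonneg (I : Data) (W : View) (x : ℕ) : 0 ≤ I.wgt W x := by
  unfold wgt; split_ifs <;> exact I.cst_nonneg _ _

theorem okx_of_asg {I : Data} {W : View} {t x : ℕ} (ht : t < 2) (h : I.Asg W t x) : I.Okx W x := by
  interval_cases t
  · exact .inl h
  · exact .inr h

/-- This is why the potential asks for `ρ ≤ 16 * |R|`: with no point left, `ρ ≤ 0`, so the debt `D`
is not positive. -/
theorem OnTrack.le_of_nil {I : Data} {G : Goal} {tgt : ℝ} {f : ℕ → Prop} {k : ℕ} {W : View}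
    (h : I.OnTrack G tgt f k W) (hR : W.R = []) : W.b ≤ tgt := by
  obtain ⟨D, ρ, w, hw, hD, hρ, -, hb⟩ := h.potential
  simp only [hR, List.toFinset_nil, Finset.card_empty, Nat.cast_zero, mul_zero, Finset.sum_empty,
    add_zero] at hρ hb
  have : ρ * w / (1024 * G.q) ≤ 0 :=
    div_nonpos_of_nonpos_of_nonneg (mul_nonpos_of_nonpos_of_nonneg hρ hw) (by positivity)
  linarith

open Classical in
/-- The points that cannot be assigned to their own cluster yet are few unless one can learn. -/
theorem card_undetermined_le {I : Data} {G : Goal} {tgt : ℝ} {f : ℕ → Prop} {k : ℕ} {W : View}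
    (h : I.OnTrack G tgt f k W) (hl : ∀ x, G.l x < 2) (hΔ : 1 ≤ G.Δ) (hL : ¬ I.Learnable G f W) :
    1024 * G.q * (W.R.toFinset.filter fun x => ¬ I.Asg W (G.l x) x).card ≤ W.R.toFinset.card := by
  set r := W.R.toFinset.card with hr
  set a := 4096 * G.Δ * G.q with ha
  -- For a center already learned from, an undetermined point has one of the at most `2 * Δ` unknown
  -- coordinates, each of which few points of the cluster have. For a center never learned from, the
  -- whole cluster is small.
  have hpart : ∀ t < 2, a * ((W.R.toFinset.filter fun x => ¬ I.Asg W (G.l x) x).filter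
      fun x => G.l x = t).card ≤ 2 * G.Δ * r := by
    intro t ht
    have hL' := hL
    unfold Learnable at hL'
    push Not at hL'
    obtain ⟨h1, h2⟩ := hL' t ht
    by_cases hf : f t
    · have hsub : (W.R.toFinset.filter fun x => ¬ I.Asg W (G.l x) x).filter (fun x => G.l x = t) ⊆
          ((Finset.range I.d).filter fun i => ¬ W.kn t i).biUnion
            fun j => I.having (cluster G W t) j := by
        intro x hx
        simp only [Finset.mem_filter, Asg, not_forall] at hx
        obtain ⟨⟨hxR, j, hj, hp, hk⟩, hlx⟩ := hx
        rw [hlx] at hk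
        exact Finset.mem_biUnion.2 ⟨j, Finset.mem_filter.2 ⟨Finset.mem_range.2 hj, hk⟩,
          Finset.mem_filter.2 ⟨Finset.mem_filter.2 ⟨hxR, hlx⟩, hp⟩⟩
      have h3 := (Finset.card_le_card hsub).trans Finset.card_biUnion_le
      calc _ ≤ a * ∑ j ∈ (Finset.range I.d).filter (fun i => ¬ W.kn t i),
            (I.having (cluster G W t) j).card := Nat.mul_le_mul_left _ h3
        _ = ∑ j ∈ (Finset.range I.d).filter (fun i => ¬ W.kn t i),
            a * (I.having (cluster G W t) j).card := Finset.mul_sum _ _ _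
        _ ≤ ∑ j ∈ (Finset.range I.d).filter (fun i => ¬ W.kn t i), r := by
            refine Finset.sum_le_sum fun j hj => ?_
            rw [Finset.mem_filter, Finset.mem_range] at hj
            exact (h2 hf j hj.1 hj.2).le
        _ = unl W t I.d * r := by rw [Finset.sum_const, smul_eq_mul]; rfl
        _ ≤ _ := Nat.mul_le_mul_right _ (h.few_unknown t ht hf)
    · have hsub : (W.R.toFinset.filter fun x => ¬ I.Asg W (G.l x) x).filter (fun x => G.l x = t) ⊆
          cluster G W t := by
        intro x hx
        simp only [Finset.mem_filter] at hx
        exact Finset.mem_filter.2 ⟨hx.1.1, hx.2⟩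
      have h3 := Nat.mul_le_mul_left a (Finset.card_le_card hsub)
      have h4 := h1 hf
      nlinarith
  set U := W.R.toFinset.filter fun x => ¬ I.Asg W (G.l x) x with hU
  have hUc : U.card = (U.filter fun x => G.l x = 0).card + (U.filter fun x => G.l x = 1).card := by
    rw [← Finset.card_filter_add_card_filter_not (s := U) fun x => G.l x = 0]
    congr 2
    refine Finset.filter_congr fun x _ => ?_
    have := hl x
    omega
  have h0 := hpart 0 (by norm_num)
  have h1 := hpart 1 (by norm_num)
  have h5 : (4 * G.Δ) * (1024 * G.q * U.card) ≤ (4 * G.Δ) * r := by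
    rw [hUc]
    rw [ha] at h0 h1
    nlinarith
  exact Nat.le_of_mul_le_mul_left h5 (by omega)

/-- Breaking ties of the weight by the index makes the order linear with distinct keys, as the
counting of ranks requires. -/
theorem bef_iff (I : Data) (W : View) (x p : ℕ) :
    I.Bef W x p ↔ I.Okx W x ∧ toLex (I.wgt W x, x) ≤ toLex (I.wgt W p, p) := by
  unfold Bef
  rw [Prod.Lex.toLex_le_toLex]
  constructor
  · rintro ⟨h1, h2, h3⟩
    refine ⟨h1, ?_⟩
    rcases h2.lt_or_eq with h | h
    · exact .inl h
    · exact .inr ⟨h, not_lt.1 fun h' => h3 ⟨h.ge, h'⟩⟩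
  · rintro ⟨h1, h | ⟨h, h'⟩⟩
    · exact ⟨h1, h.le, fun h3 => absurd h3.1 (not_le.2 h)⟩
    · exact ⟨h1, le_of_eq h, fun h3 => absurd h3.2 (not_lt.2 h')⟩

open Classical in
-- All but a fraction `1/1024` of the points are assignable, so the assignable points realize every
-- central rank. A uniformly drawn unassigned point is then a good pivot with probability at least
-- `1/2`.
theorem card_goodPivot {I : Data} {G : Goal} {tgt : ℝ} {f : ℕ → Prop} {k : ℕ} {W : View}
    (h : I.OnTrack G tgt f k W) (hl : ∀ x, G.l x < 2) (hΔ : 1 ≤ G.Δ) (hq : 1 ≤ G.q)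
    (hL : ¬ I.Learnable G f W) (hR : 0 < W.R.toFinset.card) :
    W.R.toFinset.card ≤ 2 * (W.R.toFinset.filter fun p => I.GoodPivot W p).card := by
  have hU := card_undetermined_le h hl hΔ hL
  set F := W.R.toFinset.filter fun x => I.Okx W x with hF
  have hcard : W.R.toFinset.card ≤
      F.card + (W.R.toFinset.filter fun x => ¬ I.Asg W (G.l x) x).card := by
    rw [← Finset.card_filter_add_card_filter_not (s := W.R.toFinset) fun x => I.Okx W x]
    refine Nat.add_le_add_left (Finset.card_le_card fun x hx => ?_) _
    rw [Finset.mem_filter] at hx ⊢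
    exact ⟨hx.1, fun h' => hx.2 (okx_of_asg (hl x) h')⟩
  have hinj : Function.Injective fun x : ℕ => toLex (I.wgt W x, x) := fun x y hxy => by
    have := congrArg (fun z => (ofLex z).2) hxy
    simpa using this
  have key := card_central_rank F (fun x => toLex (I.wgt W x, x)) hinj _ hR (by
    intro k hk
    have : 1024 * (W.R.toFinset.filter fun x => ¬ I.Asg W (G.l x) x).card ≤ W.R.toFinset.card :=
      le_trans (by nlinarith [Nat.zero_le (W.R.toFinset.filter fun x => ¬ I.Asg W (G.l x) x).card]) hU
    omega)
  refine key.trans (Nat.mul_le_mul_left _ (Finset.card_le_card fun p hp => ?_))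
  have hrank : (F.filter fun x => toLex (I.wgt W x, x) ≤ toLex (I.wgt W p, p)).card =
      I.rank W p := by
    unfold rank
    rw [hF, Finset.filter_filter]
    congr 1
    exact Finset.filter_congr fun x _ => (I.bef_iff W x p).symm
  rw [Finset.mem_filter, hrank, hF, Finset.mem_filter] at hp
  exact Finset.mem_filter.2 ⟨hp.1.1, hp.1.2, hp.2⟩

open Classical in
theorem peel_toFinset (I : Data) (W : View) (p : ℕ) :
    (I.peel W p).R.toFinset = W.R.toFinset.filter fun x => ¬ I.Bef W x p := by
  ext x
  simp [peel]

open Classical in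
-- The old debt is repaid by the slack on the peeled points `B`, and a new debt is taken for the
-- points of `B` whose own center is not usable yet. The other points of `B` have a weight of at
-- most their prospective cost.
theorem OnTrack.peel {I : Data} {G : Goal} {tgt : ℝ} {f : ℕ → Prop} {k : ℕ} {W : View}
    (h : I.OnTrack G tgt f k W) (hl : ∀ x, G.l x < 2) (hΔ : 1 ≤ G.Δ) (hq : 1 ≤ G.q)
    (hL : ¬ I.Learnable G f W) {p : ℕ} (hp : I.GoodPivot W p) :
    I.OnTrack G tgt f k (I.peel W p) := by
  refine ⟨h.none_known, h.few_unknown, h.measure_le, ?_⟩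
  obtain ⟨D, ρ, w, hw, hD, hρ, hheavy, hb⟩ := h.potential
  have hUle := card_undetermined_le h hl hΔ hL
  set U := W.R.toFinset.filter fun x => ¬ I.Asg W (G.l x) x with hU
  set B := W.R.toFinset.filter fun x => I.Bef W x p with hB
  set R' := W.R.toFinset.filter fun x => ¬ I.Bef W x p with hR'
  set r := W.R.toFinset.card with hr
  have hsplit : B.card + R'.card = r := Finset.card_filter_add_card_filter_not _
  obtain ⟨-, hp1, hp2⟩ := hp
  change r ≤ 8 * B.card at hp1
  change 8 * B.card ≤ 7 * r + 1 at hp2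
  have hqR : (1 : ℝ) ≤ G.q := by exact_mod_cast hq
  have hkap (x : ℕ) : I.kap G f (I.peel W p) x = I.kap G f W x := rfl
  -- The new debt is what the prematurely assigned points cost, each at most the weight of the
  -- pivot. The new `ρ` is scaled so that `ρ / (1024 * q)` is the number of undetermined points.
  refine ⟨∑ x ∈ B.filter (fun x => ¬ I.Asg W (G.l x) x), I.wgt W x, 1024 * G.q * U.card, I.wgt W p,
    I.wgt_nonneg W p, ?_, ?_, ?_, ?_⟩
  · have h1 : ∑ x ∈ B.filter (fun x => ¬ I.Asg W (G.l x) x), I.wgt W x ≤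
        (B.filter fun x => ¬ I.Asg W (G.l x) x).card * I.wgt W p := by
      rw [← nsmul_eq_mul]
      refine Finset.sum_le_card_nsmul _ _ _ fun x hx => ?_
      rw [Finset.mem_filter, hB, Finset.mem_filter] at hx
      exact hx.1.2.2.1
    have h2 : (B.filter fun x => ¬ I.Asg W (G.l x) x).card ≤ U.card := by
      refine Finset.card_le_card fun x hx => ?_
      rw [Finset.mem_filter, hB, Finset.mem_filter] at hx
      exact Finset.mem_filter.2 ⟨hx.1.1, hx.2⟩
    have h3 : ((B.filter fun x => ¬ I.Asg W (G.l x) x).card : ℝ) ≤ U.card := by exact_mod_cast h2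
    have h4 := mul_le_mul_of_nonneg_right h3 (I.wgt_nonneg W p)
    have h5 : 1024 * (G.q : ℝ) * U.card * I.wgt W p / (1024 * G.q) = U.card * I.wgt W p := by
      field_simp
    rw [h5]
    exact h1.trans h4
  · rw [peel_toFinset, ← hR']
    -- The left side is at most `r`. If it is not zero then `r ≥ 1024`, so the rounding in `8 * |R'|
    -- ≥ r - 1` is harmless.
    have : 1024 * G.q * U.card ≤ 16 * R'.card := by
      rcases Nat.eq_zero_or_pos U.card with h0 | h0
      · rw [h0]; omega
      · have : 1024 ≤ 1024 * G.q * U.card := by nlinarith [Nat.mul_le_mul hq h0]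
        omega
    exact_mod_cast this
  · intro _
    rw [peel_toFinset, ← hR', mul_div_cancel_left₀ _ (by positivity)]
    -- A remaining point that could go to its own center comes after the pivot, so its cost there is
    -- at least the weight of the pivot: it is heavy.
    refine Nat.cast_le.2 (Finset.card_le_card fun x hx => ?_)
    rw [Finset.mem_filter, hR', Finset.mem_filter] at hx
    refine Finset.mem_filter.2 ⟨hx.1.1, fun hasg => hx.2 ⟨hasg, ?_⟩⟩
    have hnb := hx.1.2
    have hle := wgt_le_of_asg (hl x) hasg
    change I.wgt W p ≤ I.cst (W.u (G.l x)) x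
    refine le_trans ?_ hle
    by_contra hc
    exact hnb ⟨okx_of_asg (hl x) hasg, (not_le.1 hc).le, fun h' => hc h'.1⟩
  · rw [peel_toFinset, ← hR']
    simp only [hkap]
    have hsum : ∑ x ∈ W.R.toFinset, I.kap G f W x = ∑ x ∈ B, I.kap G f W x + ∑ x ∈ R', I.kap G f W x :=
      (Finset.sum_filter_add_sum_filter_not _ _ _).symm
    have hBw : ∑ x ∈ B, I.wgt W x = ∑ x ∈ B.filter (fun x => ¬ I.Asg W (G.l x) x), I.wgt W x +
        ∑ x ∈ B.filter (fun x => I.Asg W (G.l x) x), I.wgt W x := by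
      rw [add_comm]; exact (Finset.sum_filter_add_sum_filter_not _ _ _).symm
    have hBk : ∑ x ∈ B.filter (fun x => I.Asg W (G.l x) x), I.wgt W x ≤ ∑ x ∈ B, I.kap G f W x := by
      calc _ ≤ ∑ x ∈ B.filter (fun x => I.Asg W (G.l x) x), I.kap G f W x := by
            refine Finset.sum_le_sum fun x hx => ?_
            rw [Finset.mem_filter] at hx
            rw [kap_eq_cst f hx.2]
            exact wgt_le_of_asg (hl x) hx.2
        _ ≤ _ := Finset.sum_le_sum_of_subset_of_nonneg (Finset.filter_subset _ _)
            fun x _ _ => I.kap_nonneg G f W x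
    have hDk : D ≤ 1 / (4 * G.q) * ∑ x ∈ B, I.kap G f W x := by
      rcases le_or_gt D 0 with hD0 | hD0
      · exact hD0.trans (mul_nonneg (by positivity)
          (Finset.sum_nonneg fun x _ => I.kap_nonneg G f W x))
      replace hheavy := hheavy hD0
      have hheavyB : (B.card : ℝ) ≤ (B.filter fun x => I.Heavy G W w x).card + ρ / (1024 * G.q) := by
        have h1 := Finset.card_filter_add_card_filter_not (s := B) fun x => I.Heavy G W w x
        have h2 : (B.filter fun x => ¬ I.Heavy G W w x).card ≤
            (W.R.toFinset.filter fun x => ¬ I.Heavy G W w x).card :=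
          Finset.card_le_card (Finset.filter_subset_filter _ (Finset.filter_subset _ _))
        have h3 : (B.card : ℝ) ≤ (B.filter fun x => I.Heavy G W w x).card +
            (W.R.toFinset.filter fun x => ¬ I.Heavy G W w x).card := by
          exact_mod_cast (by omega)
        linarith
      have hρ0 : 0 ≤ ρ := by
        by_contra hneg
        have : ρ / (1024 * G.q) < 0 := div_neg_of_neg_of_pos (not_le.1 hneg) (by positivity)
        have h0 : (0 : ℝ) ≤ (W.R.toFinset.filter fun x => ¬ I.Heavy G W w x).card := by positivity
        linarith
      have hρq : ρ / (1024 * G.q) ≤ ρ / 1024 := by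
        apply div_le_div_of_nonneg_left hρ0 (by norm_num); linarith
      have hBr : (r : ℝ) ≤ 8 * B.card := by exact_mod_cast hp1
      -- From `|B| ≥ r / 8 ≥ ρ / 128`, with at most `ρ / 1024` of these points not heavy.
      have hcount : ρ / 256 ≤ (B.filter fun x => I.Heavy G W w x).card := by linarith
      have hkB : ρ / 256 * w ≤ ∑ x ∈ B, I.kap G f W x := by
        calc ρ / 256 * w ≤ (B.filter fun x => I.Heavy G W w x).card * w :=
              mul_le_mul_of_nonneg_right hcount hw
          _ = ∑ _x ∈ B.filter (fun x => I.Heavy G W w x), w := by rw [Finset.sum_const, nsmul_eq_mul]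
          _ ≤ ∑ x ∈ B.filter (fun x => I.Heavy G W w x), I.kap G f W x := by
              refine Finset.sum_le_sum fun x hx => ?_
              rw [Finset.mem_filter] at hx
              rw [kap_eq_cst f hx.2.1]
              exact hx.2.2
          _ ≤ _ := Finset.sum_le_sum_of_subset_of_nonneg (Finset.filter_subset _ _)
              fun x _ _ => I.kap_nonneg G f W x
      refine hD.trans ?_
      have h1 : ρ * w / (1024 * G.q) = 1 / (4 * G.q) * (ρ / 256 * w) := by field_simp; ring
      rw [h1]
      exact mul_le_mul_of_nonneg_left hkB (by positivity)
    rw [hsum] at hb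
    change W.b + ∑ x ∈ B, I.wgt W x + _ ≤ _
    rw [hBw]
    have e : (1 + 1 / (4 * (G.q : ℝ))) * (∑ x ∈ B, I.kap G f W x + ∑ x ∈ R', I.kap G f W x) =
        ∑ x ∈ B, I.kap G f W x + 1 / (4 * G.q) * ∑ x ∈ B, I.kap G f W x +
        (1 + 1 / (4 * (G.q : ℝ))) * ∑ x ∈ R', I.kap G f W x := by ring
    rw [e] at hb
    linarith

end Data

namespace Data

/-! ### The analysis of learning. -/

theorem having_having (I : Data) (A : Finset ℕ) (j : ℕ) :
    I.having (I.having A j) j = I.having A j := by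
  ext x; simp [having]

theorem coordCost_having (I : Data) (A : Finset ℕ) (j : ℕ) (c : ℝ) :
    I.coordCost (I.having A j) j c = I.coordCost A j c := by
  unfold coordCost; rw [having_having]

theorem coordCost_mean {I : Data} {A : Finset ℕ} {s : ℕ} {σ : Fin s → ℕ} {j : ℕ}
    (h : s ≤ 2 * I.cnt σ j) :
    I.coordCost A j (I.mean σ j) = I.coordCost A j (I.avg A j) + I.excess A σ j := by
  rw [I.coordCost_eq A j (I.mean σ j), excess, if_pos h]

open Classical in
-- Summing by coordinates instead of points reduces the effect of learning to one inequality per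
-- coordinate.
theorem sum_kap_cluster (I : Data) (G : Goal) (f : ℕ → Prop) (W W' : View) (t : ℕ) :
    ∑ x ∈ cluster G W t, I.kap G f W' x = ∑ j ∈ Finset.range I.d,
      if W'.kn t j then I.coordCost (cluster G W t) j (W'.u t j)
      else coef G f t * I.coordCost (cluster G W t) j (G.c t j) := by
  unfold kap
  rw [Finset.sum_comm]
  refine Finset.sum_congr rfl fun j _ => ?_
  have h : ∀ x ∈ cluster G W t, (if I.pr x j then
      (if W'.kn (G.l x) j then (I.v x j - W'.u (G.l x) j) ^ 2
        else coef G f (G.l x) * (I.v x j - G.c (G.l x) j) ^ 2) else 0) =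
      if I.pr x j then (if W'.kn t j then (I.v x j - W'.u t j) ^ 2
        else coef G f t * (I.v x j - G.c t j) ^ 2) else 0 := by
    intro x hx
    rw [cluster, Finset.mem_filter] at hx
    rw [hx.2]
  rw [Finset.sum_congr rfl h, ← Finset.sum_filter]
  change ∑ x ∈ I.having (cluster G W t) j, _ = _
  split_ifs
  · rfl
  · rw [coordCost, Finset.mul_sum]

open Classical in
theorem learn_kap_of_ne {I : Data} {G : Goal} {f : ℕ → Prop} {W : View} {t h s : ℕ}
    {σ : Fin s → ℕ} {x : ℕ} (hx : G.l x ≠ t) :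
    I.kap G (fun t' => f t' ∨ t' = t) (I.learn W t h σ) x = I.kap G f W x := by
  unfold kap coef
  refine Finset.sum_congr rfl fun j _ => ?_
  simp [learn, hx]

theorem asg_learn {I : Data} {W : View} {t h s : ℕ} {σ : Fin s → ℕ} {t' x : ℕ}
    (hx : I.Asg W t' x) : I.Asg (I.learn W t h σ) t' x := fun j hj hp => .inl (hx j hj hp)

theorem learn_u_of_kn {I : Data} {W : View} {t h s : ℕ} {σ : Fin s → ℕ} {t' j : ℕ}
    (hk : W.kn t' j) : (I.learn W t h σ).u t' j = W.u t' j := by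
  simp only [learn]
  rw [if_neg]
  rintro ⟨rfl, -, h2, -⟩
  exact h2 hk

open Classical in
/-- Learning preserves the potential if it does not increase the prospective cost of the cluster. -/
theorem potential_learn {I : Data} {G : Goal} {tgt : ℝ} {f : ℕ → Prop} {k : ℕ} {W : View}
    (ht : I.OnTrack G tgt f k W) {t h s : ℕ} {σ : Fin s → ℕ}
    (hle : ∑ x ∈ cluster G W t, I.kap G (fun t' => f t' ∨ t' = t) (I.learn W t h σ) x ≤
      ∑ x ∈ cluster G W t, I.kap G f W x) :
    ∃ D ρ w : ℝ, 0 ≤ w ∧ D ≤ ρ * w / (1024 * G.q) ∧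
      ρ ≤ 16 * (I.learn W t h σ).R.toFinset.card ∧
      (0 < D → (((I.learn W t h σ).R.toFinset.filter fun x =>
        ¬ I.Heavy G (I.learn W t h σ) w x).card : ℝ) ≤ ρ / (1024 * G.q)) ∧
      (I.learn W t h σ).b + (1 + 1 / (4 * G.q)) * ∑ x ∈ (I.learn W t h σ).R.toFinset,
        I.kap G (fun t' => f t' ∨ t' = t) (I.learn W t h σ) x ≤ tgt + D := by
  obtain ⟨D, ρ, w, hw, hD, hρ, hheavy, hb⟩ := ht.potential
  refine ⟨D, ρ, w, hw, hD, hρ, ?_, ?_⟩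
  · intro hD0
    refine le_trans (Nat.cast_le.2 (Finset.card_le_card fun x hx => ?_)) (hheavy hD0)
    rw [Finset.mem_filter] at hx ⊢
    refine ⟨hx.1, fun hH => hx.2 ⟨asg_learn hH.1, ?_⟩⟩
    rw [cst_congr hH.1 (c' := W.u (G.l x)) fun j _ hk => learn_u_of_kn hk]
    exact hH.2
  · refine le_trans ?_ hb
    have h1 : ∑ x ∈ W.R.toFinset, I.kap G (fun t' => f t' ∨ t' = t) (I.learn W t h σ) x ≤
        ∑ x ∈ W.R.toFinset, I.kap G f W x := by
      rw [← Finset.sum_filter_add_sum_filter_not W.R.toFinset (fun x => G.l x = t),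
        ← Finset.sum_filter_add_sum_filter_not W.R.toFinset (fun x => G.l x = t)
          (fun x => I.kap G f W x)]
      refine add_le_add hle (le_of_eq (Finset.sum_congr rfl fun x hx => ?_))
      rw [Finset.mem_filter] at hx
      exact learn_kap_of_ne hx.2
    have h2 : (0 : ℝ) ≤ 1 + 1 / (4 * G.q) := by positivity
    have := mul_le_mul_of_nonneg_left h1 h2
    change W.b + _ ≤ _
    exact add_le_add_right this _

theorem unl_mono (W : View) (t : ℕ) : Monotone (unl W t) := fun i j hij => by
  classical
  unfold unl
  exact Finset.card_le_card (Finset.filter_subset_filter _ (Finset.range_mono hij))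

theorem unl_succ {W : View} {t j : ℕ} (h : ¬ W.kn t j) : unl W t (j + 1) = unl W t j + 1 := by
  classical
  unfold unl
  rw [Finset.range_add_one, Finset.filter_insert, if_pos h, Finset.card_insert_of_notMem]
  simp

theorem unl_succ_of_kn {W : View} {t j : ℕ} (h : W.kn t j) : unl W t (j + 1) = unl W t j := by
  classical
  unfold unl
  rw [Finset.range_add_one, Finset.filter_insert, if_neg (not_not.2 h)]

/-- An unknown coordinate is determined by its position among the unknown ones. Hence a number up to
`2 * Δ` suffices to guess it, instead of a number up to `d`. -/
theorem unl_inj {W : View} {t i j : ℕ} (hi : ¬ W.kn t i) (hj : ¬ W.kn t j)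
    (h : unl W t i = unl W t j) : i = j := by
  by_contra hne
  rcases lt_or_gt_of_ne hne with hlt | hlt
  · have := unl_mono W t (Nat.succ_le_of_lt hlt)
    rw [Nat.succ_eq_add_one, unl_succ hi] at this
    omega
  · have := unl_mono W t (Nat.succ_le_of_lt hlt)
    rw [Nat.succ_eq_add_one, unl_succ hj] at this
    omega

open Classical in
/-- Few coordinates are missing in more than half of the sample points. -/
theorem card_rare_le {I : Data} {Δ s : ℕ} (hs : 0 < s) (σ : Fin s → ℕ)
    (hmiss : ∀ k, ((Finset.range I.d).filter fun j => ¬ I.pr (σ k) j).card ≤ Δ) :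
    ((Finset.range I.d).filter fun j => ¬ s ≤ 2 * I.cnt σ j).card ≤ 2 * Δ := by
  set J := (Finset.range I.d).filter fun j => ¬ s ≤ 2 * I.cnt σ j with hJ
  have h1 : ∑ j ∈ Finset.range I.d, (Finset.univ.filter fun k => ¬ I.pr (σ k) j).card =
      ∑ k : Fin s, ((Finset.range I.d).filter fun j => ¬ I.pr (σ k) j).card := by
    simp_rw [Finset.card_filter]
    exact Finset.sum_comm
  have h2 : ∑ k : Fin s, ((Finset.range I.d).filter fun j => ¬ I.pr (σ k) j).card ≤ s * Δ := by
    calc _ ≤ ∑ _k : Fin s, Δ := Finset.sum_le_sum fun k _ => hmiss k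
      _ = s * Δ := by simp
  have h3 : J.card * s ≤ 2 * ∑ j ∈ J, (Finset.univ.filter fun k => ¬ I.pr (σ k) j).card := by
    rw [Finset.mul_sum, ← smul_eq_mul]
    refine Finset.card_nsmul_le_sum _ _ _ fun j hj => ?_
    rw [hJ, Finset.mem_filter] at hj
    have := Finset.card_filter_add_card_filter_not (s := (Finset.univ : Finset (Fin s)))
      fun k => I.pr (σ k) j
    rw [Finset.card_univ, Fintype.card_fin] at this
    have hc : I.cnt σ j = (Finset.univ.filter fun k => I.pr (σ k) j).card := rfl
    omega
  have h4 : ∑ j ∈ J, (Finset.univ.filter fun k => ¬ I.pr (σ k) j).card ≤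
      ∑ j ∈ Finset.range I.d, (Finset.univ.filter fun k => ¬ I.pr (σ k) j).card :=
    Finset.sum_le_sum_of_subset (Finset.filter_subset _ _)
  have h5 : s * J.card ≤ s * (2 * Δ) := by nlinarith
  exact Nat.le_of_mul_le_mul_left h5 hs

open Classical in
theorem sum_measure_lt {F F' : ℕ → ℕ} {t k : ℕ} (ht : t < 2) (hne : ∀ t' < 2, t' ≠ t → F' t' = F t')
    (hlt : F' t < F t) (h : ∑ t ∈ Finset.range 2, F t ≤ k) :
    1 ≤ k ∧ ∑ t ∈ Finset.range 2, F' t ≤ k - 1 := by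
  rw [Finset.sum_range_succ, Finset.sum_range_one] at h ⊢
  interval_cases t
  · have := hne 1 (by norm_num) (by norm_num); omega
  · have := hne 0 (by norm_num) (by norm_num); omega

open Classical in
theorem unl_learn_of_ne {I : Data} {W : View} {t h s : ℕ} {σ : Fin s → ℕ} {t' : ℕ} (ht : t' ≠ t)
    (j : ℕ) : unl (I.learn W t h σ) t' j = unl W t' j := by
  unfold unl
  congr 1
  refine Finset.filter_congr fun i _ => ?_
  simp [learn, ht]

open Classical in
/-- The first time one learns about the center `t`. -/
theorem OnTrack.learn_all {I : Data} {G : Goal} {tgt : ℝ} {f : ℕ → Prop} {k : ℕ} {W : View}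
    (h : I.OnTrack G tgt f k W) (hq : 1 ≤ G.q) {t : ℕ} (ht : t < 2) (hf : ¬ f t)
    (σ : Fin (64 * G.q) → ℕ)
    (hmiss : ∀ k, ((Finset.range I.d).filter fun j => ¬ I.pr (σ k) j).card ≤ G.Δ)
    (hσ : ∑ j ∈ Finset.range I.d, I.excess (cluster G W t) σ j ≤
      8 / (64 * G.q : ℕ) * ∑ j ∈ Finset.range I.d,
        I.coordCost (cluster G W t) j (I.avg (cluster G W t) j)) :
    1 ≤ k ∧ I.OnTrack G tgt (fun t' => f t' ∨ t' = t) (k - 1) (I.learn W t 0 σ) := by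
  have hnk := h.none_known t ht hf
  have hlearns (j : ℕ) (hj : j < I.d) : (I.learn W t 0 σ).kn t j ↔ 64 * G.q ≤ 2 * I.cnt σ j := by
    simp [learn, Learns, hnk j hj, hj]
  have hunl : unl (I.learn W t 0 σ) t I.d ≤ 2 * G.Δ := by
    refine le_trans (le_of_eq ?_) (card_rare_le (by omega) σ hmiss)
    unfold unl
    congr 1
    exact Finset.filter_congr fun j hj => by rw [hlearns j (Finset.mem_range.1 hj)]
  -- The value `2 * Δ + 1` for a center never learned from makes the measure drop also at this move,
  -- after which at most `2 * Δ` coordinates are unknown.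
  obtain ⟨hk, hmeas⟩ := sum_measure_lt ht (F := fun t' => if f t' then unl W t' I.d else 2 * G.Δ + 1)
    (F' := fun t' => if f t' ∨ t' = t then unl (I.learn W t 0 σ) t' I.d else 2 * G.Δ + 1)
    (fun t' _ hne => by simp [hne, unl_learn_of_ne hne]) (by simp [hf]; omega) h.measure_le
  refine ⟨hk, ?_, ?_, by convert hmeas, ?_⟩
  · intro t' ht' hnf j hj
    push Not at hnf
    simp [learn, hnf.2, h.none_known t' ht' hnf.1 j hj]
  · intro t' ht' hf'
    by_cases he : t' = t
    · exact he ▸ hunl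
    · rw [unl_learn_of_ne he]
      exact h.few_unknown t' ht' (hf'.resolve_right he)
  · refine potential_learn h ?_
    rw [sum_kap_cluster, sum_kap_cluster]
    set Y := cluster G W t with hY
    have hqR : (1 : ℝ) ≤ G.q := by exact_mod_cast hq
    have hO : ∑ j ∈ Finset.range I.d, I.coordCost Y j (I.avg Y j) ≤
        ∑ j ∈ Finset.range I.d, I.coordCost Y j (G.c t j) :=
      Finset.sum_le_sum fun j _ => I.coordCost_avg_le Y j _
    have hcoef : coef G (fun t' => f t' ∨ t' = t) t = 1 + 1 / (8 * G.q) := by simp [coef]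
    have hcoef' : coef G f t = 1 + 1 / (4 * G.q) := by simp [coef, hf]
    -- The coefficient before this move is `1 + 1 / (4 * q)`. Half of its surplus pays for the error
    -- of the sample means; the other half remains as the surplus of the coordinates still unknown.
    calc _ ≤ ∑ j ∈ Finset.range I.d, ((1 + 1 / (8 * G.q)) * I.coordCost Y j (G.c t j) +
          I.excess Y σ j) := by
          refine Finset.sum_le_sum fun j hj => ?_
          have hj' := Finset.mem_range.1 hj
          have hC := I.coordCost_nonneg Y j (G.c t j)
          have h1 : 0 ≤ 1 / (8 * (G.q : ℝ)) * I.coordCost Y j (G.c t j) := by positivity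
          split_ifs with hkn
          · have hc := (hlearns j hj').1 hkn
            have hu : (I.learn W t 0 σ).u t j = I.mean σ j := by
              simp [learn, Learns, hnk j hj', hj', hc]
            rw [hu, coordCost_mean hc]
            have := I.coordCost_avg_le Y j (G.c t j)
            linarith
          · rw [hcoef]
            have := I.excess_nonneg Y σ j
            linarith
      _ ≤ (1 + 1 / (8 * G.q)) * ∑ j ∈ Finset.range I.d, I.coordCost Y j (G.c t j) +
          1 / (8 * G.q) * ∑ j ∈ Finset.range I.d, I.coordCost Y j (G.c t j) := by
          rw [Finset.sum_add_distrib, ← Finset.mul_sum]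
          refine add_le_add_right (hσ.trans ?_) _
          -- This fixes the sample size `64 * q`.
          have e : (8 : ℝ) / (64 * G.q : ℕ) = 1 / (8 * G.q) := by push_cast; field_simp; norm_num
          rw [e]
          exact mul_le_mul_of_nonneg_left hO (by positivity)
      _ = (1 + 1 / (4 * G.q)) * ∑ j ∈ Finset.range I.d, I.coordCost Y j (G.c t j) := by
          field_simp; ring
      _ = _ := by
          rw [Finset.mul_sum]
          refine Finset.sum_congr rfl fun j hj => ?_
          rw [if_neg (hnk j (Finset.mem_range.1 hj)), hcoef']

open Classical in
/-- Learning one more coordinate `j` of the center `t`. -/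
theorem OnTrack.learn_one {I : Data} {G : Goal} {tgt : ℝ} {f : ℕ → Prop} {k : ℕ} {W : View}
    (h : I.OnTrack G tgt f k W) (hq : 1 ≤ G.q) {t : ℕ} (ht : t < 2) (hf : f t) {j : ℕ}
    (hj : j < I.d) (hkn : ¬ W.kn t j) (σ : Fin (64 * G.q) → ℕ) (hp : ∀ k, I.pr (σ k) j)
    (hσ : I.excess (I.having (cluster G W t) j) σ j ≤
      8 / (64 * G.q : ℕ) * I.coordCost (I.having (cluster G W t) j) j
        (I.avg (I.having (cluster G W t) j) j)) :
    1 ≤ k ∧ I.OnTrack G tgt (fun t' => f t' ∨ t' = t) (k - 1)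
      (I.learn W t (unl W t j + 1) σ) := by
  set W' := I.learn W t (unl W t j + 1) σ with hW'
  have hcnt : I.cnt σ j = 64 * G.q := by
    unfold cnt
    rw [Finset.filter_true_of_mem fun k _ => hp k]
    simp
  -- Only the coordinate `j` changes, so the sample need not be good for the other coordinates; it
  -- comes from the points that have `j`, which may be a small biased part of the cluster.
  have hlearns (i : ℕ) : I.Learns W t (unl W t j + 1) σ i ↔ i = j := by
    constructor
    · rintro ⟨-, h2, h3, -⟩
      rcases h3 with h3 | h3
      · omega
      · exact unl_inj h2 hkn (by omega)
    · rintro rfl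
      exact ⟨hj, hkn, .inr rfl, by omega⟩
  have hkn' (i : ℕ) : W'.kn t i ↔ W.kn t i ∨ i = j := by
    rw [hW']; simp [learn, hlearns]
  have hunl : unl W' t I.d < unl W t I.d := by
    unfold unl
    refine Finset.card_lt_card ⟨fun i hi => ?_, fun hsub => ?_⟩
    · rw [Finset.mem_filter, hkn'] at hi
      rw [Finset.mem_filter]
      exact ⟨hi.1, fun hx => hi.2 (.inl hx)⟩
    · have := hsub (Finset.mem_filter.2 ⟨Finset.mem_range.2 hj, hkn⟩)
      rw [Finset.mem_filter, hkn'] at this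
      exact this.2 (.inr rfl)
  obtain ⟨hk, hmeas⟩ := sum_measure_lt ht (F := fun t' => if f t' then unl W t' I.d else 2 * G.Δ + 1)
    (F' := fun t' => if f t' ∨ t' = t then unl W' t' I.d else 2 * G.Δ + 1)
    (fun t' _ hne => by simp [hne, hW', unl_learn_of_ne hne]) (by simpa [hf] using hunl) h.measure_le
  refine ⟨hk, ?_, ?_, by convert hmeas, ?_⟩
  · intro t' ht' hnf i hi
    push Not at hnf
    simp [hW', learn, hnf.2, h.none_known t' ht' hnf.1 i hi]
  · intro t' ht' hf'
    by_cases he : t' = t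
    · subst he
      exact hunl.le.trans (h.few_unknown _ ht' hf)
    · rw [hW', unl_learn_of_ne he]
      exact h.few_unknown t' ht' (hf'.resolve_right he)
  · refine potential_learn h ?_
    rw [sum_kap_cluster, sum_kap_cluster]
    set Y := cluster G W t with hY
    have hqR : (1 : ℝ) ≤ G.q := by exact_mod_cast hq
    have hcoef : coef G (fun t' => f t' ∨ t' = t) t = 1 + 1 / (8 * G.q) := by simp [coef]
    have hcoef' : coef G f t = 1 + 1 / (8 * G.q) := by simp [coef, hf]
    -- The coefficient `1 + 1 / (8 * q)` is the same before and after. At the learned coordinate its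
    -- surplus covers the error of the sample mean.
    refine Finset.sum_le_sum fun i _ => ?_
    by_cases hi : i = j
    · subst hi
      rw [if_pos ((hkn' i).2 (.inr rfl)), if_neg hkn, hcoef']
      have hu : (I.learn W t (unl W t i + 1) σ).u t i = I.mean σ i := by
        simp [learn, hlearns]
      rw [hu, ← coordCost_having, coordCost_mean (by omega)]
      have hO := I.coordCost_avg_le (I.having Y i) i (G.c t i)
      have e : (8 : ℝ) / (64 * G.q : ℕ) = 1 / (8 * G.q) := by push_cast; field_simp; norm_num
      rw [e] at hσ
      have h1 : 1 / (8 * (G.q : ℝ)) * I.coordCost (I.having Y i) i (I.avg (I.having Y i) i) ≤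
          1 / (8 * (G.q : ℝ)) * I.coordCost (I.having Y i) i (G.c t i) :=
        mul_le_mul_of_nonneg_left hO (by positivity)
      rw [← I.coordCost_having Y i (G.c t i)]
      linarith
    · have h1 : W'.kn t i ↔ W.kn t i := by rw [hkn']; simp [hi]
      have h2 : (I.learn W t (unl W t j + 1) σ).u t i = W.u t i := by simp [learn, hlearns, hi]
      rw [h2, hcoef, hcoef']
      by_cases h3 : W.kn t i
      · rw [if_pos h3, if_pos (h1.2 h3)]
      · rw [if_neg h3, if_neg (mt h1.1 h3)]

open Classical in
/-- If one can learn, then a constant fraction of the samples from a large set of points does. -/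
theorem OnTrack.exists_learn {I : Data} {G : Goal} {tgt : ℝ} {f : ℕ → Prop} {k : ℕ} {W : View}
    (h : I.OnTrack G tgt f k W) (hq : 1 ≤ G.q)
    (hmiss : ∀ x ∈ W.R, ((Finset.range I.d).filter fun j => ¬ I.pr x j).card ≤ G.Δ)
    (hL : I.Learnable G f W) :
    ∃ t < 2, ∃ h ≤ 2 * G.Δ, ∃ A ⊆ W.R.toFinset,
      W.R.toFinset.card ≤ 4096 * G.Δ * G.q * A.card ∧
      A.card ^ (64 * G.q) ≤ 2 * (Finset.univ.filter fun σ : Fin (64 * G.q) → A =>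
        1 ≤ k ∧ ∃ f', I.OnTrack G tgt f' (k - 1) (I.learn W t h fun i => (σ i : ℕ))).card := by
  obtain ⟨t, ht, ⟨hf, hc⟩ | ⟨hf, j, hj, hkn, hc⟩⟩ := hL
  · refine ⟨t, ht, 0, by omega, cluster G W t, Finset.filter_subset _ _, hc, ?_⟩
    refine (I.card_good_samples (cluster G W t) (Finset.range I.d) (64 * G.q) (by omega)).trans
      (Nat.mul_le_mul_left _ (Finset.card_le_card fun σ hσ => ?_))
    rw [Finset.mem_filter] at hσ ⊢
    have := h.learn_all hq ht hf (fun i => (σ i : ℕ)) (fun i => hmiss _ ?_) hσ.2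
    · exact ⟨hσ.1, this.1, _, this.2⟩
    · have := (σ i).2
      exact List.mem_toFinset.1 (Finset.mem_filter.1 this).1
  -- The unknown coordinates below `j`, together with `j` itself, are among the at most `2 * Δ`
  -- unknown ones.
  · have hle : unl W t j + 1 ≤ 2 * G.Δ := by
      rw [← unl_succ hkn]
      exact (unl_mono W t hj).trans (h.few_unknown t ht hf)
    refine ⟨t, ht, unl W t j + 1, hle, I.having (cluster G W t) j,
      (Finset.filter_subset _ _).trans (Finset.filter_subset _ _), hc, ?_⟩
    refine (I.card_good_samples (I.having (cluster G W t) j) {j} (64 * G.q) (by omega)).trans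
      (Nat.mul_le_mul_left _ (Finset.card_le_card fun σ hσ => ?_))
    rw [Finset.mem_filter, Finset.sum_singleton, Finset.sum_singleton] at hσ
    rw [Finset.mem_filter]
    have := h.learn_one hq ht hf hj hkn (fun i => (σ i : ℕ))
      (fun i => (Finset.mem_filter.1 (σ i).2).2) hσ.2
    exact ⟨hσ.1, this.1, _, this.2⟩

/-! ### Soundness of partial solutions -/

/-- Whatever the unknown coordinates are, the assigned points cost at most `b`. -/
def Sound (I : Data) (n : ℕ) (W : View) : Prop :=
  ∀ u' : ℕ → ℕ → ℝ, (∀ t < 2, ∀ j < I.d, W.kn t j → u' t j = W.u t j) →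
    ∑ x ∈ Finset.range n, min (I.cst (u' 0) x) (I.cst (u' 1) x) ≤
      W.b + ∑ x ∈ W.R.toFinset, min (I.cst (u' 0) x) (I.cst (u' 1) x)

theorem Sound.learn {I : Data} {n : ℕ} {W : View} (h : I.Sound n W) (t h' : ℕ) {s : ℕ}
    (σ : Fin s → ℕ) : I.Sound n (I.learn W t h' σ) := fun u' hu' =>
  h u' fun t' ht' j hj hk => (hu' t' ht' j hj (.inl hk)).trans (learn_u_of_kn hk)

open Classical in
-- An assigned point pays its cost at a center known at all its present entries. Later learning
-- cannot change that cost, and the distance to the nearest center is at most this.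
theorem Sound.peel {I : Data} {n : ℕ} {W : View} (h : I.Sound n W) (p : ℕ) :
    I.Sound n (I.peel W p) := fun u' hu' => by
  have h1 := h u' hu'
  rw [peel_toFinset]
  rw [← Finset.sum_filter_add_sum_filter_not W.R.toFinset (fun x => I.Bef W x p)] at h1
  have h2 : ∑ x ∈ W.R.toFinset.filter (fun x => I.Bef W x p), min (I.cst (u' 0) x) (I.cst (u' 1) x) ≤
      ∑ x ∈ W.R.toFinset.filter (fun x => I.Bef W x p), I.wgt W x := by
    refine Finset.sum_le_sum fun x hx => ?_
    rw [Finset.mem_filter] at hx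
    obtain ⟨t, ht, hasg, hw⟩ := exists_wgt_eq hx.2.1
    have e : I.cst (u' t) x = I.cst (W.u t) x := cst_congr hasg fun j hj hk => hu' t ht j hj hk
    rw [hw, ← e]
    interval_cases t
    · exact min_le_left _ _
    · exact min_le_right _ _
  change _ ≤ W.b + _ + _
  linarith

theorem Sound.of_nil {I : Data} {n : ℕ} {W : View} (h : I.Sound n W) (hR : W.R = []) :
    ∑ x ∈ Finset.range n, min (I.cst (W.u 0) x) (I.cst (W.u 1) x) ≤ W.b := by
  have := h W.u fun _ _ _ _ _ => rfl
  simpa [hR] using this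

theorem sound_start (I : Data) (n : ℕ) (u : ℕ → ℕ → ℝ) :
    I.Sound n ⟨List.range n, fun _ _ => False, u, 0⟩ := fun u' _ => by
  simp only [zero_add]
  refine le_of_eq (Finset.sum_congr ?_ fun _ _ => rfl)
  ext x; simp

open Classical in
-- One factor `1 + 1 / (4 * q)` is the coefficient spent on learning, the other is the slack spent
-- on debts. The measure starts at `2 * (2 * Δ + 1)`, and there is no debt.
theorem onTrack_start (I : Data) (G : Goal) (n : ℕ) (u : ℕ → ℕ → ℝ) (tgt : ℝ)
    (h : (1 + 1 / (4 * G.q)) * ((1 + 1 / (4 * G.q)) *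
      ∑ x ∈ Finset.range n, I.cst (G.c (G.l x)) x) ≤ tgt) :
    I.OnTrack G tgt (fun _ => False) (4 * G.Δ + 2) ⟨List.range n, fun _ _ => False, u, 0⟩ := by
  refine ⟨fun _ _ _ _ _ => id, fun _ _ h => h.elim, ?_, 0, 0, 0, le_rfl, by simp, by positivity,
    fun h => absurd h (lt_irrefl _), ?_⟩
  · simp; omega
  · simp only [zero_add, add_zero]
    refine le_trans (le_of_eq ?_) h
    congr 1
    rw [Finset.mul_sum]
    refine Finset.sum_congr ?_ fun x _ => ?_
    · ext x; simp
    · simp only [kap, coef, cst, if_false, Finset.mul_sum]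
      refine Finset.sum_congr rfl fun j _ => ?_
      split_ifs <;> simp

end Data
/-! ### The program -/

/-- The cell `0` of the natural array `a`, used as a variable. -/
def sc (a : ℕ) : NExp := .get a (.lit 0)

/-- Memory map. Natural arrays: `0`–`2` input, presence flags and labels; per level, `3` the
unassigned points (blocks of `n`), `4` their number, `5` whether a child was opened since the last
peeling, `6` the number of peelings, `7` the known coordinates (blocks of `2 * d`); `8` the current
level; `9` positions of the sample; `10`–`12` and `25` counters; `13`–`15` guessed center, guessed
coordinate and its countdown; `16` a count; `17`–`19` current point and its assignability; `20`–`24`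
the parameters `q`, `64 * q`, `4096 * Δ * q`, `4 * Δ + 2` and the number of searches; `26` searches
done; `27` whether a solution is recorded; `28` assignable points; `29`–`31` pivot found, trials,
pivot; `32` writing position; `33` dummy. Real arrays: `0`, `1` input; `2` recorded centers; `3`,
`4` centers and cost per level; `5` recorded cost; `6` weights; `7`, `8` accumulators. -/
def nN : NExp := .get 0 (.lit 0)
def nD : NExp := .get 0 (.lit 1)
def nMiss : NExp := .get 0 (.lit 2)
def setv (a : ℕ) (e : NExp) : Cmd := .setNat a (.lit 0) e
def skip : Cmd := setv 33 (.lit 0)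

/-- The position of the first point of the current level in the natural array `3`. -/
def offR : NExp := .mul (sc 8) nN

/-- The position of the centers of the current level in the natural array `7` and the real array `3`. -/
def offU : NExp := .mul (sc 8) (.mul (.lit 2) nD)

/-- The number of unassigned points of the current level. -/
def rlen : NExp := .get 4 (sc 8)

/-- The squared distances of the point in the variable `17` to two centers. -/
def costLoop (arr : ℕ) (o₀ o₁ : NExp) : Cmd :=
  .seq (.setReal 7 (.lit 0) (.ofNat (.lit 0))) (.seq (.setReal 8 (.lit 0) (.ofNat (.lit 0)))
    (forN 11 nD (.ite (.natLe (.lit 1) (.get 1 (.add (.mul (sc 17) nD) (sc 11))))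
      (.seq
        (.setReal 7 (.lit 0) (.add (.get 7 (.lit 0)) (.mul
          (.sub (.get 1 (.add (.mul (sc 17) nD) (sc 11))) (.get arr (.add o₀ (sc 11))))
          (.sub (.get 1 (.add (.mul (sc 17) nD) (sc 11))) (.get arr (.add o₀ (sc 11)))))))
        (.setReal 8 (.lit 0) (.add (.get 8 (.lit 0)) (.mul
          (.sub (.get 1 (.add (.mul (sc 17) nD) (sc 11))) (.get arr (.add o₁ (sc 11))))
          (.sub (.get 1 (.add (.mul (sc 17) nD) (sc 11))) (.get arr (.add o₁ (sc 11))))))))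
      skip)))

/-- The variables `18` and `19` tell whether the point in the variable `17` can be assigned. -/
def knownLoop : Cmd :=
  .seq (setv 18 (.lit 1)) (.seq (setv 19 (.lit 1))
    (forN 11 nD (.ite (.natLe (.lit 1) (.get 1 (.add (.mul (sc 17) nD) (sc 11))))
      (.seq (setv 18 (.mul (sc 18) (.get 7 (.add offU (sc 11)))))
        (setv 19 (.mul (sc 19) (.get 7 (.add (.add offU nD) (sc 11))))))
      skip)))

/-- The weights of the unassigned points. -/
def weigh : Cmd :=
  forN 10 rlen
    (.seq (setv 17 (.get 3 (.add offR (sc 10))))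
      (.seq (costLoop 3 offU (.add offU nD)) (.seq knownLoop
        (.seq (.setNat 28 (sc 17) (.add (sc 18) (sc 19)))
          (.ite (.natLe (.lit 1) (sc 18))
            (.ite (.and (.natLe (.lit 1) (sc 19)) (.realLe (.get 8 (.lit 0)) (.get 7 (.lit 0))))
              (.setReal 6 (sc 17) (.get 8 (.lit 0))) (.setReal 6 (sc 17) (.get 7 (.lit 0))))
            (.setReal 6 (sc 17) (.get 8 (.lit 0))))))))

/-- The point in the variable `17` does not come after the pivot in the variable `31`. -/
def befTest : Test :=
  .and (.natLe (.lit 1) (.get 28 (sc 17))) (.and (.realLe (.get 6 (sc 17)) (.get 6 (sc 31)))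
    (.neg (.and (.realLe (.get 6 (sc 31)) (.get 6 (sc 17))) (.natLe (.add (sc 31) (.lit 1)) (sc 17)))))

/-- The rank of the pivot. -/
def rankLoop : Cmd :=
  .seq (setv 16 (.lit 0)) (forN 10 rlen
    (.seq (setv 17 (.get 3 (.add offR (sc 10))))
      (.ite befTest (setv 16 (.add (sc 16) (.lit 1))) skip)))

/-- Test of one pivot. -/
def tryPivot : Cmd :=
  .seq (setv 31 (.get 3 (.add offR (sc 31)))) (.seq rankLoop
    (.seq (.ite (.and (.natLe (.lit 1) (.get 28 (sc 31))) (.and (.natLe rlen (.mul (.lit 8) (sc 16)))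
        (.natLe (.mul (.lit 8) (sc 16)) (.add (.mul (.lit 7) rlen) (.lit 1)))))
      (setv 29 (.lit 1)) skip)
      (setv 30 (.add (sc 30) (.lit 1)))))

/-- After `i` peelings of a level, `i + 3` trials are allowed. The failure probabilities `2 ^ (-(i +
3))` are then summable over the rounds, while the geometric decrease of the list keeps the total
time linear. -/
def pivotTest : Test :=
  .and (.natLe (.add (sc 30) (.lit 1)) (.add (.get 6 (sc 8)) (.lit 3))) (.natLe (sc 29) (.lit 0))

def pivotLoop : Cmd :=
  .loop pivotTest (.seq (.rand 31 (.lit 0) rlen) tryPivot)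

/-- Removal of the points up to the pivot. -/
def filterLoop : Cmd :=
  .seq (setv 32 (.lit 0)) (.seq (forN 10 rlen
    (.seq (setv 17 (.get 3 (.add offR (sc 10))))
      (.ite befTest
        (.setReal 4 (sc 8) (.add (.get 4 (sc 8)) (.get 6 (sc 17))))
        (.seq (.setNat 3 (.add offR (sc 32)) (sc 17)) (setv 32 (.add (sc 32) (.lit 1)))))))
    (.seq (.setNat 4 (sc 8) (sc 32)) (.seq (.setNat 6 (sc 8) (.add (.get 6 (sc 8)) (.lit 1)))
      (.setNat 5 (sc 8) (.lit 0)))))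

def pop : Cmd := setv 8 (.sub (sc 8) (.lit 1))

/-- If no pivot is found the level is abandoned, which keeps the running time bounded in every
execution. -/
def peelCmd : Cmd :=
  .seq weigh (.seq (setv 29 (.lit 0)) (.seq (setv 30 (.lit 0)) (.seq pivotLoop
    (.ite (.natLe (.lit 1) (sc 29)) filterLoop pop))))

def leafCmd : Cmd :=
  .seq (.ite (.and (.natLe (.lit 1) (sc 27)) (.realLe (.get 5 (.lit 0)) (.get 4 (sc 8)))) skip
    (.seq (forN 10 (.mul (.lit 2) nD) (.setReal 2 (sc 10) (.get 3 (.add offU (sc 10)))))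
      (.seq (.setReal 5 (.lit 0) (.get 4 (sc 8))) (setv 27 (.lit 1))))) pop

/-- The state of the current level is copied to the next one. -/
def copyCmd : Cmd :=
  .seq (.setNat 5 (sc 8) (.lit 1))
  (.seq (forN 10 rlen (.setNat 3 (.add (.add offR nN) (sc 10)) (.get 3 (.add offR (sc 10)))))
  (.seq (forN 10 (.mul (.lit 2) nD)
    (.seq (.setNat 7 (.add (.add offU (.mul (.lit 2) nD)) (sc 10)) (.get 7 (.add offU (sc 10))))
      (.setReal 3 (.add (.add offU (.mul (.lit 2) nD)) (sc 10)) (.get 3 (.add offU (sc 10))))))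
  (.seq (.setNat 4 (.add (sc 8) (.lit 1)) rlen)
  (.seq (.setReal 4 (.add (sc 8) (.lit 1)) (.get 4 (sc 8)))
  (.seq (.setNat 5 (.add (sc 8) (.lit 1)) (.lit 0))
  (.seq (.setNat 6 (.add (sc 8) (.lit 1)) (.lit 0))
    (setv 8 (.add (sc 8) (.lit 1)))))))))

def drawLoop : Cmd :=
  .loop (.natLe (.add (sc 10) (.lit 1)) (sc 21))
    (.seq (.rand 9 (sc 10) rlen) (setv 10 (.add (sc 10) (.lit 1))))

/-- The second draw has `2 * Δ + 1` outcomes: `0` stands for learning all coordinates at once, the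
others for one of the at most `2 * Δ` unknown coordinates. -/
def drawCmd : Cmd :=
  .seq (.rand 13 (.lit 0) (.lit 2))
    (.seq (.rand 14 (.lit 0) (.add (.mul (.lit 2) nMiss) (.lit 1)))
      (.seq (setv 10 (.lit 0)) drawLoop))

/-- The position of the coordinate in the variable `11` of the center in the variable `13`. -/
def posU : NExp := .add (.add offU (.mul (sc 13) nD)) (sc 11)

/-- The position of the entry in the variable `11` of the sample point in the variable `12`. -/
def posS : NExp := .add (.mul (.get 3 (.add offR (.get 9 (sc 12)))) nD) (sc 11)

/-- Number and sum of the entries of the sample points. -/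
def meanLoop : Cmd :=
  .seq (setv 16 (.lit 0)) (.seq (.setReal 7 (.lit 0) (.ofNat (.lit 0)))
    (forN 12 (sc 21) (.ite (.natLe (.lit 1) (.get 1 posS))
      (.seq (setv 16 (.add (sc 16) (.lit 1)))
        (.setReal 7 (.lit 0) (.add (.get 7 (.lit 0)) (.get 1 posS))))
      skip)))

/-- The variable `15` counts down at each coordinate that was unknown, and equals `1` exactly at the
guessed one; truncated subtraction keeps it at `0` afterwards. -/
def learnCmd : Cmd :=
  .seq (setv 15 (sc 14)) (forN 11 nD (.ite (.natLe (.get 7 posU) (.lit 0))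
    (.seq
      (.ite (.neg (.and (.natLe (.lit 1) (sc 14))
          (.neg (.and (.natLe (.lit 1) (sc 15)) (.natLe (sc 15) (.lit 1))))))
        (.seq meanLoop (.ite (.natLe (sc 21) (.mul (.lit 2) (sc 16)))
          (.seq (.setReal 3 posU (.div (.get 7 (.lit 0)) (.ofNat (sc 16)))) (.setNat 7 posU (.lit 1)))
          skip))
        skip)
      (setv 15 (.sub (sc 15) (.lit 1))))
    skip))

def pushCmd : Cmd := .seq copyCmd (.seq drawCmd learnCmd)

/-- A depth-first search with an explicit stack. Between two peelings each level opens one child, as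
long as the depth allows it. -/
def roundCmd : Cmd :=
  .ite (.natLe rlen (.lit 0)) leafCmd
    (.ite (.and (.natLe (.get 5 (sc 8)) (.lit 0)) (.natLe (sc 8) (sc 23))) pushCmd peelCmd)

def searchLoop : Cmd := .loop (.natLe (.lit 1) (sc 8)) roundCmd

/-- The root is level `1`, so that level `0` signals the end of the search. -/
def startCmd : Cmd :=
  .seq (forN 10 nN (.setNat 3 (.add nN (sc 10)) (sc 10)))
  (.seq (forN 10 (.mul (.lit 2) nD) (.setNat 7 (.add (.mul (.lit 2) nD) (sc 10)) (.lit 0)))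
  (.seq (.setNat 4 (.lit 1) nN)
  (.seq (.setReal 4 (.lit 1) (.ofNat (.lit 0)))
  (.seq (.setNat 5 (.lit 1) (.lit 0))
  (.seq (.setNat 6 (.lit 1) (.lit 0))
    (setv 8 (.lit 1)))))))

def outerLoop : Cmd :=
  .loop (.natLe (.add (sc 26) (.lit 1)) (sc 24))
    (.seq startCmd (.seq searchLoop (setv 26 (.add (sc 26) (.lit 1)))))

def paramCmd : Cmd :=
  .seq (setv 20 (.lit 1))
  (.seq (.loop (.neg (.realLe (.ofNat (.lit 1)) (.mul (.ofNat (sc 20)) (.get 0 (.lit 0)))))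
    (setv 20 (.add (sc 20) (.lit 1))))
  (.seq (setv 21 (.mul (.lit 64) (sc 20)))
  (.seq (setv 22 (.mul (.mul (.lit 4096) nMiss) (sc 20)))
  (.seq (setv 23 (.add (.mul (.lit 4) nMiss) (.lit 2)))
  (.seq (setv 24 (sc 22))
    (forN 25 (.mul (.add (sc 21) (.lit 1)) (sc 23)) (setv 24 (.mul (sc 24) (sc 22)))))))))

def labelCmd : Cmd :=
  forN 10 nN (.seq (setv 17 (sc 10)) (.seq (costLoop 2 (.lit 0) nD)
    (.ite (.realLe (.get 7 (.lit 0)) (.get 8 (.lit 0)))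
      (.setNat 2 (sc 10) (.lit 0)) (.setNat 2 (sc 10) (.lit 1)))))

/-- The clustering algorithm. -/
def clusterProg : Cmd :=
  .seq paramCmd (.seq (setv 26 (.lit 0)) (.seq outerLoop labelCmd))

/-! ### The state of the search in the memory -/

/-- The constant part of the memory. -/
structure Env where
  n : ℕ
  d : ℕ
  Δ : ℕ
  q : ℕ
  D : ℕ → ℕ
  V : ℕ → ℝ

namespace Env

def data (E : Env) : Data where
  d := E.d
  pr x j := 1 ≤ E.D (x * E.d + j)
  v x j := E.V (x * E.d + j)

structure Holds (E : Env) (m : Mem) : Prop where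
  n_eq : m.nat 0 0 = E.n
  d_eq : m.nat 0 1 = E.d
  miss_eq : m.nat 0 2 = E.Δ
  D_eq : m.nat 1 = E.D
  V_eq : m.real 1 = E.V
  s_eq : m.nat 21 0 = 64 * E.q
  K_eq : m.nat 23 0 = 4 * E.Δ + 2

theorem Holds.frame {E : Env} {m m' : Mem} (h : E.Holds m) {F G : List ℕ} (hf : Frame F G m m')
    (h0 : 0 ∉ F := by decide) (h1 : 1 ∉ F := by decide) (h21 : 21 ∉ F := by decide)
    (h23 : 23 ∉ F := by decide) (hV : 1 ∉ G := by decide) : E.Holds m' :=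
  ⟨by rw [hf.1 0 h0, h.n_eq], by rw [hf.1 0 h0, h.d_eq], by rw [hf.1 0 h0, h.miss_eq],
    by rw [hf.1 1 h1, h.D_eq], by rw [hf.2 1 hV, h.V_eq], by rw [hf.1 21 h21, h.s_eq],
    by rw [hf.1 23 h23, h.K_eq]⟩

/-- The partial solution at the level `ℓ`. -/
noncomputable def view (E : Env) (m : Mem) (ℓ : ℕ) : View where
  -- The minimum confines the list to the block of its level, so that writes to higher levels never
  -- affect it.
  R := (List.range (min (m.nat 4 ℓ) E.n)).map fun k => m.nat 3 (ℓ * E.n + k)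
  kn t j := t < 2 ∧ j < E.d ∧ 1 ≤ m.nat 7 (ℓ * (2 * E.d) + t * E.d + j)
  u t j := if t < 2 ∧ j < E.d then m.real 3 (ℓ * (2 * E.d) + t * E.d + j) else 0
  b := m.real 4 ℓ

theorem view_congr {E : Env} {m m' : Mem} {ℓ ℓ' : ℕ} (h4 : m'.nat 4 ℓ' = m.nat 4 ℓ)
    (h3 : ∀ k < E.n, k < m.nat 4 ℓ → m'.nat 3 (ℓ' * E.n + k) = m.nat 3 (ℓ * E.n + k))
    (h7 : ∀ i < 2 * E.d, m'.nat 7 (ℓ' * (2 * E.d) + i) = m.nat 7 (ℓ * (2 * E.d) + i))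
    (hu : ∀ i < 2 * E.d, m'.real 3 (ℓ' * (2 * E.d) + i) = m.real 3 (ℓ * (2 * E.d) + i))
    (hb : m'.real 4 ℓ' = m.real 4 ℓ) : E.view m' ℓ' = E.view m ℓ := by
  have hi : ∀ t j, t < 2 → j < E.d → t * E.d + j < 2 * E.d := fun t j ht hj => by
    interval_cases t <;> omega
  unfold view
  congr 1
  · rw [h4]
    refine List.map_congr_left fun k hk => ?_
    have := List.mem_range.1 hk
    exact h3 k (by omega) (by omega)
  · funext t j
    refine propext (and_congr_right fun ht => and_congr_right fun hj => ?_)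
    rw [add_assoc, add_assoc, h7 _ (hi t j ht hj)]
  · funext t j
    split_ifs with h
    · rw [add_assoc, add_assoc, hu _ (hi t j h.1 h.2)]
    · rfl

/-- The levels below `ℓ` agree. -/
def Same (E : Env) (ℓ : ℕ) (m m' : Mem) : Prop :=
  ∀ i < ℓ, E.view m' i = E.view m i ∧ m'.nat 4 i = m.nat 4 i ∧ m'.nat 5 i = m.nat 5 i ∧
    m'.nat 6 i = m.nat 6 i

theorem Same.refl (E : Env) (ℓ : ℕ) (m : Mem) : E.Same ℓ m m := fun _ _ => ⟨rfl, rfl, rfl, rfl⟩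

theorem Same.trans {E : Env} {ℓ : ℕ} {m m' m'' : Mem} (h : E.Same ℓ m m') (h' : E.Same ℓ m' m'') :
    E.Same ℓ m m'' := fun i hi =>
  ⟨(h' i hi).1.trans (h i hi).1, (h' i hi).2.1.trans (h i hi).2.1,
    (h' i hi).2.2.1.trans (h i hi).2.2.1, (h' i hi).2.2.2.trans (h i hi).2.2.2⟩

theorem Same.mono {E : Env} {ℓ ℓ' : ℕ} {m m' : Mem} (h : E.Same ℓ m m') (hl : ℓ' ≤ ℓ) :
    E.Same ℓ' m m' := fun i hi => h i (by omega)

theorem view_frame {E : Env} {m m' : Mem} {F G : List ℕ} (hf : Frame F G m m') (ℓ : ℕ)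
    (h3 : 3 ∉ F := by decide) (h4 : 4 ∉ F := by decide) (h7 : 7 ∉ F := by decide)
    (h3' : 3 ∉ G := by decide) (h4' : 4 ∉ G := by decide) : E.view m' ℓ = E.view m ℓ :=
  view_congr (by rw [hf.1 4 h4]) (fun _ _ _ => by rw [hf.1 3 h3]) (fun _ _ => by rw [hf.1 7 h7])
    (fun _ _ => by rw [hf.2 3 h3']) (by rw [hf.2 4 h4'])

theorem same_frame {E : Env} {m m' : Mem} {F G : List ℕ} (hf : Frame F G m m') (ℓ : ℕ)
    (h3 : 3 ∉ F := by decide) (h4 : 4 ∉ F := by decide) (h7 : 7 ∉ F := by decide)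
    (h3' : 3 ∉ G := by decide) (h4' : 4 ∉ G := by decide) (h5 : 5 ∉ F := by decide)
    (h6 : 6 ∉ F := by decide) : E.Same ℓ m m' := fun i _ =>
  ⟨view_frame hf i h3 h4 h7 h3' h4', by rw [hf.1 4 h4], by rw [hf.1 5 h5], by rw [hf.1 6 h6]⟩

/-- The points of the list of the level `ℓ` are distinct and below `n`. -/
structure Valid (E : Env) (m : Mem) (ℓ : ℕ) : Prop where
  nodup : (E.view m ℓ).R.Nodup
  lt : ∀ x ∈ (E.view m ℓ).R, x < E.n
  len_le : m.nat 4 ℓ ≤ E.n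

theorem Valid.R_eq {E : Env} {m : Mem} {ℓ : ℕ} (h : E.Valid m ℓ) :
    (E.view m ℓ).R = (List.range (m.nat 4 ℓ)).map fun k => m.nat 3 (ℓ * E.n + k) := by
  rw [view, min_eq_left h.len_le]

theorem Valid.card {E : Env} {m : Mem} {ℓ : ℕ} (h : E.Valid m ℓ) :
    (E.view m ℓ).R.toFinset.card = m.nat 4 ℓ := by
  rw [List.toFinset_card_of_nodup h.nodup, h.R_eq]; simp

theorem Valid.congr {E : Env} {m m' : Mem} {ℓ ℓ' : ℕ} (h : E.Valid m ℓ)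
    (h1 : E.view m' ℓ' = E.view m ℓ) (h2 : m'.nat 4 ℓ' = m.nat 4 ℓ) : E.Valid m' ℓ' :=
  ⟨h1 ▸ h.nodup, h1 ▸ h.lt, h2 ▸ h.len_le⟩

/-! ### Specifications of the deterministic subroutines. -/

open Classical in
/-- The specification of `costLoop`. -/
theorem tri_costLoop {E : Env} {m : Mem} (hE : E.Holds m) {arr : ℕ} (h7 : arr ≠ 7) (h8 : arr ≠ 8)
    {o₀ o₁ : NExp} {c₀ c₁ : ℕ} (h₀ : ∀ m', Frame [11, 33] [7, 8] m m' → o₀.eval m' = c₀)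
    (h₁ : ∀ m', Frame [11, 33] [7, 8] m m' → o₁.eval m' = c₁) :
    Tri (costLoop arr o₀ o₁) m (E.d * 10 + 10) fun m' => Frame [11, 33] [7, 8] m m' ∧
      m'.real 7 0 = E.data.cst (fun j => m.real arr (c₀ + j)) (m.nat 17 0) ∧
      m'.real 8 0 = E.data.cst (fun j => m.real arr (c₁ + j)) (m.nat 17 0) := by
  refine (tri_real_seq (tri_real_seq (tri_forN E.d 6 (fun k m' => Frame [11, 33] [7, 8] m m' ∧
    m'.nat 11 0 = k ∧
    (m'.real 7 0 = ∑ j ∈ Finset.range k, if E.data.pr (m.nat 17 0) j then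
      (E.data.v (m.nat 17 0) j - m.real arr (c₀ + j)) ^ 2 else 0) ∧
    (m'.real 8 0 = ∑ j ∈ Finset.range k, if E.data.pr (m.nat 17 0) j then
      (E.data.v (m.nat 17 0) j - m.real arr (c₁ + j)) ^ 2 else 0)) ?_ ?_ ?_))).mono (by omega) ?_
  · refine ⟨(((Frame.refl _ _ m).setReal (by decide) _ _).setReal (by decide) _ _).setNat
      (by decide) _ _, ?_⟩
    simp [Mem.nat_setNat, Mem.real_setReal, Mem.real_setNat, RExp.eval, NExp.eval]
  · rintro k m' ⟨hf, hk, -⟩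
    refine ⟨?_, hk⟩
    simp [nD, NExp.eval, (hE.frame hf).d_eq]
  · rintro k m' hk ⟨hf, hk', e7, e8⟩
    have hE' := hE.frame hf
    have e17 : m'.nat 17 0 = m.nat 17 0 := by rw [hf.1 17 (by decide)]
    have earr : m'.real arr = m.real arr := hf.2 arr (by simp [h7, h8])
    refine (tri_ite (t := 4) (fun hb => ?_) (fun hb => ?_)).mono (by omega) fun _ => id
    · have hp : E.data.pr (m.nat 17 0) k := by
        simpa [Test.Holds, NExp.eval, sc, nD, hE'.d_eq, e17, hk', hE'.D_eq, data] using hb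
      refine (tri_real_seq (tri_setReal ?_)).mono (by omega) fun _ => id
      refine ⟨by simp [Mem.nat_setReal, hk'],
        ((hf.setReal (by decide) _ _).setReal (by decide) _ _).setNat (by decide) _ _, ?_⟩
      have hv : E.V (m.nat 17 0 * E.d + k) = E.data.v (m.nat 17 0) k := rfl
      have o0 := h₀ _ hf
      have o1 : ∀ z, o₁.eval (m'.setReal 7 0 z) = c₁ := fun z => h₁ _ (hf.setReal (by decide) _ _)
      simp [Mem.nat_setNat, Mem.real_setReal, Mem.real_setNat, Mem.nat_setReal, RExp.eval, NExp.eval,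
        Finset.sum_range_succ, hp, sc, nD, e17, hk', hE'.d_eq, h7, earr, o0, o1, hE'.V_eq, hv,
        e7, e8, sq]
    · have hp : ¬ E.data.pr (m.nat 17 0) k := by
        simpa [Test.Holds, NExp.eval, sc, nD, hE'.d_eq, e17, hk', hE'.D_eq, data] using hb
      refine (tri_setNat ?_).mono (by omega) fun _ => id
      refine ⟨by simp [Mem.nat_setNat, hk'], (hf.setNat (by decide) _ _).setNat (by decide) _ _, ?_⟩
      simp [Mem.nat_setNat, Mem.real_setNat, Finset.sum_range_succ, hp, e7, e8]
  · rintro m' ⟨hf, -, e7, e8⟩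
    exact ⟨hf, e7, e8⟩

/-- A product of natural numbers is positive exactly if all factors are, so the products of the
flags compute the conjunctions. -/
theorem tri_knownLoop {E : Env} {m : Mem} (hE : E.Holds m) {ℓ : ℕ} (hsp : m.nat 8 0 = ℓ) :
    Tri knownLoop m (E.d * 10 + 10) fun m' => Frame [11, 18, 19, 33] [] m m' ∧
      (1 ≤ m'.nat 18 0 ↔ E.data.Asg (E.view m ℓ) 0 (m.nat 17 0)) ∧
      (1 ≤ m'.nat 19 0 ↔ E.data.Asg (E.view m ℓ) 1 (m.nat 17 0)) := by
  refine (tri_nat_seq (tri_nat_seq (tri_forN E.d 6 (fun k m' => Frame [11, 18, 19, 33] [] m m' ∧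
    m'.nat 11 0 = k ∧
    (1 ≤ m'.nat 18 0 ↔ ∀ j < k, E.data.pr (m.nat 17 0) j → 1 ≤ m.nat 7 (ℓ * (2 * E.d) + j)) ∧
    (1 ≤ m'.nat 19 0 ↔ ∀ j < k, E.data.pr (m.nat 17 0) j →
      1 ≤ m.nat 7 (ℓ * (2 * E.d) + E.d + j))) ?_ ?_ ?_))).mono (by omega) ?_
  · refine ⟨(((Frame.refl _ _ m).setNat (by decide) _ _).setNat (by decide) _ _).setNat
      (by decide) _ _, ?_⟩
    simp [Mem.nat_setNat, NExp.eval]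
  · rintro k m' ⟨hf, hk, -⟩
    refine ⟨?_, hk⟩
    simp [nD, NExp.eval, (hE.frame hf).d_eq]
  · rintro k m' hk ⟨hf, hk', e18, e19⟩
    have hE' := hE.frame hf
    have e17 : m'.nat 17 0 = m.nat 17 0 := by rw [hf.1 17 (by decide)]
    have e8 : m'.nat 8 0 = ℓ := by rw [hf.1 8 (by decide), hsp]
    have e7 : m'.nat 7 = m.nat 7 := hf.1 7 (by decide)
    refine (tri_ite (t := 4) (fun hb => ?_) (fun hb => ?_)).mono (by omega) fun _ => id
    · have hp : E.data.pr (m.nat 17 0) k := by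
        simpa [Test.Holds, NExp.eval, sc, nD, hE'.d_eq, e17, hk', hE'.D_eq, data] using hb
      refine (tri_nat_seq (tri_setNat ?_)).mono (by omega) fun _ => id
      refine ⟨by simp [Mem.nat_setNat, hk'],
        ((hf.setNat (by decide) _ _).setNat (by decide) _ _).setNat (by decide) _ _, ?_⟩
      simp only [Mem.nat_setNat, NExp.eval, sc, offU, nD, hk', e8, e7, hE'.d_eq]
      simp only [and_true, and_false, if_true, if_false, Nat.reduceEqDiff, and_self, false_and,
        e8, hE'.d_eq, hk', true_and]
      refine ⟨?_, ?_⟩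
      · rw [Nat.one_le_iff_ne_zero, mul_ne_zero_iff, ← Nat.one_le_iff_ne_zero,
          ← Nat.one_le_iff_ne_zero, e18]
        simp only [Nat.forall_lt_succ_right, hp, true_imp_iff]
      · rw [Nat.one_le_iff_ne_zero, mul_ne_zero_iff, ← Nat.one_le_iff_ne_zero,
          ← Nat.one_le_iff_ne_zero, e19]
        simp only [Nat.forall_lt_succ_right, hp, true_imp_iff]
    · have hp : ¬ E.data.pr (m.nat 17 0) k := by
        simpa [Test.Holds, NExp.eval, sc, nD, hE'.d_eq, e17, hk', hE'.D_eq, data] using hb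
      refine (tri_setNat ?_).mono (by omega) fun _ => id
      refine ⟨by simp [Mem.nat_setNat, hk'], (hf.setNat (by decide) _ _).setNat (by decide) _ _, ?_⟩
      simp only [Mem.nat_setNat, Nat.forall_lt_succ_right, hp, false_imp_iff, and_true]
      simp [e18, e19]
  · rintro m' ⟨hf, -, e18, e19⟩
    refine ⟨hf, e18.trans ?_, e19.trans ?_⟩
    · simp +contextual [Data.Asg, view, data]
    · simp +contextual [Data.Asg, view, data]

/-- The weights in the memory are those of the partial solution `W`. -/
def Weighed (E : Env) (W : View) (m : Mem) : Prop :=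
  ∀ x ∈ W.R, (1 ≤ m.nat 28 x ↔ E.data.Okx W x) ∧ m.real 6 x = E.data.wgt W x

theorem Weighed.frame {E : Env} {W : View} {m m' : Mem} (h : E.Weighed W m) {F G : List ℕ}
    (hf : Frame F G m m') (h28 : 28 ∉ F := by decide) (h6 : 6 ∉ G := by decide) : E.Weighed W m' :=
  fun x hx => by rw [hf.1 28 h28, hf.2 6 h6]; exact h x hx

theorem cst_view_u (E : Env) (m : Mem) (ℓ t x : ℕ) (ht : t < 2) :
    E.data.cst (fun j => m.real 3 (ℓ * (2 * E.d) + t * E.d + j)) x =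
      E.data.cst ((E.view m ℓ).u t) x := by
  refine Finset.sum_congr rfl fun j hj => ?_
  have : j < E.d := Finset.mem_range.1 hj
  have e : (E.view m ℓ).u t j = m.real 3 (ℓ * (2 * E.d) + t * E.d + j) := if_pos ⟨ht, this⟩
  rw [e]

theorem tri_weigh {E : Env} {m : Mem} (hE : E.Holds m) {ℓ : ℕ} (hsp : m.nat 8 0 = ℓ)
    (hV : E.Valid m ℓ) :
    Tri weigh m (m.nat 4 ℓ * (E.d * 20 + 40) + 3) fun m' =>
      Frame [10, 11, 17, 18, 19, 28, 33] [6, 7, 8] m m' ∧ E.Weighed (E.view m ℓ) m' := by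
  set W := E.view m ℓ with hW
  refine (tri_forN (m.nat 4 ℓ) (E.d * 20 + 35) (fun k m' =>
    Frame [10, 11, 17, 18, 19, 28, 33] [6, 7, 8] m m' ∧ m'.nat 10 0 = k ∧
    ∀ i < k, (1 ≤ m'.nat 28 (m.nat 3 (ℓ * E.n + i)) ↔ E.data.Okx W (m.nat 3 (ℓ * E.n + i))) ∧
      m'.real 6 (m.nat 3 (ℓ * E.n + i)) = E.data.wgt W (m.nat 3 (ℓ * E.n + i))) ?_ ?_ ?_).mono
        (by nlinarith) ?_
  · refine ⟨(Frame.refl _ _ m).setNat (by decide) _ _, by simp [Mem.nat_setNat], by simp⟩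
  · rintro k m' ⟨hf, hk, -⟩
    refine ⟨?_, hk⟩
    simp only [rlen, sc, NExp.eval]
    rw [hf.1 4 (by decide), hf.1 8 (by decide), hsp]
  · rintro k m₁ hk ⟨hf, hk', hi⟩
    have hE₁ := hE.frame hf
    have e8 : m₁.nat 8 0 = ℓ := by rw [hf.1 8 (by decide), hsp]
    set x := m.nat 3 (ℓ * E.n + k) with hx
    have hx₁ : (NExp.get 3 (.add offR (sc 10))).eval m₁ = x := by
      simp only [NExp.eval, offR, sc, nN, e8, hE₁.n_eq, hk', hf.1 3 (by decide), hx]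
    refine (tri_nat_seq (t := E.d * 20 + 33) ?_).mono (by omega) fun _ => id
    rw [hx₁]
    have hf₂ := hf.setNat (a := 17) (by decide) ((NExp.lit 0).eval m₁) x
    set m₂ := m₁.setNat 17 ((NExp.lit 0).eval m₁) x with hm₂
    have hE₂ := hE.frame hf₂
    have e8₂ : m₂.nat 8 0 = ℓ := by rw [hf₂.1 8 (by decide), hsp]
    have e10₂ : m₂.nat 10 0 = k := by rw [hm₂]; simp [Mem.nat_setNat, hk']
    have e17₂ : m₂.nat 17 0 = x := by rw [hm₂]; simp [Mem.nat_setNat, NExp.eval]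
    have e28₂ : m₂.nat 28 = m₁.nat 28 := by funext i; rw [hm₂]; simp [Mem.nat_setNat]
    have e6₂ : m₂.real 6 = m₁.real 6 := rfl
    have hoff : ∀ m', Frame [11, 33] [7, 8] m₂ m' →
        offU.eval m' = ℓ * (2 * E.d) + 0 * E.d := fun m' hf' => by
      have := (hE₂.frame hf').d_eq
      simp [offU, sc, nD, NExp.eval, this, hf'.1 8 (by decide), e8₂]
    have hoff' : ∀ m', Frame [11, 33] [7, 8] m₂ m' →
        (NExp.add offU nD).eval m' = ℓ * (2 * E.d) + 1 * E.d := fun m' hf' => by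
      have := (hE₂.frame hf').d_eq
      simp [offU, sc, nD, NExp.eval, this, hf'.1 8 (by decide), e8₂]
    refine (tri_seq (tri_costLoop hE₂ (by decide) (by decide) hoff hoff') (t' := E.d * 10 + 20)
      fun m₃ hm₃ => ?_).mono (by omega) fun _ => id
    obtain ⟨hf₃, e7, e8'⟩ := hm₃
    have hr3 : m₂.real 3 = m.real 3 := hf₂.2 3 (by decide)
    rw [e17₂, hr3, cst_view_u E m ℓ _ x (by norm_num), ← hW] at e7 e8'
    have hE₃ := hE₂.frame hf₃
    have e8₃ : m₃.nat 8 0 = ℓ := by rw [hf₃.1 8 (by decide), e8₂]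
    refine (tri_seq (tri_knownLoop hE₃ e8₃) (t' := 8) fun m₄ hm₄ => ?_).mono (by omega) fun _ => id
    obtain ⟨hf₄, k0, k1⟩ := hm₄
    have hf₃' := hf₂.trans hf₃ (by decide) (by decide)
    have hf₄' := hf₃'.trans hf₄ (by decide) (by decide)
    have hview : E.view m₃ ℓ = W := view_frame hf₃' ℓ
    rw [hview, hf₃.1 17 (by decide), e17₂] at k0 k1
    have e17₄ : m₄.nat 17 0 = x := by rw [hf₄.1 17 (by decide), hf₃.1 17 (by decide), e17₂]
    have e10₄ : m₄.nat 10 0 = k := by rw [hf₄.1 10 (by decide), hf₃.1 10 (by decide), e10₂]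
    have e28₄ : m₄.nat 28 = m₁.nat 28 := by rw [hf₄.1 28 (by decide), hf₃.1 28 (by decide), e28₂]
    have e6₄ : m₄.real 6 = m₁.real 6 := by rw [hf₄.2 6 (by decide), hf₃.2 6 (by decide), e6₂]
    have e7₄ : m₄.real 7 0 = E.data.cst (W.u 0) x := by rw [hf₄.2 7 (by decide), e7]
    have e8₄ : m₄.real 8 0 = E.data.cst (W.u 1) x := by rw [hf₄.2 8 (by decide), e8']
    refine (tri_nat_seq (t := 3) ?_).mono (by omega) fun _ => id
    have hsum : (1 ≤ m₄.nat 18 0 + m₄.nat 19 0 ↔ E.data.Okx W x) := by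
      unfold Data.Okx
      rw [← k0, ← k1]; omega
    simp only [NExp.eval, sc, e17₄]
    set m₅ := m₄.setNat 28 x (m₄.nat 18 0 + m₄.nat 19 0) with hm₅
    have hf₅ := hf₄'.setNat (a := 28) (by decide) x (m₄.nat 18 0 + m₄.nat 19 0)
    rw [← hm₅] at hf₅
    have e17₅ : m₅.nat 17 0 = x := by rw [hm₅]; simp [Mem.nat_setNat, e17₄]
    have e18₅ : m₅.nat 18 0 = m₄.nat 18 0 := by rw [hm₅]; simp [Mem.nat_setNat]
    have e19₅ : m₅.nat 19 0 = m₄.nat 19 0 := by rw [hm₅]; simp [Mem.nat_setNat]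
    have fin : ∀ z, z = E.data.wgt W x →
        (m₅.setReal 6 x z).nat 10 0 = k ∧ (Frame [10, 11, 17, 18, 19, 28, 33] [6, 7, 8] m
          ((m₅.setReal 6 x z).setNat 10 0 (k + 1)) ∧
        ((m₅.setReal 6 x z).setNat 10 0 (k + 1)).nat 10 0 = k + 1 ∧
        ∀ i < k + 1, (1 ≤ ((m₅.setReal 6 x z).setNat 10 0 (k + 1)).nat 28 (m.nat 3 (ℓ * E.n + i)) ↔
          E.data.Okx W (m.nat 3 (ℓ * E.n + i))) ∧
        ((m₅.setReal 6 x z).setNat 10 0 (k + 1)).real 6 (m.nat 3 (ℓ * E.n + i)) =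
          E.data.wgt W (m.nat 3 (ℓ * E.n + i))) := by
      intro z hz
      refine ⟨by rw [Mem.nat_setReal, hm₅]; simp [Mem.nat_setNat, e10₄],
        (hf₅.setReal (by decide) _ _).setNat (by decide) _ _, by simp [Mem.nat_setNat], ?_⟩
      intro i hik
      simp only [Mem.nat_setNat, Mem.real_setNat, Mem.real_setReal, Mem.nat_setReal, hm₅]
      by_cases hxi : m.nat 3 (ℓ * E.n + i) = x
      · rw [hxi]
        simp [hsum, hz]
      · have hne : i ≠ k := fun h => hxi (by rw [h])
        have := hi i (by omega)
        simpa [hxi, e28₄, e6₄] using this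
    unfold Data.wgt at fin
    refine (tri_ite (t := 2) (fun hb => ?_) (fun hb => ?_)).mono (by omega) fun _ => id
    · have ha0 : E.data.Asg W 0 x := k0.1 (by simpa [Test.Holds, NExp.eval, sc, e18₅] using hb)
      simp only [ha0, if_true] at fin
      refine (tri_ite (t := 1) (fun hb => ?_) (fun hb => ?_)).mono (by omega) fun _ => id
      · have hc : 1 ≤ m₄.nat 19 0 ∧ E.data.cst (W.u 1) x ≤ E.data.cst (W.u 0) x := by
          simpa [Test.Holds, NExp.eval, RExp.eval, sc, e19₅, hm₅, Mem.real_setNat, Mem.nat_setNat,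
            e7₄, e8₄] using hb
        rw [k1] at hc
        refine tri_setReal ?_
        simp only [NExp.eval, RExp.eval, e17₅]
        refine fin _ ?_
        rw [if_pos hc, hm₅, Mem.real_setNat, e8₄]
      · have hc : ¬ (1 ≤ m₄.nat 19 0 ∧ E.data.cst (W.u 1) x ≤ E.data.cst (W.u 0) x) := by
          simpa [Test.Holds, NExp.eval, RExp.eval, sc, e19₅, hm₅, Mem.real_setNat, Mem.nat_setNat,
            e7₄, e8₄] using hb
        rw [k1] at hc
        refine tri_setReal ?_
        simp only [NExp.eval, RExp.eval, e17₅]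
        refine fin _ ?_
        rw [if_neg hc, hm₅, Mem.real_setNat, e7₄]
    · have ha0 : ¬ E.data.Asg W 0 x := fun h => hb (by
        simpa [Test.Holds, NExp.eval, sc, e18₅] using k0.2 h)
      simp only [ha0, if_false] at fin
      refine (tri_setReal ?_).mono (by omega) fun _ => id
      simp only [NExp.eval, RExp.eval, e17₅]
      refine fin _ ?_
      rw [hm₅, Mem.real_setNat, e8₄]
  · rintro m' ⟨hf, -, hi⟩
    refine ⟨hf, fun x hx => ?_⟩
    rw [hW, hV.R_eq, List.mem_map] at hx
    obtain ⟨i, hi', rfl⟩ := hx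
    exact hi i (List.mem_range.1 hi')

theorem befTest_holds {E : Env} {W : View} {m : Mem} (h : E.Weighed W m) (hx : m.nat 17 0 ∈ W.R)
    (hp : m.nat 31 0 ∈ W.R) : befTest.Holds m ↔ E.data.Bef W (m.nat 17 0) (m.nat 31 0) := by
  have h1 := h _ hx
  have h2 := h _ hp
  simp only [befTest, Test.Holds, NExp.eval, RExp.eval, sc, h1.1, h1.2, h2.2, Data.Bef, Nat.succ_le_iff]

open Classical in
theorem tri_rankLoop {E : Env} {m : Mem} (hE : E.Holds m) {ℓ : ℕ} (hsp : m.nat 8 0 = ℓ)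
    (hV : E.Valid m ℓ) (hw : E.Weighed (E.view m ℓ) m) (hp : m.nat 31 0 ∈ (E.view m ℓ).R) :
    Tri rankLoop m (m.nat 4 ℓ * 8 + 5) fun m' =>
      Frame [10, 16, 17, 33] [] m m' ∧ m'.nat 16 0 = E.data.rank (E.view m ℓ) (m.nat 31 0) := by
  set W := E.view m ℓ with hW
  set p := m.nat 31 0 with hpp
  refine (tri_nat_seq (tri_forN (m.nat 4 ℓ) 5 (fun k m' => Frame [10, 16, 17, 33] [] m m' ∧
    m'.nat 10 0 = k ∧ m'.nat 16 0 = ((List.range k).map fun i => m.nat 3 (ℓ * E.n + i)).countP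
      fun x => decide (E.data.Bef W x p)) ?_ ?_ ?_)).mono (by omega) ?_
  · refine ⟨((Frame.refl _ _ m).setNat (by decide) _ _).setNat (by decide) _ _, ?_⟩
    simp [Mem.nat_setNat, NExp.eval]
  · rintro k m' ⟨hf, hk, -⟩
    refine ⟨?_, hk⟩
    simp only [rlen, sc, NExp.eval]
    rw [hf.1 4 (by decide), hf.1 8 (by decide), hsp]
  · rintro k m₁ hk ⟨hf, hk', hi⟩
    have hE₁ := hE.frame hf
    have e8 : m₁.nat 8 0 = ℓ := by rw [hf.1 8 (by decide), hsp]
    set x := m.nat 3 (ℓ * E.n + k) with hx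
    have hxR : x ∈ W.R := by
      rw [hW, hV.R_eq]; exact List.mem_map.2 ⟨k, List.mem_range.2 hk, rfl⟩
    have hx₁ : (NExp.get 3 (.add offR (sc 10))).eval m₁ = x := by
      simp only [NExp.eval, offR, sc, nN, e8, hE₁.n_eq, hk', hf.1 3 (by decide), hx]
    refine (tri_nat_seq (t := 2) ?_).mono (by omega) fun _ => id
    rw [hx₁]
    have hf₂ := hf.setNat (a := 17) (by decide) ((NExp.lit 0).eval m₁) x
    set m₂ := m₁.setNat 17 ((NExp.lit 0).eval m₁) x with hm₂
    have e17 : m₂.nat 17 0 = x := by rw [hm₂]; simp [Mem.nat_setNat, NExp.eval]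
    have e31 : m₂.nat 31 0 = p := by rw [hf₂.1 31 (by decide)]
    have e16 : m₂.nat 16 0 = m₁.nat 16 0 := by rw [hm₂]; simp [Mem.nat_setNat]
    have e10 : m₂.nat 10 0 = k := by rw [hm₂]; simp [Mem.nat_setNat, hk']
    have hbef := befTest_holds (hw.frame hf₂) (by rwa [e17]) (by rwa [e31])
    rw [e17, e31] at hbef
    refine (tri_ite (t := 1) (fun hb => ?_) (fun hb => ?_)).mono (by omega) fun _ => id
    · rw [hbef] at hb
      refine tri_setNat ⟨by simp [Mem.nat_setNat, e10],
        (hf₂.setNat (by decide) _ _).setNat (by decide) _ _, by simp [Mem.nat_setNat], ?_⟩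
      simp [Mem.nat_setNat, NExp.eval, sc, List.range_succ, hi, ← hx, hb, e16]
    · rw [hbef] at hb
      refine tri_setNat ⟨by simp [Mem.nat_setNat, e10],
        (hf₂.setNat (by decide) _ _).setNat (by decide) _ _, by simp [Mem.nat_setNat], ?_⟩
      simp [Mem.nat_setNat, List.range_succ, hi, ← hx, hb, e16]
  · rintro m' ⟨hf, -, hi⟩
    refine ⟨hf, hi.trans ?_⟩
    rw [← hV.R_eq, ← hW, Data.rank, List.countP_eq_length_filter,
      ← List.toFinset_card_of_nodup (hV.nodup.filter _), List.toFinset_filter]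
    simp [hW]

open Classical in
theorem tri_tryPivot {E : Env} {m : Mem} (hE : E.Holds m) {ℓ : ℕ} (hsp : m.nat 8 0 = ℓ)
    (hV : E.Valid m ℓ) (hw : E.Weighed (E.view m ℓ) m) (hv : m.nat 31 0 < m.nat 4 ℓ) :
    Tri tryPivot m (m.nat 4 ℓ * 8 + 13) fun m' =>
      Frame [10, 16, 17, 29, 30, 31, 33] [] m m' ∧ m'.nat 31 0 = m.nat 3 (ℓ * E.n + m.nat 31 0) ∧
      m'.nat 30 0 = m.nat 30 0 + 1 ∧ m'.nat 29 0 =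
        if E.data.GoodPivot (E.view m ℓ) (m.nat 3 (ℓ * E.n + m.nat 31 0)) then 1 else m.nat 29 0 := by
  set W := E.view m ℓ with hW
  set p := m.nat 3 (ℓ * E.n + m.nat 31 0) with hp
  have hpR : p ∈ W.R := by
    rw [hW, hV.R_eq]; exact List.mem_map.2 ⟨_, List.mem_range.2 hv, rfl⟩
  have hp₁ : (NExp.get 3 (.add offR (sc 31))).eval m = p := by
    simp only [NExp.eval, offR, sc, nN, hsp, hE.n_eq, hp]
  refine (tri_nat_seq (t := m.nat 4 ℓ * 8 + 11) ?_).mono (by omega) fun _ => id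
  rw [hp₁]
  have hf₁ := (Frame.refl [10, 16, 17, 29, 30, 31, 33] [] m).setNat (a := 31) (by decide)
    ((NExp.lit 0).eval m) p
  set m₁ := m.setNat 31 ((NExp.lit 0).eval m) p with hm₁
  have hview : E.view m₁ ℓ = W := view_frame hf₁ ℓ
  have e4 : m₁.nat 4 ℓ = m.nat 4 ℓ := by rw [hf₁.1 4 (by decide)]
  have e31 : m₁.nat 31 0 = p := by rw [hm₁]; simp [Mem.nat_setNat, NExp.eval]
  have e29 : m₁.nat 29 0 = m.nat 29 0 := by rw [hm₁]; simp [Mem.nat_setNat]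
  have e30 : m₁.nat 30 0 = m.nat 30 0 := by rw [hm₁]; simp [Mem.nat_setNat]
  have hrank := tri_rankLoop (hE.frame hf₁) (ℓ := ℓ) (by rw [hf₁.1 8 (by decide), hsp])
    (hV.congr hview e4) (by rw [hview]; exact hw.frame hf₁) (by rw [hview, e31]; exact hpR)
  rw [e4, hview, e31] at hrank
  refine (tri_seq hrank (t' := 5) fun m₂ hm₂ => ?_).mono (by omega) fun _ => id
  obtain ⟨hf₂, e16⟩ := hm₂
  have hf₂' := hf₁.trans hf₂ (by decide) (by decide)
  have e31₂ : m₂.nat 31 0 = p := by rw [hf₂.1 31 (by decide), e31]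
  have e29₂ : m₂.nat 29 0 = m.nat 29 0 := by rw [hf₂.1 29 (by decide), e29]
  have e30₂ : m₂.nat 30 0 = m.nat 30 0 := by rw [hf₂.1 30 (by decide), e30]
  have e28 : m₂.nat 28 = m.nat 28 := hf₂'.1 28 (by decide)
  have e4₂ : m₂.nat 4 = m.nat 4 := hf₂'.1 4 (by decide)
  have e8₂ : m₂.nat 8 0 = ℓ := by rw [hf₂'.1 8 (by decide), hsp]
  have hgood : (E.data.GoodPivot W p ↔ 1 ≤ m.nat 28 p ∧ m.nat 4 ℓ ≤ 8 * E.data.rank W p ∧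
      8 * E.data.rank W p ≤ 7 * m.nat 4 ℓ + 1) := by
    unfold Data.GoodPivot
    rw [hV.card, (hw p hpR).1]
  refine (tri_seq (t := 2) (t' := 1) (S := fun m' => Frame [10, 16, 17, 29, 30, 31, 33] [] m m' ∧
    m'.nat 31 0 = p ∧ m'.nat 30 0 = m.nat 30 0 ∧ m'.nat 29 0 =
        if E.data.GoodPivot W p then 1 else m.nat 29 0) ?_ ?_).mono (by omega) fun _ => id
  · refine (tri_ite (t := 1) (fun hb => ?_) (fun hb => ?_)).mono (by omega) fun _ => id
    · have hg : E.data.GoodPivot W p := by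
        rw [hgood]
        simpa [Test.Holds, NExp.eval, sc, rlen, e31₂, e28, e4₂, e8₂, e16] using hb
      refine tri_setNat ⟨hf₂'.setNat (by decide) _ _, ?_⟩
      simp [Mem.nat_setNat, NExp.eval, e31₂, e30₂, hg]
    · have hg : ¬ E.data.GoodPivot W p := by
        rw [hgood]
        simpa [Test.Holds, NExp.eval, sc, rlen, e31₂, e28, e4₂, e8₂, e16] using hb
      refine tri_setNat ⟨hf₂'.setNat (by decide) _ _, ?_⟩
      simp [Mem.nat_setNat, e31₂, e30₂, e29₂, hg]
  · rintro m₃ ⟨hf₃, a31, a30, a29⟩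
    refine tri_setNat ⟨hf₃.setNat (by decide) _ _, ?_⟩
    simp [Mem.nat_setNat, NExp.eval, sc, a31, a30, a29]

theorem row_lt {i ℓ n k : ℕ} (hi : i < ℓ) (hk : k < n) : i * n + k < ℓ * n := by
  have : (i + 1) * n ≤ ℓ * n := Nat.mul_le_mul_right _ hi
  nlinarith

/-- Changing cells of the level `ℓ` and above does not affect the levels below. -/
theorem same_of_cells {E : Env} {ℓ : ℕ} {m m' : Mem} (h3 : ∀ i < ℓ * E.n, m'.nat 3 i = m.nat 3 i)
    (h4 : ∀ i < ℓ, m'.nat 4 i = m.nat 4 i) (h5 : ∀ i < ℓ, m'.nat 5 i = m.nat 5 i)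
    (h6 : ∀ i < ℓ, m'.nat 6 i = m.nat 6 i)
    (h7 : ∀ i < ℓ * (2 * E.d), m'.nat 7 i = m.nat 7 i)
    (hu : ∀ i < ℓ * (2 * E.d), m'.real 3 i = m.real 3 i)
    (hb : ∀ i < ℓ, m'.real 4 i = m.real 4 i) : E.Same ℓ m m' := fun i hi =>
  ⟨view_congr (h4 i hi) (fun _ hk _ => h3 _ (row_lt hi hk)) (fun _ hk => h7 _ (row_lt hi hk))
    (fun _ hk => hu _ (row_lt hi hk)) (hb i hi), h4 i hi, h5 i hi, h6 i hi⟩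

open Classical in
-- The list is compacted in place. The writing position never overtakes the reading position, so the
-- cells still to be read are unchanged.
theorem tri_filterLoop {E : Env} {m : Mem} (hE : E.Holds m) {ℓ : ℕ} (hsp : m.nat 8 0 = ℓ)
    (hV : E.Valid m ℓ) (hw : E.Weighed (E.view m ℓ) m) (hp : m.nat 31 0 ∈ (E.view m ℓ).R) :
    Tri filterLoop m (m.nat 4 ℓ * 10 + 15) fun m' =>
      Frame [3, 4, 5, 6, 10, 17, 32] [4] m m' ∧ E.Same ℓ m m' ∧
      E.view m' ℓ = E.data.peel (E.view m ℓ) (m.nat 31 0) ∧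
      m'.nat 4 ℓ + E.data.rank (E.view m ℓ) (m.nat 31 0) = m.nat 4 ℓ ∧
      m'.nat 5 ℓ = 0 ∧ m'.nat 6 ℓ = m.nat 6 ℓ + 1 := by
  set W := E.view m ℓ with hW
  set p := m.nat 31 0 with hpp
  set g := fun i => m.nat 3 (ℓ * E.n + i) with hg
  set keep : ℕ → List ℕ := fun k => ((List.range k).map g).filter fun x => decide (¬ E.data.Bef W x p)
    with hkeep
  have keep_le (k : ℕ) : (keep k).length ≤ k := by
    simpa [hkeep] using List.length_filter_le (fun x => decide (¬ E.data.Bef W x p))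
      ((List.range k).map g)
  refine (tri_nat_seq (tri_seq (t' := 6) (tri_forN (m.nat 4 ℓ) 7 (fun k m' =>
    Frame [3, 10, 17, 32] [4] m m' ∧
    m'.nat 10 0 = k ∧ m'.nat 32 0 = (keep k).length ∧
    (List.range (keep k).length).map (fun i => m'.nat 3 (ℓ * E.n + i)) = keep k ∧
    (∀ i, (i < ℓ * E.n ∨ ℓ * E.n + k ≤ i) → m'.nat 3 i = m.nat 3 i) ∧
    (∀ i, i ≠ ℓ → m'.real 4 i = m.real 4 i) ∧
    m'.real 4 ℓ = m.real 4 ℓ + ((((List.range k).map g).filter fun x =>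
      decide (E.data.Bef W x p)).map (E.data.wgt W)).sum) ?_ ?_ ?_) ?_)).mono (by omega)
      fun _ => id
  · refine ⟨((Frame.refl _ _ m).setNat (by decide) _ _).setNat (by decide) _ _, ?_⟩
    simp [Mem.nat_setNat, NExp.eval, hkeep, Mem.real_setNat]
  · rintro k m' ⟨hf, hk, -⟩
    refine ⟨?_, hk⟩
    simp only [rlen, sc, NExp.eval]
    rw [hf.1 4 (by decide), hf.1 8 (by decide), hsp]
  · rintro k m₁ hk ⟨hf, hk', e32, hlist, hcells, hreal, hb⟩
    have hE₁ := hE.frame hf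
    have e8 : m₁.nat 8 0 = ℓ := by rw [hf.1 8 (by decide), hsp]
    set x := m.nat 3 (ℓ * E.n + k) with hx
    have hgk : g k = x := rfl
    have hxR : x ∈ W.R := by
      rw [hW, hV.R_eq]; exact List.mem_map.2 ⟨k, List.mem_range.2 hk, rfl⟩
    have hx₁ : (NExp.get 3 (.add offR (sc 10))).eval m₁ = x := by
      simp only [NExp.eval, offR, sc, nN, e8, hE₁.n_eq, hk']
      exact hcells _ (.inr le_rfl)
    refine (tri_nat_seq (t := 4) ?_).mono (by omega) fun _ => id
    rw [hx₁]
    have hf₂ := hf.setNat (a := 17) (by decide) ((NExp.lit 0).eval m₁) x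
    set m₂ := m₁.setNat 17 ((NExp.lit 0).eval m₁) x with hm₂
    have e17 : m₂.nat 17 0 = x := by rw [hm₂]; simp [Mem.nat_setNat, NExp.eval]
    have e31 : m₂.nat 31 0 = p := by rw [hf₂.1 31 (by decide)]
    have e10 : m₂.nat 10 0 = k := by rw [hm₂]; simp [Mem.nat_setNat, hk']
    have e32₂ : m₂.nat 32 0 = (keep k).length := by rw [hm₂]; simp [Mem.nat_setNat, e32]
    have e3 : m₂.nat 3 = m₁.nat 3 := by funext i; rw [hm₂]; simp [Mem.nat_setNat]
    have er4 : m₂.real 4 = m₁.real 4 := rfl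
    have e8₂ : m₂.nat 8 0 = ℓ := by rw [hf₂.1 8 (by decide), hsp]
    have en : m₂.nat 0 0 = E.n := (hE.frame hf₂).n_eq
    have hbef := befTest_holds (hw.frame hf₂) (by rwa [e17]) (by rwa [e31])
    rw [e17, e31] at hbef
    have ew : m₂.real 6 x = E.data.wgt W x := ((hw.frame hf₂) x hxR).2
    refine (tri_ite (t := 3) (fun hb' => ?_) (fun hb' => ?_)).mono (by omega) fun _ => id
    · rw [hbef] at hb'
      have hkk : keep (k + 1) = keep k := by
        simp [hkeep, List.range_succ, hgk, hb']
      refine (tri_setReal ⟨by simp [Mem.nat_setReal, e10],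
        (hf₂.setReal (by decide) _ _).setNat (by decide) _ _, by simp [Mem.nat_setNat], ?_, ?_, ?_,
        ?_, ?_⟩).mono (by omega) fun _ => id
      · simp [Mem.nat_setNat, Mem.nat_setReal, hkk, e32₂]
      · simp [Mem.nat_setNat, Mem.nat_setReal, hkk, e3, hlist]
      · intro i hi
        simp only [Mem.nat_setNat, Mem.nat_setReal, e3]
        simpa using hcells i (by omega)
      · intro i hi
        simp [Mem.real_setNat, Mem.real_setReal, NExp.eval, sc, e8₂, hi, er4, hreal i hi]
      · simp [Mem.real_setNat, Mem.real_setReal, NExp.eval, RExp.eval, sc, e8₂, e17, ew, er4, hb,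
          List.range_succ, hgk, hb', add_assoc]
    · rw [hbef] at hb'
      have hkk : keep (k + 1) = keep k ++ [x] := by
        simp [hkeep, List.range_succ, hgk, hb']
      have hle := keep_le k
      have hidx : (NExp.add offR (sc 32)).eval m₂ = ℓ * E.n + (keep k).length := by
        simp [NExp.eval, offR, sc, nN, e8₂, en, e32₂]
      refine (tri_nat_seq (tri_setNat ?_)).mono (by omega) fun _ => id
      rw [hidx]
      have e17' : (sc 17).eval m₂ = x := e17
      rw [e17']
      refine ⟨by simp [Mem.nat_setNat, e10],
        ((hf₂.setNat (by decide) _ _).setNat (by decide) _ _).setNat (by decide) _ _,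
        by simp [Mem.nat_setNat], ?_, ?_, ?_, ?_, ?_⟩
      · simp [Mem.nat_setNat, NExp.eval, sc, hkk, e32₂]
      · rw [hkk, List.length_append, List.length_singleton, List.range_succ, List.map_append]
        congr 1
        · rw [← hlist, List.length_map, List.length_range]
          refine List.map_congr_left fun i hi => ?_
          have : i ≠ (keep k).length := (List.mem_range.1 hi).ne
          simp [Mem.nat_setNat, this, e3]
        · simp [Mem.nat_setNat]
      · intro i hi
        have : i ≠ ℓ * E.n + (keep k).length := by omega
        simp only [Mem.nat_setNat, e3]
        simpa [this] using hcells i (by omega)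
      · intro i hi
        simp [Mem.real_setNat, er4, hreal i hi]
      · simp [Mem.real_setNat, er4, hb, List.range_succ, hgk, hb']
  · rintro m₁ ⟨hf, -, e32, hlist, hcells, hreal, hb⟩
    have e8 : m₁.nat 8 0 = ℓ := by rw [hf.1 8 (by decide), hsp]
    have hlen : (keep (m.nat 4 ℓ)).length ≤ E.n := (keep_le _).trans hV.len_le
    refine (tri_nat_seq (tri_nat_seq (tri_setNat ?_))).mono (by omega) fun _ => id
    simp only [NExp.eval, sc, e8, e32, Mem.nat_setNat]
    simp only [OfNat.ofNat_ne_zero, and_true, and_false, false_and, if_false, e8,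
      Nat.reduceEqDiff]
    have e6 : m₁.nat 6 = m.nat 6 := hf.1 6 (by decide)
    have e5 : m₁.nat 5 = m.nat 5 := hf.1 5 (by decide)
    have e4 : m₁.nat 4 = m.nat 4 := hf.1 4 (by decide)
    have e7 : m₁.nat 7 = m.nat 7 := hf.1 7 (by decide)
    have er3 : m₁.real 3 = m.real 3 := hf.2 3 (by decide)
    have hf' : Frame [3, 4, 5, 6, 10, 17, 32] [4] m m₁ :=
      (Frame.refl _ _ m).trans hf (by decide) (by decide)
    refine ⟨((hf'.setNat (by decide) _ _).setNat (by decide) _ _).setNat (by decide) _ _, ?_, ?_, ?_,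
      ?_, ?_⟩
    · refine same_of_cells (fun i hi => ?_) (fun i hi => ?_) (fun i hi => ?_) (fun i hi => ?_)
        (fun i hi => ?_) (fun i hi => ?_) (fun i hi => ?_)
      · simp [Mem.nat_setNat, hcells i (.inl hi)]
      · simp [Mem.nat_setNat, hi.ne, e4]
      · simp [Mem.nat_setNat, hi.ne, e5]
      · simp [Mem.nat_setNat, hi.ne, e6]
      · simp [Mem.nat_setNat, e7]
      · simp [Mem.real_setNat, er3]
      · simp [Mem.real_setNat, hreal i hi.ne]
    · have hkW : keep (m.nat 4 ℓ) = W.R.filter fun x => decide (¬ E.data.Bef W x p) := by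
        rw [hW, hV.R_eq]
      have hsum : ((((List.range (m.nat 4 ℓ)).map g).filter fun x =>
          decide (E.data.Bef W x p)).map (E.data.wgt W)).sum =
          ∑ x ∈ W.R.toFinset.filter (fun x => E.data.Bef W x p), E.data.wgt W x := by
        rw [← hV.R_eq, ← List.sum_toFinset _ (hV.nodup.filter _), List.toFinset_filter]
        simp [hW]
      unfold view Data.peel
      congr 1
      · simp only [Mem.nat_setNat]
        simp only [Nat.reduceEqDiff, false_and, and_self, if_true, if_false]
        rw [min_eq_left hlen, hlist, hkW]
      · rw [hW]
        funext t j
        simp [Mem.nat_setNat, e7, view]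
      · rw [hW]
        funext t j
        simp [Mem.real_setNat, er3, view]
      · simp only [Mem.real_setNat]
        rw [hb, hsum]; rfl
    · have h1 := List.length_eq_countP_add_countP (fun x => decide (E.data.Bef W x p)) (l := W.R)
      have h2 : E.data.rank W p = W.R.countP fun x => decide (E.data.Bef W x p) := by
        rw [Data.rank, List.countP_eq_length_filter,
          ← List.toFinset_card_of_nodup (hV.nodup.filter _), List.toFinset_filter]
        simp [hW]
      have h3 : (keep (m.nat 4 ℓ)).length = W.R.countP fun x => decide (¬ E.data.Bef W x p) := by
        rw [List.countP_eq_length_filter, hW, hV.R_eq]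
      have h4 : W.R.length = m.nat 4 ℓ := by rw [hW, hV.R_eq]; simp
      rw [h2, h3]
      simp only [decide_eq_true_eq] at h1
      rw [if_pos trivial]
      omega
    · simp [Mem.nat_setNat]
    · simp [Mem.nat_setNat, e6]

/-- The centers in the output. -/
def out (E : Env) (m : Mem) (t j : ℕ) : ℝ := m.real 2 (t * E.d + j)

noncomputable def outCost (E : Env) (m : Mem) : ℝ :=
  ∑ x ∈ Finset.range E.n, min (E.data.cst (E.out m 0) x) (E.data.cst (E.out m 1) x)

/-- If there is a best solution, its cost is at most the recorded one. -/
def BestSound (E : Env) (m : Mem) : Prop := 1 ≤ m.nat 27 0 → E.outCost m ≤ m.real 5 0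

/-- A solution of cost at most `tgt` has been found. -/
def GoodBest (tgt : ℝ) (m : Mem) : Prop := 1 ≤ m.nat 27 0 ∧ m.real 5 0 ≤ tgt

theorem BestSound.frame {E : Env} {m m' : Mem} (h : E.BestSound m) {F G : List ℕ}
    (hf : Frame F G m m') (h27 : 27 ∉ F := by decide) (h2 : 2 ∉ G := by decide)
    (h5 : 5 ∉ G := by decide) : E.BestSound m' := by
  unfold BestSound outCost out at *
  rw [hf.1 27 h27, hf.2 2 h2, hf.2 5 h5]
  exact h

theorem goodBest_frame {tgt : ℝ} {m m' : Mem} {F G : List ℕ}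
    (hf : Frame F G m m') (h27 : 27 ∉ F := by decide) (h5 : 5 ∉ G := by decide) :
    GoodBest tgt m' ↔ GoodBest tgt m := by
  unfold GoodBest
  rw [hf.1 27 h27, hf.2 5 h5]

/-- Keeping the cheaper solution cannot destroy a good one. Coordinates still unknown are output
with arbitrary values, which soundness tolerates. -/
theorem tri_leafCmd {E : Env} {m : Mem} (hE : E.Holds m) {ℓ : ℕ} (hsp : m.nat 8 0 = ℓ)
    (hR : (E.view m ℓ).R = []) (hs : E.data.Sound E.n (E.view m ℓ)) (hB : E.BestSound m) :
    Tri leafCmd m (E.d * 8 + 15) fun m' => E.Holds m' ∧ E.Same ℓ m m' ∧ m'.nat 8 0 = ℓ - 1 ∧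
      E.BestSound m' ∧ Frame [8, 10, 27, 33] [2, 5] m m' ∧
      ∀ tgt, (GoodBest tgt m ∨ (E.view m ℓ).b ≤ tgt → GoodBest tgt m') := by
  set W := E.view m ℓ with hW
  have hbW : m.real 4 ℓ = W.b := rfl
  refine (tri_seq (t := E.d * 8 + 12) (t' := 1) (S := fun m' => Frame [8, 10, 27, 33] [2, 5] m m' ∧
    m'.nat 8 0 = ℓ ∧ E.BestSound m' ∧
      ∀ tgt, (GoodBest tgt m ∨ W.b ≤ tgt → GoodBest tgt m')) ?_ ?_).mono (by omega) fun _ => id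
  · refine (tri_ite (t := E.d * 8 + 10) (fun hb => ?_) (fun hb => ?_)).mono (by omega) fun _ => id
    · have hb' : 1 ≤ m.nat 27 0 ∧ m.real 5 0 ≤ W.b := by
        simpa [Test.Holds, NExp.eval, RExp.eval, sc, hsp, hbW] using hb
      refine (tri_setNat ?_).mono (by omega) fun _ => id
      have hf := (Frame.refl [33] [] m).setNat (a := 33) (by decide) ((NExp.lit 0).eval m)
        ((NExp.lit 0).eval m)
      refine ⟨(Frame.refl _ _ m).setNat (by decide) _ _, by simp [Mem.nat_setNat, hsp],
        hB.frame hf, fun tgt h => (goodBest_frame hf).2 ?_⟩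
      exact h.elim id fun h => ⟨hb'.1, hb'.2.trans h⟩
    · have hb' : ¬ (1 ≤ m.nat 27 0 ∧ m.real 5 0 ≤ W.b) := by
        simpa [Test.Holds, NExp.eval, RExp.eval, sc, hsp, hbW] using hb
      refine (tri_seq (tri_forN (2 * E.d) 1 (fun k m' => Frame [10] [2] m m' ∧ m'.nat 10 0 = k ∧
        ∀ i < k, m'.real 2 i = m.real 3 (ℓ * (2 * E.d) + i)) ?_ ?_ ?_) (t' := 3)
        fun m₁ hm₁ => ?_).mono (by omega) fun _ => id
      · exact ⟨(Frame.refl _ _ m).setNat (by decide) _ _, by simp [Mem.nat_setNat], by simp⟩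
      · rintro k m' ⟨hf, hk, -⟩
        refine ⟨?_, hk⟩
        simp [nD, NExp.eval, (hE.frame hf).d_eq]
      · rintro k m₁ hk ⟨hf, hk', hi⟩
        have hd := (hE.frame hf).d_eq
        have e8 : m₁.nat 8 0 = ℓ := by rw [hf.1 8 (by decide), hsp]
        have e3 : m₁.real 3 = m.real 3 := hf.2 3 (by decide)
        refine tri_setReal ⟨by simp [Mem.nat_setReal, hk'],
          (hf.setReal (by decide) _ _).setNat (by decide) _ _, by simp [Mem.nat_setNat], ?_⟩
        intro i hik
        by_cases h : i = k
        · simp [Mem.real_setNat, Mem.real_setReal, RExp.eval, NExp.eval, sc, offU, nD, hk', h, hd, e8,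
            e3]
        · simp [Mem.real_setNat, Mem.real_setReal, RExp.eval, NExp.eval, sc, hk', h,
            hi i (by omega)]
      · obtain ⟨hf, -, hi⟩ := hm₁
        have e8 : m₁.nat 8 0 = ℓ := by rw [hf.1 8 (by decide), hsp]
        have e4 : m₁.real 4 = m.real 4 := hf.2 4 (by decide)
        refine (tri_real_seq (tri_setNat ?_)).mono (by omega) fun _ => id
        have hf' : Frame [8, 10, 27, 33] [2, 5] m m₁ :=
          (Frame.refl _ _ m).trans hf (by decide) (by decide)
        refine ⟨(hf'.setReal (by decide) _ _).setNat (by decide) _ _,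
          by simp [Mem.nat_setNat, Mem.nat_setReal, e8], fun _ => ?_, fun tgt h => ⟨?_, ?_⟩⟩
        · have := hs.of_nil hR
          have hcst (t x : ℕ) (ht : t < 2) : E.data.cst (fun j => m₁.real 2 (t * E.d + j)) x =
              E.data.cst (W.u t) x := by
            rw [hW, ← cst_view_u E m ℓ t x ht]
            refine Finset.sum_congr rfl fun j hj => ?_
            have hj' : j < E.d := Finset.mem_range.1 hj
            have e : m₁.real 2 (t * E.d + j) = m.real 3 (ℓ * (2 * E.d) + t * E.d + j) := by
              rw [hi _ (by interval_cases t <;> omega), add_assoc]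
            simp only [e]
          simp only [outCost, Mem.real_setNat, Mem.real_setReal, RExp.eval, NExp.eval, sc, e8, e4]
          simp only [and_self, if_true]
          have ho (t : ℕ) : E.out ((m₁.setReal 5 0 (m.real 4 ℓ)).setNat 27 0 1) t =
              fun j => m₁.real 2 (t * E.d + j) := by
            funext j
            simp [out, Mem.real_setNat, Mem.real_setReal]
          simp only [ho, hcst 0 _ (by norm_num), hcst 1 _ (by norm_num)]
          exact this
        · simp [Mem.nat_setNat, NExp.eval]
        · simp only [Mem.real_setNat, Mem.real_setReal, RExp.eval, NExp.eval, sc, e8, e4]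
          simp only [and_self, if_true]
          rcases h with h | h
          · have : ¬ m.real 5 0 ≤ W.b := fun h' => hb' ⟨h.1, h'⟩
            exact (not_le.1 this).le.trans h.2
          · exact h
  · rintro m₁ ⟨hf, e8, hB₁, hG⟩
    have hf₁ := (Frame.refl [8] [] m₁).setNat (a := 8) (by decide) ((NExp.lit 0).eval m₁)
      ((NExp.sub (sc 8) (.lit 1)).eval m₁)
    have hf₂ := hf.trans hf₁ (by decide) (by decide)
    refine tri_setNat ⟨hE.frame hf₂, same_frame hf₂ ℓ, ?_, hB₁.frame hf₁, hf₂, fun tgt h =>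
      (goodBest_frame hf₁).2 (hG tgt h)⟩
    simp [Mem.nat_setNat, NExp.eval, sc, e8]

theorem tri_copyCmd {E : Env} {m : Mem} (hE : E.Holds m) {ℓ : ℕ} (hsp : m.nat 8 0 = ℓ)
    (hV : E.Valid m ℓ) :
    Tri copyCmd m (m.nat 4 ℓ * 4 + E.d * 12 + 25) fun m' =>
      Frame [3, 4, 5, 6, 7, 8, 10] [3, 4] m m' ∧ E.Same ℓ m m' ∧ m'.nat 8 0 = ℓ + 1 ∧
      E.view m' ℓ = E.view m ℓ ∧ m'.nat 4 ℓ = m.nat 4 ℓ ∧ m'.nat 5 ℓ = 1 ∧ m'.nat 6 ℓ = m.nat 6 ℓ ∧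
      E.view m' (ℓ + 1) = E.view m ℓ ∧ m'.nat 4 (ℓ + 1) = m.nat 4 ℓ ∧ m'.nat 5 (ℓ + 1) = 0 ∧
      m'.nat 6 (ℓ + 1) = 0 := by
  refine (tri_nat_seq (t := m.nat 4 ℓ * 4 + E.d * 12 + 23) ?_).mono (by omega) fun _ => id
  rw [show (sc 8).eval m = ℓ from hsp, show (NExp.lit 1).eval m = 1 from rfl]
  set m₀ := m.setNat 5 ℓ 1 with hm₀
  have hf₀ : Frame [5] [] m m₀ := (Frame.refl _ _ m).setNat (by decide) _ _
  have hE₀ := hE.frame hf₀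
  refine (tri_seq (tri_forN (m.nat 4 ℓ) 1 (fun k m' => Frame [3, 10] [] m₀ m' ∧ m'.nat 10 0 = k ∧
    (∀ i < (ℓ + 1) * E.n, m'.nat 3 i = m.nat 3 i) ∧
    ∀ i < k, m'.nat 3 ((ℓ + 1) * E.n + i) = m.nat 3 (ℓ * E.n + i)) ?_ ?_ ?_)
    (t' := E.d * 12 + 19) fun m₁ hm₁ => ?_).mono (by omega) fun _ => id
  · refine ⟨(Frame.refl _ _ _).setNat (by decide) _ _, by simp [Mem.nat_setNat], ?_, by simp⟩
    intro i _
    simp [Mem.nat_setNat, hm₀]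
  · rintro k m' ⟨hf, hk, -⟩
    refine ⟨?_, hk⟩
    simp only [rlen, sc, NExp.eval]
    rw [hf.1 4 (by decide), hf.1 8 (by decide), hf₀.1 8 (by decide), hf₀.1 4 (by decide), hsp]
  · rintro k m₁ hk ⟨hf, hk', hlow, hi⟩
    have hE₁ := hE₀.frame hf
    have e8 : m₁.nat 8 0 = ℓ := by rw [hf.1 8 (by decide), hf₀.1 8 (by decide), hsp]
    have hkn : k < E.n := lt_of_lt_of_le hk hV.len_le
    have hidx : (NExp.add (.add offR nN) (sc 10)).eval m₁ = (ℓ + 1) * E.n + k := by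
      simp [NExp.eval, offR, nN, sc, e8, hE₁.n_eq, hk']; ring
    have hval : (NExp.get 3 (.add offR (sc 10))).eval m₁ = m.nat 3 (ℓ * E.n + k) := by
      simp only [NExp.eval, offR, nN, sc, e8, hE₁.n_eq, hk']
      exact hlow _ (row_lt (Nat.lt_succ_self ℓ) hkn)
    refine tri_setNat ?_
    rw [hidx, hval]
    refine ⟨by simp [Mem.nat_setNat, hk'], (hf.setNat (by decide) _ _).setNat (by decide) _ _,
      by simp [Mem.nat_setNat], fun i hil => ?_, fun i hik => ?_⟩
    · have : i ≠ (ℓ + 1) * E.n + k := by omega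
      simp [Mem.nat_setNat, this, hlow i hil]
    · by_cases h : i = k
      · simp [Mem.nat_setNat, h]
      · simp [Mem.nat_setNat, h, hi i (by omega)]
  obtain ⟨hf₁, -, hlow, hR⟩ := hm₁
  have hE₁ := hE₀.frame hf₁
  refine (tri_seq (tri_forN (2 * E.d) 3 (fun k m' => Frame [7, 10] [3] m₁ m' ∧ m'.nat 10 0 = k ∧
    (∀ i < (ℓ + 1) * (2 * E.d), m'.nat 7 i = m.nat 7 i ∧ m'.real 3 i = m.real 3 i) ∧
    ∀ i < k, m'.nat 7 ((ℓ + 1) * (2 * E.d) + i) = m.nat 7 (ℓ * (2 * E.d) + i) ∧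
      m'.real 3 ((ℓ + 1) * (2 * E.d) + i) = m.real 3 (ℓ * (2 * E.d) + i)) ?_ ?_ ?_)
    (t' := 12) fun m₂ hm₂ => ?_).mono (by omega) fun _ => id
  · refine ⟨(Frame.refl _ _ _).setNat (by decide) _ _, by simp [Mem.nat_setNat], ?_, by simp⟩
    intro i _
    have e7 : m₁.nat 7 = m.nat 7 := by rw [hf₁.1 7 (by decide), hf₀.1 7 (by decide)]
    have e3 : m₁.real 3 = m.real 3 := by rw [hf₁.2 3 (by decide), hf₀.2 3 (by decide)]
    simp [Mem.nat_setNat, Mem.real_setNat, e7, e3]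
  · rintro k m' ⟨hf, hk, -⟩
    refine ⟨?_, hk⟩
    simp [nD, NExp.eval, (hE₁.frame hf).d_eq]
  · rintro k m₂ hk ⟨hf, hk', hlow', hi⟩
    have hE₂ := hE₁.frame hf
    have e8 : m₂.nat 8 0 = ℓ := by
      rw [hf.1 8 (by decide), hf₁.1 8 (by decide), hf₀.1 8 (by decide), hsp]
    have hidx : ∀ m', m'.nat 8 0 = ℓ → m'.nat 0 1 = E.d → m'.nat 10 0 = k →
        (NExp.add (.add offU (.mul (.lit 2) nD)) (sc 10)).eval m' = (ℓ + 1) * (2 * E.d) + k := by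
      intro m' h1 h2 h3
      simp [NExp.eval, offU, nD, sc, h1, h2, h3]; ring
    have hlt : ℓ * (2 * E.d) + k < (ℓ + 1) * (2 * E.d) := row_lt (Nat.lt_succ_self ℓ) hk
    have hval : (NExp.get 7 (.add offU (sc 10))).eval m₂ = m.nat 7 (ℓ * (2 * E.d) + k) := by
      simp only [NExp.eval, offU, nD, sc, e8, hE₂.d_eq, hk']
      exact (hlow' _ hlt).1
    refine (tri_nat_seq (t := 1) ?_).mono (by omega) fun _ => id
    rw [hidx _ e8 hE₂.d_eq hk', hval]
    set m₃ := m₂.setNat 7 ((ℓ + 1) * (2 * E.d) + k) (m.nat 7 (ℓ * (2 * E.d) + k)) with hm₃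
    have e8₃ : m₃.nat 8 0 = ℓ := by rw [hm₃]; simp [Mem.nat_setNat, e8]
    have e10₃ : m₃.nat 10 0 = k := by rw [hm₃]; simp [Mem.nat_setNat, hk']
    have ed₃ : m₃.nat 0 1 = E.d := by rw [hm₃]; simp [Mem.nat_setNat, hE₂.d_eq]
    have hval' : (RExp.get 3 (.add offU (sc 10))).eval m₃ = m.real 3 (ℓ * (2 * E.d) + k) := by
      simp only [RExp.eval, NExp.eval, offU, nD, sc, e8₃, ed₃, e10₃]
      rw [hm₃, Mem.real_setNat]
      exact (hlow' _ hlt).2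
    refine tri_setReal ?_
    rw [hidx _ e8₃ ed₃ e10₃, hval']
    refine ⟨by simp [Mem.nat_setReal, e10₃],
      ((hf.setNat (by decide) _ _).setReal (by decide) _ _).setNat (by decide) _ _,
      by simp [Mem.nat_setNat], fun i hil => ?_, fun i hik => ?_⟩
    · have : i ≠ (ℓ + 1) * (2 * E.d) + k := by omega
      have := hlow' i hil
      simp [Mem.nat_setNat, Mem.nat_setReal, Mem.real_setReal, Mem.real_setNat, hm₃, *]
    · by_cases h : i = k
      · simp [Mem.nat_setNat, Mem.nat_setReal, Mem.real_setReal, Mem.real_setNat, hm₃, h]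
      · have := hi i (by omega)
        simp [Mem.nat_setNat, Mem.nat_setReal, Mem.real_setReal, Mem.real_setNat, hm₃, h, this]
  obtain ⟨hf₂, -, hlow', hU⟩ := hm₂
  have e8 : m₂.nat 8 0 = ℓ := by
    rw [hf₂.1 8 (by decide), hf₁.1 8 (by decide), hf₀.1 8 (by decide), hsp]
  have e4 : m₂.nat 4 = m.nat 4 := by
    rw [hf₂.1 4 (by decide), hf₁.1 4 (by decide), hf₀.1 4 (by decide)]
  have e6 : m₂.nat 6 = m.nat 6 := by
    rw [hf₂.1 6 (by decide), hf₁.1 6 (by decide), hf₀.1 6 (by decide)]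
  have e5 : m₂.nat 5 = m₀.nat 5 := by
    rw [hf₂.1 5 (by decide), hf₁.1 5 (by decide)]
  have er4 : m₂.real 4 = m.real 4 := by
    rw [hf₂.2 4 (by decide), hf₁.2 4 (by decide), hf₀.2 4 (by decide)]
  have e3 : m₂.nat 3 = m₁.nat 3 := hf₂.1 3 (by decide)
  have hf : Frame [3, 4, 5, 6, 7, 8, 10] [3, 4] m m₂ :=
    (((Frame.refl _ _ m).trans hf₀ (by decide) (by decide)).trans hf₁ (by decide) (by decide)).trans
      hf₂ (by decide) (by decide)
  set m₃ := ((((m₂.setNat 4 (ℓ + 1) (m.nat 4 ℓ)).setReal 4 (ℓ + 1) (m.real 4 ℓ)).setNat 5 (ℓ + 1)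
    0).setNat 6 (ℓ + 1) 0).setNat 8 0 (ℓ + 1) with hm₃
  refine (tri_nat_seq (tri_real_seq (tri_nat_seq (tri_nat_seq (tri_setNat
    (S := fun m' => m' = m₃) ?_))))).mono (by omega) ?_
  · have hv₁ : (NExp.add (sc 8) (.lit 1)).eval m₂ = ℓ + 1 := by simp [NExp.eval, sc, e8]
    have hv₂ : rlen.eval m₂ = m.nat 4 ℓ := by simp [NExp.eval, rlen, sc, e8, e4]
    rw [hv₁, hv₂]
    simp only [NExp.eval, RExp.eval, sc, Mem.nat_setNat, Mem.nat_setReal, Mem.real_setNat, er4]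
    simp only [OfNat.ofNat_ne_zero, and_false, false_and, if_false, Nat.reduceEqDiff, e8, hm₃]
  rintro _ rfl
  have a3 : m₃.nat 3 = m₁.nat 3 := by
    funext i; rw [hm₃]; simp [Mem.nat_setNat, Mem.nat_setReal, e3]
  have a4 (i : ℕ) : m₃.nat 4 i = if i = ℓ + 1 then m.nat 4 ℓ else m.nat 4 i := by
    rw [hm₃]; simp [Mem.nat_setNat, Mem.nat_setReal, e4]
  have a5 (i : ℕ) : m₃.nat 5 i = if i = ℓ + 1 then 0 else if i = ℓ then 1 else m.nat 5 i := by
    rw [hm₃]; simp [Mem.nat_setNat, Mem.nat_setReal, e5, hm₀]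
  have a6 (i : ℕ) : m₃.nat 6 i = if i = ℓ + 1 then 0 else m.nat 6 i := by
    rw [hm₃]; simp [Mem.nat_setNat, Mem.nat_setReal, e6]
  have a7 : m₃.nat 7 = m₂.nat 7 := by
    funext i; rw [hm₃]; simp [Mem.nat_setNat, Mem.nat_setReal]
  have b3 : m₃.real 3 = m₂.real 3 := by
    funext i; rw [hm₃]; simp [Mem.real_setNat, Mem.real_setReal]
  have b4 (i : ℕ) : m₃.real 4 i = if i = ℓ + 1 then m.real 4 ℓ else m.real 4 i := by
    rw [hm₃]; simp [Mem.real_setNat, Mem.real_setReal, er4]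
  have hmul : ℓ * E.n ≤ (ℓ + 1) * E.n := Nat.mul_le_mul_right _ (Nat.le_succ ℓ)
  have hmul' : ℓ * (2 * E.d) ≤ (ℓ + 1) * (2 * E.d) := Nat.mul_le_mul_right _ (Nat.le_succ ℓ)
  refine ⟨((((hf.setNat (by decide) _ _).setReal (by decide) _ _).setNat (by decide) _ _).setNat
    (by decide) _ _).setNat (by decide) _ _, ?_, by rw [hm₃]; simp [Mem.nat_setNat], ?_, ?_, ?_, ?_, ?_,
    ?_, ?_, ?_⟩
  · refine same_of_cells (fun i hi => ?_) (fun i hi => ?_) (fun i hi => ?_) (fun i hi => ?_)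
        (fun i hi => ?_) (fun i hi => ?_) (fun i hi => ?_)
    · rw [a3, hlow i (by omega)]
    · rw [a4, if_neg (by omega)]
    · rw [a5, if_neg (by omega), if_neg (by omega)]
    · rw [a6, if_neg (by omega)]
    · rw [a7, (hlow' i (by omega)).1]
    · rw [b3, (hlow' i (by omega)).2]
    · rw [b4, if_neg (by omega)]
  · refine view_congr ?_ (fun k hk _ => ?_) (fun i hi => ?_) (fun i hi => ?_) ?_
    · rw [a4, if_neg (by omega)]
    · rw [a3, hlow _ (row_lt (Nat.lt_succ_self ℓ) hk)]
    · rw [a7, (hlow' _ (row_lt (Nat.lt_succ_self ℓ) hi)).1]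
    · rw [b3, (hlow' _ (row_lt (Nat.lt_succ_self ℓ) hi)).2]
    · rw [b4, if_neg (by omega)]
  · rw [a4, if_neg (by omega)]
  · rw [a5, if_neg (by omega), if_pos rfl]
  · rw [a6, if_neg (by omega)]
  · refine view_congr ?_ (fun k hk hk' => ?_) (fun i hi => ?_) (fun i hi => ?_) ?_
    · rw [a4, if_pos rfl]
    · rw [a3, hR _ hk']
    · rw [a7, (hU _ hi).1]
    · rw [b3, (hU _ hi).2]
    · rw [b4, if_pos rfl]
  · rw [a4, if_pos rfl]
  · rw [a5, if_pos rfl]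
  · rw [a6, if_pos rfl]

/-- The sample points of the level `ℓ` in the memory. -/
def sample (E : Env) (m : Mem) (ℓ : ℕ) : Fin (64 * E.q) → ℕ := fun k => m.nat 3 (ℓ * E.n + m.nat 9 k)

open Classical in
theorem tri_meanLoop {E : Env} {m : Mem} (hE : E.Holds m) {ℓ j : ℕ} (hsp : m.nat 8 0 = ℓ)
    (hj : m.nat 11 0 = j) :
    Tri meanLoop m (E.q * 512 + 7) fun m' => Frame [12, 16, 33] [7] m m' ∧
      m'.nat 16 0 = E.data.cnt (E.sample m ℓ) j ∧
      m'.real 7 0 = ∑ k, if E.data.pr (E.sample m ℓ k) j then E.data.v (E.sample m ℓ k) j else 0 := by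
  set σ : ℕ → ℕ := fun k => m.nat 3 (ℓ * E.n + m.nat 9 k) with hσ
  refine (tri_nat_seq (tri_real_seq (tri_forN (64 * E.q) 5 (fun k m' => Frame [12, 16, 33] [7] m m' ∧
    m'.nat 12 0 = k ∧ (m'.nat 16 0 = ∑ i ∈ Finset.range k, if E.data.pr (σ i) j then 1 else 0) ∧
    (m'.real 7 0 = ∑ i ∈ Finset.range k, if E.data.pr (σ i) j then E.data.v (σ i) j else 0))
    ?_ ?_ ?_))).mono (by omega) ?_
  · refine ⟨(((Frame.refl _ _ m).setNat (by decide) _ _).setReal (by decide) _ _).setNat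
      (by decide) _ _, ?_⟩
    simp [Mem.nat_setNat, Mem.real_setReal, Mem.real_setNat, Mem.nat_setReal, RExp.eval, NExp.eval]
  · rintro k m' ⟨hf, hk, -⟩
    exact ⟨(hE.frame hf).s_eq, hk⟩
  · rintro k m' hk ⟨hf, hk', e16, e7⟩
    have hE' := hE.frame hf
    have e8 : m'.nat 8 0 = ℓ := by rw [hf.1 8 (by decide), hsp]
    have e11 : m'.nat 11 0 = j := by rw [hf.1 11 (by decide), hj]
    have hpos : ∀ m'', m''.nat 8 = m'.nat 8 → m''.nat 0 = m'.nat 0 → m''.nat 3 = m'.nat 3 →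
        m''.nat 9 = m'.nat 9 → m''.nat 12 = m'.nat 12 → m''.nat 11 = m'.nat 11 →
        posS.eval m'' = σ k * E.d + j := by
      intro m'' h1 h2 h3 h4 h5 h6
      simp only [posS, offR, sc, nN, nD, NExp.eval, h1, h2, h3, h4, h5, h6, e8, hE'.n_eq, hE'.d_eq, hk',
        e11, hσ]
      rw [hf.1 3 (by decide), hf.1 9 (by decide)]
    have hp0 := hpos m' rfl rfl rfl rfl rfl rfl
    refine (tri_ite (t := 3) (fun hb => ?_) (fun hb => ?_)).mono (by omega) fun _ => id
    · have hp : E.data.pr (σ k) j := by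
        simpa [Test.Holds, NExp.eval, hp0, hE'.D_eq, data] using hb
      refine (tri_nat_seq (tri_setReal ?_)).mono (by omega) fun _ => id
      refine ⟨by simp [Mem.nat_setReal, Mem.nat_setNat, hk'],
        ((hf.setNat (by decide) _ _).setReal (by decide) _ _).setNat (by decide) _ _, ?_⟩
      have hv : E.V (σ k * E.d + j) = E.data.v (σ k) j := rfl
      have hp1 := hpos (m'.setNat 16 ((NExp.lit 0).eval m') (((sc 16).add (.lit 1)).eval m'))
        (by funext i; simp [Mem.nat_setNat]) (by funext i; simp [Mem.nat_setNat])
        (by funext i; simp [Mem.nat_setNat]) (by funext i; simp [Mem.nat_setNat])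
        (by funext i; simp [Mem.nat_setNat]) (by funext i; simp [Mem.nat_setNat])
      simp only [RExp.eval, hp1, Mem.real_setNat]
      simp [Mem.nat_setNat, Mem.real_setReal, Mem.real_setNat, Mem.nat_setReal, NExp.eval,
        Finset.sum_range_succ, hp, sc, e16, e7, hE'.V_eq, hv, -Finset.sum_boole]
    · have hp : ¬ E.data.pr (σ k) j := by
        simpa [Test.Holds, NExp.eval, hp0, hE'.D_eq, data] using hb
      refine (tri_setNat ?_).mono (by omega) fun _ => id
      refine ⟨by simp [Mem.nat_setNat, hk'], (hf.setNat (by decide) _ _).setNat (by decide) _ _, ?_⟩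
      simp [Mem.nat_setNat, Mem.real_setNat, Finset.sum_range_succ, hp, e16, e7, -Finset.sum_boole]
  · rintro m' ⟨hf, -, e16, e7⟩
    refine ⟨hf, e16.trans ?_, e7.trans ?_⟩
    · rw [Finset.sum_range, Data.cnt, Finset.card_filter]; rfl
    · rw [Finset.sum_range]; rfl

open Classical in
-- The loop modifies the flags it reads, but `Learns` refers to the old ones. This is consistent
-- because each flag is read before it is written, and the countdown is expressed by the unknown
-- coordinates of the old view.
theorem tri_learnCmd {E : Env} {m : Mem} (hE : E.Holds m) {ℓ t h : ℕ} (hsp : m.nat 8 0 = ℓ)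
    (h13 : m.nat 13 0 = t) (ht : t < 2) (h14 : m.nat 14 0 = h) :
    Tri learnCmd m (E.d * (E.q * 512 + 30) + 5) fun m' =>
      Frame [7, 11, 12, 15, 16, 33] [3, 7] m m' ∧ E.Same ℓ m m' ∧
      E.view m' ℓ = E.data.learn (E.view m ℓ) t h (E.sample m ℓ) := by
  set W := E.view m ℓ with hW
  set σ := E.sample m ℓ with hσ
  set pos : ℕ → ℕ := fun j => ℓ * (2 * E.d) + t * E.d + j with hpos
  have hkn (j : ℕ) (hj : j < E.d) : W.kn t j ↔ 1 ≤ m.nat 7 (pos j) := by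
    simp [hW, view, hj, hpos]; omega
  refine (tri_nat_seq (tri_forN E.d (E.q * 512 + 26) (fun k m' =>
    Frame [7, 11, 12, 15, 16, 33] [3, 7] m m' ∧
    m'.nat 11 0 = k ∧ m'.nat 15 0 = h - Data.unl W t k ∧
    (∀ i, (∀ j < k, i ≠ pos j) → m'.nat 7 i = m.nat 7 i ∧ m'.real 3 i = m.real 3 i) ∧
    ∀ j < k, (m'.nat 7 (pos j) = if E.data.Learns W t h σ j then 1 else m.nat 7 (pos j)) ∧
      (m'.real 3 (pos j) = if E.data.Learns W t h σ j then E.data.mean σ j else m.real 3 (pos j)))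
      ?_ ?_ ?_)).mono (by nlinarith) ?_
  · refine ⟨((Frame.refl _ _ m).setNat (by decide) _ _).setNat (by decide) _ _, ?_⟩
    simp [Mem.nat_setNat, Mem.real_setNat, NExp.eval, sc, h14, Data.unl]
  · rintro k m' ⟨hf, hk, -⟩
    refine ⟨?_, hk⟩
    simp [nD, NExp.eval, (hE.frame hf).d_eq]
  · rintro k m₁ hk ⟨hf, hk', e15, hother, hdone⟩
    have hE₁ := hE.frame hf
    have e8 : m₁.nat 8 0 = ℓ := by rw [hf.1 8 (by decide), hsp]
    have e13 : m₁.nat 13 0 = t := by rw [hf.1 13 (by decide), h13]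
    have e14 : m₁.nat 14 0 = h := by rw [hf.1 14 (by decide), h14]
    have hposeval : ∀ m', m'.nat 8 0 = ℓ → m'.nat 0 1 = E.d → m'.nat 13 0 = t → m'.nat 11 0 = k →
        posU.eval m' = pos k := by
      intro m' h1 h2 h3 h4
      simp [posU, offU, sc, nD, NExp.eval, h1, h2, h3, h4, hpos]
    have hp1 := hposeval m₁ e8 hE₁.d_eq e13 hk'
    have hcell := hother (pos k) fun j hj h => by simp only [hpos] at h; omega
    have fin : ∀ m₂, Frame [7, 11, 12, 15, 16, 33] [3, 7] m m₂ → m₂.nat 11 0 = k →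
        (∀ i, i ≠ pos k → m₂.nat 7 i = m₁.nat 7 i ∧ m₂.real 3 i = m₁.real 3 i) →
        m₂.nat 15 0 = h - Data.unl W t (k + 1) →
        (m₂.nat 7 (pos k) = if E.data.Learns W t h σ k then 1 else m.nat 7 (pos k)) →
        (m₂.real 3 (pos k) = if E.data.Learns W t h σ k then E.data.mean σ k else m.real 3 (pos k)) →
        m₂.nat 11 0 = k ∧ (Frame [7, 11, 12, 15, 16, 33] [3, 7] m (m₂.setNat 11 0 (k + 1)) ∧
          (m₂.setNat 11 0 (k + 1)).nat 11 0 = k + 1 ∧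
          (m₂.setNat 11 0 (k + 1)).nat 15 0 = h - Data.unl W t (k + 1) ∧
          (∀ i, (∀ j < k + 1, i ≠ pos j) → (m₂.setNat 11 0 (k + 1)).nat 7 i = m.nat 7 i ∧
            (m₂.setNat 11 0 (k + 1)).real 3 i = m.real 3 i) ∧
          ∀ j < k + 1, ((m₂.setNat 11 0 (k + 1)).nat 7 (pos j) =
              if E.data.Learns W t h σ j then 1 else m.nat 7 (pos j)) ∧
            ((m₂.setNat 11 0 (k + 1)).real 3 (pos j) =
              if E.data.Learns W t h σ j then E.data.mean σ j else m.real 3 (pos j))) := by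
      intro m₂ hf₂ h11 hcells h15 h7 h3
      have c7 : ∀ i, (m₂.setNat 11 0 (k + 1)).nat 7 i = m₂.nat 7 i := fun i => by
        simp [Mem.nat_setNat]
      refine ⟨h11, hf₂.setNat (by decide) _ _, by simp [Mem.nat_setNat], by simp [Mem.nat_setNat, h15],
        fun i hi => ?_, fun j hj => ?_⟩
      · rw [c7, Mem.real_setNat]
        obtain ⟨h1, h2⟩ := hcells i (hi k (by omega))
        rw [h1, h2]
        exact hother i fun j hj => hi j (by omega)
      · rw [c7, Mem.real_setNat]
        by_cases hjk : j = k
        · rw [hjk]; exact ⟨h7, h3⟩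
        · obtain ⟨h1, h2⟩ := hcells (pos j) (by simp only [hpos]; omega)
          rw [h1, h2]
          exact hdone j (by omega)
    refine (tri_ite (t := E.q * 512 + 20) (fun hb => ?_) (fun hb => ?_)).mono (by omega) fun _ => id
    · have hz : m.nat 7 (pos k) = 0 := by
        simpa [Test.Holds, NExp.eval, hp1, hcell.1] using hb
      have hnk : ¬ W.kn t k := by rw [hkn k hk]; omega
      have hunl := Data.unl_succ hnk
      refine (tri_seq (t := E.q * 512 + 15) (t' := 1) (S := fun m₂ =>
        Frame [7, 11, 12, 15, 16, 33] [3, 7] m m₂ ∧ m₂.nat 11 0 = k ∧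
        (∀ i, i ≠ pos k → m₂.nat 7 i = m₁.nat 7 i ∧ m₂.real 3 i = m₁.real 3 i) ∧
        m₂.nat 15 0 = h - Data.unl W t k ∧
        (m₂.nat 7 (pos k) = if E.data.Learns W t h σ k then 1 else m.nat 7 (pos k)) ∧
        (m₂.real 3 (pos k) = if E.data.Learns W t h σ k then E.data.mean σ k else m.real 3 (pos k)))
        ?_ ?_).mono (by omega) fun _ => id
      · have hskip : ¬ E.data.Learns W t h σ k → ∀ m₂, Frame [12, 16, 33] [7] m₁ m₂ →
            Tri skip m₂ 1 fun m₂ => Frame [7, 11, 12, 15, 16, 33] [3, 7] m m₂ ∧ m₂.nat 11 0 = k ∧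
            (∀ i, i ≠ pos k → m₂.nat 7 i = m₁.nat 7 i ∧ m₂.real 3 i = m₁.real 3 i) ∧
            m₂.nat 15 0 = h - Data.unl W t k ∧
            (m₂.nat 7 (pos k) = if E.data.Learns W t h σ k then 1 else m.nat 7 (pos k)) ∧
            (m₂.real 3 (pos k) =
              if E.data.Learns W t h σ k then E.data.mean σ k else m.real 3 (pos k)) := by
          intro hL m₂ hf₂
          have hf₃ := hf₂.setNat (a := 33) (by decide) ((NExp.lit 0).eval m₂) ((NExp.lit 0).eval m₂)
          refine tri_setNat ?_
          rw [if_neg hL, if_neg hL, hf₃.1 7 (by decide), hf₃.1 11 (by decide), hf₃.1 15 (by decide),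
            hf₃.2 3 (by decide)]
          exact ⟨hf.trans hf₃ (by decide) (by decide), hk', fun i _ => ⟨rfl, rfl⟩, e15, hcell.1, hcell.2⟩
        have helig : (Test.neg (.and (.natLe (.lit 1) (sc 14))
            (.neg (.and (.natLe (.lit 1) (sc 15)) (.natLe (sc 15) (.lit 1)))))).Holds m₁ ↔
            (h = 0 ∨ h = Data.unl W t k + 1) := by
          simp only [Test.Holds, NExp.eval, sc, e14, e15]
          omega
        refine (tri_ite (t := E.q * 512 + 13) (fun hb => ?_) (fun hb => ?_)).mono (by omega)
          fun _ => id
        · rw [helig] at hb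
          refine (tri_seq (tri_meanLoop hE₁ e8 hk') (t' := 5) fun m₂ hm₂ => ?_).mono (by omega)
            fun _ => id
          obtain ⟨hf₂, e16, e7⟩ := hm₂
          have hσ₁ : E.sample m₁ ℓ = σ := by
            rw [hσ]; unfold sample
            rw [hf.1 3 (by decide), hf.1 9 (by decide)]
          rw [hσ₁] at e16 e7
          have hE₂ := hE₁.frame hf₂
          refine (tri_ite (t := 3) (fun hc => ?_) (fun hc => ?_)).mono (by omega) fun _ => id
          · have hL : E.data.Learns W t h σ k := by
              refine ⟨hk, hnk, hb, ?_⟩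
              simpa [Test.Holds, NExp.eval, sc, hE₂.s_eq, e16] using hc
            have p8 : m₂.nat 8 0 = ℓ := by rw [hf₂.1 8 (by decide), e8]
            have p13 : m₂.nat 13 0 = t := by rw [hf₂.1 13 (by decide), e13]
            have p11 : m₂.nat 11 0 = k := by rw [hf₂.1 11 (by decide), hk']
            have p15 : m₂.nat 15 0 = h - Data.unl W t k := by rw [hf₂.1 15 (by decide), e15]
            have p7 : m₂.nat 7 = m₁.nat 7 := hf₂.1 7 (by decide)
            have p3 : m₂.real 3 = m₁.real 3 := hf₂.2 3 (by decide)
            have hp2 := hposeval m₂ p8 hE₂.d_eq p13 p11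
            refine (tri_real_seq (tri_setNat ?_)).mono (by omega) fun _ => id
            rw [hp2, hposeval (m₂.setReal 3 (pos k) _) p8 hE₂.d_eq p13 p11]
            have hf₃ := hf.trans hf₂ (by decide) (by decide)
            refine ⟨(hf₃.setReal (by decide) _ _).setNat (by decide) _ _,
              by simp [Mem.nat_setNat, Mem.nat_setReal, p11], fun i hi => ?_,
              by simp [Mem.nat_setNat, Mem.nat_setReal, p15], ?_, ?_⟩
            · simp [Mem.nat_setNat, Mem.nat_setReal, Mem.real_setReal, Mem.real_setNat, hi, p7, p3]
            · simp [Mem.nat_setNat, NExp.eval, hL]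
            · simp only [Mem.real_setNat, Mem.real_setReal, and_self, if_true, RExp.eval, NExp.eval, sc,
                e16, e7, if_pos hL]
              rfl
          · have hL : ¬ E.data.Learns W t h σ k := by
              rintro ⟨-, -, -, h4⟩
              exact hc (by simpa [Test.Holds, NExp.eval, sc, hE₂.s_eq, e16] using h4)
            exact (hskip hL m₂ hf₂).mono (by omega) fun _ => id
        · rw [helig] at hb
          have hL : ¬ E.data.Learns W t h σ k := fun hL => hb hL.2.2.1
          exact (hskip hL m₁ (Frame.refl _ _ _)).mono (by omega) fun _ => id
      · rintro m₂ ⟨hf₂, h11, hcells, h15, h7, h3⟩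
        refine tri_setNat ?_
        refine fin _ (hf₂.setNat (by decide) _ _) (by simp [Mem.nat_setNat, h11]) (fun i hi => ?_) ?_ ?_ ?_
        · simpa [Mem.nat_setNat, Mem.real_setNat] using hcells i hi
        · simp [Mem.nat_setNat, NExp.eval, sc, h15, hunl]; omega
        · simpa [Mem.nat_setNat] using h7
        · simpa [Mem.real_setNat] using h3
    · have hz : 1 ≤ m.nat 7 (pos k) := by
        have : ¬ m.nat 7 (pos k) = 0 := by simpa [Test.Holds, NExp.eval, hp1, hcell.1] using hb
        omega
      have hk7 : W.kn t k := (hkn k hk).2 hz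
      have hL : ¬ E.data.Learns W t h σ k := fun hL => hL.2.1 hk7
      have hunl := Data.unl_succ_of_kn hk7
      refine (tri_setNat ?_).mono (by omega) fun _ => id
      refine fin _ (hf.setNat (by decide) _ _) (by simp [Mem.nat_setNat, hk']) (fun i _ => ?_) ?_ ?_ ?_
      · simp [Mem.nat_setNat, Mem.real_setNat]
      · simp [Mem.nat_setNat, e15, hunl]
      · simp [Mem.nat_setNat, hL, hcell.1]
      · simp [Mem.real_setNat, hL, hcell.2]
  · rintro m' ⟨hf, -, -, hother, hdone⟩
    have hge (j : ℕ) : ℓ * (2 * E.d) ≤ pos j := by simp only [hpos]; omega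
    refine ⟨hf, same_of_cells (fun i _ => by rw [hf.1 3 (by decide)])
      (fun i _ => by rw [hf.1 4 (by decide)]) (fun i _ => by rw [hf.1 5 (by decide)])
      (fun i _ => by rw [hf.1 6 (by decide)])
      (fun i hi => (hother i fun j _ h => by have := hge j; omega).1)
      (fun i hi => (hother i fun j _ h => by have := hge j; omega).2)
      (fun i _ => by rw [hf.2 4 (by decide)]), ?_⟩
    have hne (t' j : ℕ) (ht' : t' < 2) (hj : j < E.d) (hne : t' ≠ t) :
        ∀ j' < E.d, ℓ * (2 * E.d) + t' * E.d + j ≠ pos j' := by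
      intro j' hj'
      simp only [hpos]
      interval_cases t <;> interval_cases t' <;> omega
    unfold Data.learn
    rw [view]
    congr 1
    · rw [hf.1 4 (by decide), hf.1 3 (by decide)]; rfl
    · funext t' j
      refine propext ?_
      by_cases htt : t' = t
      · subst htt
        constructor
        · rintro ⟨h1, h2, h3⟩
          have := (hdone j h2).1
          by_cases hL : E.data.Learns W t' h σ j
          · exact .inr ⟨rfl, hL⟩
          · rw [if_neg hL] at this
            refine .inl ((hkn j h2).2 (by rw [← this]; exact h3))
        · rintro (hk | ⟨-, hL⟩)
          · have hj : j < E.d := hk.2.1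
            refine ⟨ht, hj, ?_⟩
            have := (hdone j hj).1
            rw [if_neg fun hL => hL.2.1 hk] at this
            exact this.ge.trans' ((hkn j hj).1 hk)
          · have hj : j < E.d := hL.1
            refine ⟨ht, hj, ?_⟩
            have := (hdone j hj).1
            rw [if_pos hL] at this
            exact this.ge
      · have : (t' < 2 ∧ j < E.d ∧ 1 ≤ m'.nat 7 (ℓ * (2 * E.d) + t' * E.d + j)) ↔ W.kn t' j := by
          rw [hW]
          refine and_congr_right fun h1 => and_congr_right fun h2 => ?_
          rw [(hother _ (hne t' j h1 h2 htt)).1]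
        simp only [this, htt, false_and, or_false]
    · funext t' j
      by_cases hlt : t' < 2 ∧ j < E.d
      · rw [if_pos hlt]
        by_cases htt : t' = t
        · subst htt
          have := (hdone j hlt.2).2
          simp only [true_and]
          refine this.trans ?_
          split_ifs
          · rfl
          · simp [hW, view, hlt.2, hpos]; omega
        · simp only [htt, false_and, if_false]
          rw [(hother _ (hne t' j hlt.1 hlt.2 htt)).2]
          simp [hW, view, hlt.2]; omega
      · rw [if_neg hlt, if_neg]
        · simp only [hW, view]; rw [if_neg hlt]
        · rintro ⟨rfl, hL⟩
          exact hlt ⟨ht, hL.1⟩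
    · rw [hf.2 4 (by decide)]; rfl

/-- The center values are left over from earlier searches, hence the existential `u`; with no
coordinate known they are irrelevant. -/
theorem tri_startCmd {E : Env} {m : Mem} (hE : E.Holds m) :
    Tri startCmd m (E.n * 4 + E.d * 8 + 19) fun m' =>
      Frame [3, 4, 5, 6, 7, 8, 10] [4] m m' ∧ m'.nat 8 0 = 1 ∧
      (∃ u, E.view m' 1 = ⟨List.range E.n, fun _ _ => False, u, 0⟩) ∧ m'.nat 4 1 = E.n ∧
      m'.nat 5 1 = 0 ∧ m'.nat 6 1 = 0 := by
  refine (tri_seq (tri_forN E.n 1 (fun k m' => Frame [3, 10] [] m m' ∧ m'.nat 10 0 = k ∧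
    ∀ i < k, m'.nat 3 (E.n + i) = i) ?_ ?_ ?_) (t' := E.d * 8 + 14) fun m₁ hm₁ => ?_).mono
    (by omega) fun _ => id
  · exact ⟨(Frame.refl _ _ m).setNat (by decide) _ _, by simp [Mem.nat_setNat], by simp⟩
  · rintro k m' ⟨hf, hk, -⟩
    exact ⟨(hE.frame hf).n_eq, hk⟩
  · rintro k m₁ hk ⟨hf, hk', hi⟩
    have hn := (hE.frame hf).n_eq
    refine tri_setNat ⟨by simp [Mem.nat_setNat, hk'], (hf.setNat (by decide) _ _).setNat (by decide) _ _,
      by simp [Mem.nat_setNat], fun i hik => ?_⟩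
    by_cases h : i = k
    · simp [Mem.nat_setNat, NExp.eval, sc, nN, hk', h, hn]
    · simp [Mem.nat_setNat, NExp.eval, sc, nN, hk', h, hn, hi i (by omega)]
  obtain ⟨hf₁, -, hR⟩ := hm₁
  have hE₁ := hE.frame hf₁
  refine (tri_seq (tri_forN (2 * E.d) 1 (fun k m' => Frame [7, 10] [] m₁ m' ∧ m'.nat 10 0 = k ∧
    ∀ i < k, m'.nat 7 (2 * E.d + i) = 0) ?_ ?_ ?_) (t' := 10) fun m₂ hm₂ => ?_).mono
    (by omega) fun _ => id
  · exact ⟨(Frame.refl _ _ m₁).setNat (by decide) _ _, by simp [Mem.nat_setNat], by simp⟩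
  · rintro k m' ⟨hf, hk, -⟩
    refine ⟨?_, hk⟩
    simp [nD, NExp.eval, (hE₁.frame hf).d_eq]
  · rintro k m₂ hk ⟨hf, hk', hi⟩
    have hd := (hE₁.frame hf).d_eq
    refine tri_setNat ⟨by simp [Mem.nat_setNat, hk'], (hf.setNat (by decide) _ _).setNat (by decide) _ _,
      by simp [Mem.nat_setNat], fun i hik => ?_⟩
    by_cases h : i = k
    · simp [Mem.nat_setNat, NExp.eval, sc, nD, hk', h, hd]
    · simp [Mem.nat_setNat, NExp.eval, sc, nD, hk', h, hd, hi i (by omega)]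
  obtain ⟨hf₂, -, hU⟩ := hm₂
  have e3 : m₂.nat 3 = m₁.nat 3 := hf₂.1 3 (by decide)
  have hn := (hE₁.frame hf₂).n_eq
  set m₃ := ((((m₂.setNat 4 1 E.n).setReal 4 1 0).setNat 5 1 0).setNat 6 1 0).setNat 8 0 1 with hm₃
  refine (tri_nat_seq (tri_real_seq (tri_nat_seq (tri_nat_seq (tri_setNat
    (S := fun m' => m' = m₃) ?_))))).mono (by omega) ?_
  · simp [NExp.eval, RExp.eval, nN, hn, hm₃]
  rintro _ rfl
  have hf : Frame [3, 4, 5, 6, 7, 8, 10] [4] m m₂ :=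
    ((Frame.refl _ _ m).trans hf₁ (by decide) (by decide)).trans hf₂ (by decide) (by decide)
  have h41 : m₃.nat 4 1 = E.n := by rw [hm₃]; simp [Mem.nat_setNat, Mem.nat_setReal]
  refine ⟨((((hf.setNat (by decide) _ _).setReal (by decide) _ _).setNat (by decide) _ _).setNat
    (by decide) _ _).setNat (by decide) _ _, by rw [hm₃]; simp [Mem.nat_setNat],
    ⟨(E.view m₃ 1).u, ?_⟩, h41, by rw [hm₃]; simp [Mem.nat_setNat], by rw [hm₃]; simp [Mem.nat_setNat]⟩
  have hb : m₃.real 4 1 = 0 := by rw [hm₃]; simp [Mem.real_setNat, Mem.real_setReal]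
  have h7 (i : ℕ) (hi : i < 2 * E.d) : m₃.nat 7 (1 * (2 * E.d) + i) = 0 := by
    rw [hm₃]; simpa [Mem.nat_setNat, Mem.nat_setReal] using hU i hi
  have h3 (i : ℕ) (hi : i < E.n) : m₃.nat 3 (1 * E.n + i) = i := by
    rw [hm₃]; simpa [Mem.nat_setNat, Mem.nat_setReal, e3] using hR i hi
  unfold view
  congr 1
  · rw [h41, min_self]
    conv_rhs => rw [← List.map_id (List.range E.n)]
    exact List.map_congr_left fun k hk => h3 k (List.mem_range.1 hk)
  · funext t j
    refine propext ⟨?_, False.elim⟩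
    rintro ⟨ht, hj, h⟩
    rw [add_assoc, h7 _ (by interval_cases t <;> omega)] at h
    omega

open Classical in
theorem tri_labelCmd {E : Env} {m : Mem} (hE : E.Holds m) :
    Tri labelCmd m (E.n * (E.d * 10 + 20) + 3) fun m' => m'.real 2 = m.real 2 ∧
      ∀ i < E.n, m'.nat 2 i = if E.data.cst (E.out m 0) i ≤ E.data.cst (E.out m 1) i then 0 else 1 := by
  refine (tri_forN E.n (E.d * 10 + 17) (fun k m' => Frame [2, 10, 11, 17, 33] [7, 8] m m' ∧
    m'.nat 10 0 = k ∧ ∀ i < k, m'.nat 2 i =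
      if E.data.cst (E.out m 0) i ≤ E.data.cst (E.out m 1) i then 0 else 1) ?_ ?_ ?_).mono (by rw [add_assoc]) ?_
  · exact ⟨(Frame.refl _ _ m).setNat (by decide) _ _, by simp [Mem.nat_setNat], by simp⟩
  · rintro k m' ⟨hf, hk, -⟩
    exact ⟨(hE.frame hf).n_eq, hk⟩
  · rintro k m₁ hk ⟨hf, hk', hi⟩
    refine (tri_nat_seq (t := E.d * 10 + 14) ?_).mono (by omega) fun _ => id
    rw [show (sc 10).eval m₁ = k from hk', show (NExp.lit 0).eval m₁ = 0 from rfl]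
    set m₂ := m₁.setNat 17 0 k with hm₂
    have hf₂ : Frame [2, 10, 11, 17, 33] [7, 8] m m₂ := hf.setNat (by decide) _ _
    have hE₂ := hE.frame hf₂
    have e10 : m₂.nat 10 0 = k := by rw [hm₂]; simp [Mem.nat_setNat, hk']
    have e17 : m₂.nat 17 0 = k := by rw [hm₂]; simp [Mem.nat_setNat]
    have e2 : m₂.nat 2 = m₁.nat 2 := by rw [hm₂]; funext i; simp [Mem.nat_setNat]
    refine (tri_seq (tri_costLoop hE₂ (arr := 2) (by decide) (by decide) (o₀ := .lit 0) (o₁ := nD) (c₀ := 0) (c₁ := E.d)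
      (fun _ _ => rfl) (fun m' hf' => (hE₂.frame hf').d_eq)) (t' := 2) fun m₃ hm₃ => ?_).mono (by omega)
      fun _ => id
    obtain ⟨hf₃, e7, e8⟩ := hm₃
    have ho : m₂.real 2 = m.real 2 := hf₂.2 2 (by decide)
    have r0 : m₃.real 7 0 = E.data.cst (E.out m 0) k := by
      rw [e7, e17, ho]
      congr 1
      funext j
      simp [out]
    have r1 : m₃.real 8 0 = E.data.cst (E.out m 1) k := by
      rw [e8, e17, ho]
      congr 1
      funext j
      simp [out]
    have e10' : m₃.nat 10 0 = k := by rw [hf₃.1 10 (by decide), e10]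
    have e2' : m₃.nat 2 = m₁.nat 2 := by rw [hf₃.1 2 (by decide), e2]
    have hf' := hf₂.trans hf₃ (by decide) (by decide)
    have fin (v : ℕ) (hv : v = if E.data.cst (E.out m 0) k ≤ E.data.cst (E.out m 1) k then 0 else 1) :
        Tri (.setNat 2 (sc 10) (.lit v)) m₃ 1 fun m' => m'.nat 10 0 = k ∧
          Frame [2, 10, 11, 17, 33] [7, 8] m (m'.setNat 10 0 (k + 1)) ∧
          (m'.setNat 10 0 (k + 1)).nat 10 0 = k + 1 ∧ ∀ i < k + 1, (m'.setNat 10 0 (k + 1)).nat 2 i =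
            if E.data.cst (E.out m 0) i ≤ E.data.cst (E.out m 1) i then 0 else 1 := by
      refine tri_setNat ⟨by simp [Mem.nat_setNat, e10'], (hf'.setNat (by decide) _ _).setNat
        (by decide) _ _, by simp [Mem.nat_setNat], fun i hik => ?_⟩
      by_cases h : i = k
      · simp [Mem.nat_setNat, NExp.eval, sc, e10', h, hv]
      · simp [Mem.nat_setNat, NExp.eval, sc, e10', h, e2', hi i (by omega)]
    refine (tri_ite (t := 1) (fun hb => fin 0 ?_) (fun hb => fin 1 ?_)).mono (by omega) fun _ => id
    · rw [if_pos]
      simpa [Test.Holds, RExp.eval, NExp.eval, r0, r1] using hb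
    · rw [if_neg]
      simpa [Test.Holds, RExp.eval, NExp.eval, r0, r1] using hb
  · rintro m' ⟨hf, -, h⟩
    exact ⟨hf.2 2 (by decide), h⟩

/-- The specification of `paramCmd`. -/
theorem tri_paramCmd {m : Mem} {n d Δ q : ℕ} {ε : ℝ} (h0 : m.nat 0 0 = n) (h1 : m.nat 0 1 = d)
    (h2 : m.nat 0 2 = Δ) (he : m.real 0 0 = ε) (hq : 1 ≤ q) (hq1 : 1 ≤ q * ε)
    (hmin : ∀ k < q, 1 ≤ k → k * ε < 1) :
    Tri paramCmd m (q * 2 + (64 * q + 1) * (4 * Δ + 2) * 4 + 20) fun m' =>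
      Frame [20, 21, 22, 23, 24, 25] [] m m' ∧ Holds ⟨n, d, Δ, q, m.nat 1, m.real 1⟩ m' ∧
      m'.nat 24 0 = (4096 * Δ * q) ^ ((64 * q + 1) * (4 * Δ + 2) + 1) := by
  refine (tri_nat_seq (tri_seq (t := q * 2 + 1) (t' := (64 * q + 1) * (4 * Δ + 2) * 4 + 12)
    (S := fun m' => Frame [20] [] m m' ∧ m'.nat 20 0 = q) ?_ ?_)).mono (by omega) fun _ => id
  · refine (tri_loop (N := q) (t := 1) (k := 1) (fun k m' => Frame [20] [] m m' ∧ m'.nat 20 0 = k ∧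
      1 ≤ k ∧ k ≤ q) ?_ ?_ ?_ hq ?_).mono (by omega) fun _ => id
    · rintro k m' ⟨hf, hk, hk1, hkq⟩ hb
      refine ⟨hf, ?_⟩
      have er : m'.real 0 0 = ε := by rw [hf.2 0 (by decide), he]
      have : 1 ≤ (k : ℝ) * ε := by
        simpa [Test.Holds, RExp.eval, NExp.eval, sc, hk, er] using hb
      by_contra hne
      have := hmin k (by omega) hk1
      linarith
    · rintro k m' ⟨hf, hk, hk1, hkq⟩ hb
      have er : m'.real 0 0 = ε := by rw [hf.2 0 (by decide), he]
      have hb' : ¬ 1 ≤ (k : ℝ) * ε := by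
        simpa [Test.Holds, RExp.eval, NExp.eval, sc, hk, er] using hb
      rcases hkq.lt_or_eq with h | h
      · exact h
      · subst h; exact absurd hq1 hb'
    · rintro k m' ⟨hf, hk, hk1, hkq⟩ hb
      have er : m'.real 0 0 = ε := by rw [hf.2 0 (by decide), he]
      have hb' : ¬ 1 ≤ (k : ℝ) * ε := by
        simpa [Test.Holds, RExp.eval, NExp.eval, sc, hk, er] using hb
      refine tri_setNat ⟨hf.setNat (by decide) _ _, by simp [Mem.nat_setNat, NExp.eval, sc, hk],
        by omega, ?_⟩
      rcases hkq.lt_or_eq with h | h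
      · exact h
      · subst h; exact absurd hq1 hb'
    · exact ⟨(Frame.refl _ _ m).setNat (by decide) _ _, by simp [Mem.nat_setNat, NExp.eval], le_rfl, hq⟩
  rintro m₁ ⟨hf, h20⟩
  have e0 : m₁.nat 0 2 = Δ := by rw [hf.1 0 (by decide), h2]
  set m₂ := ((((m₁.setNat 21 0 (64 * q)).setNat 22 0 (4096 * Δ * q)).setNat 23 0 (4 * Δ + 2)).setNat 24 0
    (4096 * Δ * q)) with hm₂
  have hf₂ : Frame [20, 21, 22, 23, 24, 25] [] m m₂ :=
    (((((Frame.refl _ _ m).trans hf (by decide) (by decide)).setNat (by decide) _ _).setNat (by decide) _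
      _).setNat (by decide) _ _).setNat (by decide) _ _
  have key : Tri (forN 25 (.mul (.add (sc 21) (.lit 1)) (sc 23)) (setv 24 (.mul (sc 24) (sc 22)))) m₂
      ((64 * q + 1) * (4 * Δ + 2) * 4 + 3) fun m' =>
      Frame [20, 21, 22, 23, 24, 25] [] m m' ∧ Holds ⟨n, d, Δ, q, m.nat 1, m.real 1⟩ m' ∧
      m'.nat 24 0 = (4096 * Δ * q) ^ ((64 * q + 1) * (4 * Δ + 2) + 1) := by
    refine (tri_forN ((64 * q + 1) * (4 * Δ + 2)) 1 (fun k m' => Frame [24, 25] [] m₂ m' ∧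
      m'.nat 25 0 = k ∧ m'.nat 24 0 = (4096 * Δ * q) ^ (k + 1)) ?_ ?_ ?_).mono (by omega) ?_
    · refine ⟨(Frame.refl _ _ _).setNat (by decide) _ _, by simp [Mem.nat_setNat], ?_⟩
      simp [Mem.nat_setNat, hm₂]
    · rintro k m' ⟨hf', hk, -⟩
      refine ⟨?_, hk⟩
      simp only [NExp.eval, sc, hf'.1 21 (by decide), hf'.1 23 (by decide)]
      simp [hm₂, Mem.nat_setNat]
    · rintro k m' hk ⟨hf', hk', hp⟩
      have e22 : m'.nat 22 0 = 4096 * Δ * q := by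
        rw [hf'.1 22 (by decide), hm₂]; simp [Mem.nat_setNat]
      refine tri_setNat ⟨by simp [Mem.nat_setNat, hk'], (hf'.setNat (by decide) _ _).setNat (by decide) _ _,
        by simp [Mem.nat_setNat], ?_⟩
      simp [Mem.nat_setNat, NExp.eval, sc, hp, e22, pow_succ]
    · rintro m' ⟨hf', -, hp⟩
      have hf₃ := hf₂.trans hf' (by decide) (by decide)
      refine ⟨hf₃, ⟨?_, ?_, ?_, ?_, ?_, ?_, ?_⟩, hp⟩
      · rw [hf₃.1 0 (by decide), h0]
      · rw [hf₃.1 0 (by decide), h1]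
      · rw [hf₃.1 0 (by decide), h2]
      · rw [hf₃.1 1 (by decide)]
      · rw [hf₃.2 1 (by decide)]
      · rw [hf'.1 21 (by decide), hm₂]; simp [Mem.nat_setNat]
      · rw [hf'.1 23 (by decide), hm₂]; simp [Mem.nat_setNat]
  refine (tri_nat_seq (tri_nat_seq (tri_nat_seq (tri_nat_seq (t := (64 * q + 1) * (4 * Δ + 2) * 4 + 3)
    ?_)))).mono (by omega) fun _ => id
  convert key using 1
  simp [hm₂, NExp.eval, Mem.nat_setNat, sc, nMiss, h20, e0]

/-! ### The random choices -/

theorem ok_setNat {T : ℕ} {Q : Mem → Prop} {e : ℝ} {a : ℕ} {i f : NExp} {K : List Cmd} {m m' : Mem}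
    (hm : m.setNat a (i.eval m) (f.eval m) = m') (h : Ok T Q e K m') :
    Ok (T + 1) Q e (.setNat a i f :: K) m :=
  ok_of_pure (by simp [step, hm]) h

/-- Iterated averages over single draws form the average over all tuples of positions. The induction
is on the number `j` of draws left. -/
theorem ok_drawLoop {T : ℕ} {Q : Mem → Prop} {K : List Cmd} {r s : ℕ} (hr : 0 < r) {j : ℕ} :
    ∀ {m : Mem} {k : ℕ}, rlen.eval m = r → m.nat 21 0 = s → m.nat 10 0 = k → k + j = s →
    ∀ (g : (Fin j → Fin r) → ℝ),
    (∀ (τ : Fin j → Fin r) (m' : Mem), Frame [9, 10] [] m m' → (∀ i < k, m'.nat 9 i = m.nat 9 i) →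
      (∀ i : Fin j, m'.nat 9 (k + i) = τ i) → Ok T Q (g τ) K m') →
    Ok (j * 4 + 1 + T) Q ((∑ τ, g τ) / (r : ℝ) ^ j) (drawLoop :: K) m := by
  induction j with
  | zero =>
    intro m k _ hs hk hkj g h
    have hb : ¬ (Test.natLe (.add (sc 10) (.lit 1)) (sc 21)).Holds m := by
      simp only [Test.Holds, NExp.eval, sc, hs, hk]; omega
    refine (ok_loop_false hb (h default m (Frame.refl _ _ _) (fun _ _ => rfl) fun i => i.elim0)).mono
      (by omega) (le_of_eq ?_)
    simp
  | succ j ih =>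
    intro m k hlen hs hk hkj g h
    have hb : (Test.natLe (.add (sc 10) (.lit 1)) (sc 21)).Holds m := by
      simp only [Test.Holds, NExp.eval, sc, hs, hk]; omega
    have h10 : (sc 10).eval m = k := hk
    have key : ∀ v < r, Ok (j * 4 + 1 + T + 1) Q
        (if hv : v < r then (∑ τ : Fin j → Fin r, g (Fin.cons ⟨v, hv⟩ τ)) / (r : ℝ) ^ j else 0)
        (setv 10 (.add (sc 10) (.lit 1)) :: drawLoop :: K) (m.setNat 9 ((sc 10).eval m) v) := by
      intro v hv
      rw [dif_pos hv, h10]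
      have hf : Frame [9, 10] [] m ((m.setNat 9 k v).setNat 10 0 (k + 1)) :=
        ((Frame.refl _ _ m).setNat (by decide) _ _).setNat (by decide) _ _
      refine ok_setNat (m' := (m.setNat 9 k v).setNat 10 0 (k + 1)) ?_ ?_
      · simp [NExp.eval, sc, Mem.nat_setNat, hk]
      refine ih (k := k + 1) ?_ ?_ ?_ (by omega) _ fun τ m' hf' hlt hτ => h _ m'
        (hf.trans hf' (by decide) (by decide)) (fun i hi => ?_) fun i => ?_
      · rw [← hlen]
        simp [rlen, sc, NExp.eval, Mem.nat_setNat]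
      · simp [Mem.nat_setNat, hs]
      · simp [Mem.nat_setNat]
      · rw [hlt i (by omega)]
        have : i ≠ k := by omega
        simp [Mem.nat_setNat, this]
      · refine Fin.cases ?_ (fun i => ?_) i
        · have := hlt k (by omega)
          simp only [Fin.val_zero, add_zero, Fin.cons_zero]
          rw [this]
          simp [Mem.nat_setNat]
        · simp only [Fin.val_succ, Fin.cons_succ]
          rw [← hτ i]
          congr 1
          omega
    refine (ok_loop_true hb (ok_seq (ok_rand hlen hr _ key))).mono (by omega) (le_of_eq ?_)
    rw [Finset.sum_range, ← (Fin.consEquiv fun _ : Fin (j + 1) => Fin r).sum_comp, Fintype.sum_prod_type,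
      pow_succ, ← div_div, Finset.sum_div]
    congr 1
    refine Finset.sum_congr rfl fun v _ => ?_
    simp [Fin.consEquiv]

theorem ok_drawCmd {E : Env} {m : Mem} (hE : E.Holds m) {ℓ r : ℕ} (hsp : m.nat 8 0 = ℓ)
    (hr : m.nat 4 ℓ = r) (hpos : 0 < r) {T : ℕ} {Q : Mem → Prop} {K : List Cmd}
    (g : ℕ → ℕ → (Fin (64 * E.q) → Fin r) → ℝ)
    (h : ∀ t < 2, ∀ h < 2 * E.Δ + 1, ∀ (τ : Fin (64 * E.q) → Fin r) (m' : Mem),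
      Frame [9, 10, 13, 14] [] m m' → m'.nat 13 0 = t → m'.nat 14 0 = h →
      (∀ i : Fin (64 * E.q), m'.nat 9 i = τ i) → Ok T Q (g t h τ) K m') :
    Ok (E.q * 256 + 8 + T) Q ((∑ t ∈ Finset.range 2, (∑ h ∈ Finset.range (2 * E.Δ + 1),
      (∑ τ, g t h τ) / (r : ℝ) ^ (64 * E.q)) / (2 * E.Δ + 1 : ℕ)) / (2 : ℕ)) (drawCmd :: K) m := by
  refine (ok_seq (ok_rand (T := E.q * 256 + 4 + T + 1 + 1) (r := 2) rfl (by norm_num) _ fun t ht =>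
    ok_seq (ok_rand (T := E.q * 256 + 4 + T) (r := 2 * E.Δ + 1) ?_ (by omega)
      (fun j => (∑ τ, g t j τ) / (r : ℝ) ^ (64 * E.q)) fun j hj => ?_))).mono
    (by omega) le_rfl
  · simp [NExp.eval, nMiss, Mem.nat_setNat, hE.miss_eq]
  set m₁ := ((m.setNat 13 0 t).setNat 14 0 j).setNat 10 0 0 with hm₁
  have hf : Frame [9, 10, 13, 14] [] m m₁ :=
    (((Frame.refl _ _ m).setNat (by decide) _ _).setNat (by decide) _ _).setNat (by decide) _ _
  refine (ok_seq (ok_setNat (m' := m₁) ?_ (ok_drawLoop hpos (k := 0) (s := 64 * E.q)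
    (T := T) ?_ ?_ ?_ (by omega) _ fun τ m' hf' _ hτ => h t ht j hj τ m' ?_ ?_ ?_ ?_))).mono_time ?_
  · simp [NExp.eval, hm₁]
  · simp [rlen, sc, NExp.eval, hm₁, Mem.nat_setNat, hsp, hr]
  · simp [hm₁, Mem.nat_setNat, hE.s_eq]
  · simp [hm₁, Mem.nat_setNat]
  · exact hf.trans hf' (by decide) (by decide)
  · rw [hf'.1 13 (by decide), hm₁]; simp [Mem.nat_setNat]
  · rw [hf'.1 14 (by decide), hm₁]; simp [Mem.nat_setNat]
  · simpa using hτ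
  · omega

open Classical in
/-- The points of a valid list are counted by their positions. -/
theorem Valid.card_filter {E : Env} {m : Mem} {ℓ : ℕ} (h : E.Valid m ℓ) (p : ℕ → Prop) :
    ((E.view m ℓ).R.toFinset.filter p).card =
      ((Finset.range (m.nat 4 ℓ)).filter fun k => p (m.nat 3 (ℓ * E.n + k))).card := by
  have hinj : Set.InjOn (fun k => m.nat 3 (ℓ * E.n + k)) (Finset.range (m.nat 4 ℓ)) := by
    have := h.nodup
    rw [h.R_eq] at this
    intro a ha b hb hab
    exact List.inj_on_of_nodup_map this (by simpa using ha) (by simpa using hb) hab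
  have : (E.view m ℓ).R.toFinset =
      (Finset.range (m.nat 4 ℓ)).image fun k => m.nat 3 (ℓ * E.n + k) := by
    rw [h.R_eq]
    ext x; simp
  rw [this, Finset.filter_image, Finset.card_image_of_injOn]
  exact hinj.mono fun x hx => (Finset.mem_filter.1 hx).1

open Classical in
/-- The loop that looks for a pivot fails with probability at most `2⁻ʲ`. -/
theorem ok_pivotLoop {E : Env} {ℓ r i : ℕ} {W : View} {T : ℕ} {Q : Mem → Prop} {K : List Cmd}
    {lo hi : ℝ} (hr : 0 < r) (hlo : lo ≤ hi)
    (hc : lo < hi → r ≤ 2 * (W.R.toFinset.filter fun p => E.data.GoodPivot W p).card) {j : ℕ} :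
    ∀ {m : Mem}, E.Holds m → m.nat 8 0 = ℓ → E.Valid m ℓ → E.view m ℓ = W → E.Weighed W m →
    m.nat 4 ℓ = r → m.nat 6 ℓ = i → m.nat 29 0 = 0 → m.nat 30 0 + j = i + 3 →
    (∀ m', Frame [10, 16, 17, 29, 30, 31, 33] [] m m' → m'.nat 29 0 = 0 → Ok T Q lo K m') →
    (∀ m', Frame [10, 16, 17, 29, 30, 31, 33] [] m m' → m'.nat 29 0 = 1 → m'.nat 31 0 ∈ W.R →
      E.data.GoodPivot W (m'.nat 31 0) → Ok T Q hi K m') →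
    Ok (j * (r * 8 + 16) + 1 + T) Q (hi - (hi - lo) * (1 / 2) ^ j) (pivotLoop :: K) m := by
  induction j with
  | zero =>
    intro m hE hsp hV hW hw h4 h6 h29 h30 hbad _
    have hb : ¬ pivotTest.Holds m := by
      simp only [pivotTest, Test.Holds, NExp.eval, sc, hsp, h6]; omega
    exact (ok_loop_false hb (hbad m (Frame.refl _ _ _) h29)).mono (by omega) (by simp)
  | succ j ih =>
    intro m hE hsp hV hW hw h4 h6 h29 h30 hbad hgood
    have hb : pivotTest.Holds m := by
      simp only [pivotTest, Test.Holds, NExp.eval, sc, hsp, h6, h29]; omega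
    set g := fun k => m.nat 3 (ℓ * E.n + k) with hg
    have hlen : rlen.eval m = r := by simp [rlen, sc, NExp.eval, hsp, h4]
    have key : ∀ v < r, Ok (r * 8 + 13 + (j * (r * 8 + 16) + 1 + T)) Q
        (if E.data.GoodPivot W (g v) then hi else hi - (hi - lo) * (1 / 2) ^ j)
        (tryPivot :: pivotLoop :: K) (m.setNat 31 ((NExp.lit 0).eval m) v) := by
      intro v hv
      have hf : Frame [10, 16, 17, 29, 30, 31, 33] [] m (m.setNat 31 ((NExp.lit 0).eval m) v) :=
        (Frame.refl _ _ m).setNat (by decide) _ _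
      set m₁ := m.setNat 31 ((NExp.lit 0).eval m) v with hm₁
      have e31 : m₁.nat 31 0 = v := by rw [hm₁]; simp [Mem.nat_setNat, NExp.eval]
      have e4 : m₁.nat 4 ℓ = r := by rw [hf.1 4 (by decide), h4]
      have e3 : m₁.nat 3 = m.nat 3 := hf.1 3 (by decide)
      have e29 : m₁.nat 29 0 = 0 := by rw [hm₁]; simp [Mem.nat_setNat, h29]
      have e30 : m₁.nat 30 0 = m.nat 30 0 := by rw [hm₁]; simp [Mem.nat_setNat]
      have hv₁ : E.view m₁ ℓ = W := (view_frame hf ℓ).trans hW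
      have hV₁ : E.Valid m₁ ℓ := hV.congr (view_frame hf ℓ) (by rw [e4, h4])
      have hgR : g v ∈ W.R := by
        rw [← hW, hV.R_eq, h4]; exact List.mem_map.2 ⟨v, List.mem_range.2 hv, rfl⟩
      have ht := tri_tryPivot (hE.frame hf) (by rw [hf.1 8 (by decide), hsp]) hV₁
        (hv₁ ▸ hw.frame hf) (by rw [e31, e4]; exact hv)
      rw [e4, e31, e3, hv₁, e29, e30] at ht
      refine ht _ _ _ _ fun m₂ hm₂ => ?_
      obtain ⟨hf₂, a31, a30, a29⟩ := hm₂
      have hf' := hf.trans hf₂ (by decide) (by decide)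
      by_cases hp : E.data.GoodPivot W (g v)
      · rw [if_pos hp] at a29 ⊢
        have hb : ¬ pivotTest.Holds m₂ := by
          simp only [pivotTest, Test.Holds, NExp.eval, sc, a29]; omega
        refine (ok_loop_false hb (hgood m₂ hf' a29 ?_ ?_)).mono_time (by omega)
        · rw [a31]; exact hgR
        · rw [a31]; exact hp
      · rw [if_neg hp] at a29 ⊢
        refine ih (hE.frame hf') (by rw [hf'.1 8 (by decide), hsp])
          (hV.congr (view_frame hf' ℓ) (by rw [hf'.1 4 (by decide)])) ((view_frame hf' ℓ).trans hW)
          (hw.frame hf') (by rw [hf'.1 4 (by decide), h4]) (by rw [hf'.1 6 (by decide), h6]) a29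
          (by omega) (fun m' hf'' => hbad m' (hf'.trans hf'' (by decide) (by decide)))
          (fun m' hf'' => hgood m' (hf'.trans hf'' (by decide) (by decide)))
    refine (ok_loop_true hb (ok_seq (ok_rand hlen hr _ key))).mono ?_ ?_
    · rw [Nat.succ_mul]; omega
    · have hrR : (0 : ℝ) < r := by exact_mod_cast hr
      rw [le_div_iff₀ hrR, Finset.sum_ite, Finset.sum_const, Finset.sum_const, nsmul_eq_mul, nsmul_eq_mul]
      set A := (Finset.range r).filter fun v => E.data.GoodPivot W (g v) with hA
      set B := (Finset.range r).filter fun v => ¬ E.data.GoodPivot W (g v) with hB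
      have hAB : (A.card : ℝ) + B.card = r := by
        exact_mod_cast (Finset.card_filter_add_card_filter_not (s := Finset.range r) _).trans (by simp)
      have hAc : lo < hi → (r : ℝ) ≤ 2 * A.card := fun hl => by
        have := hc hl
        rw [← hW, hV.card_filter, h4, hW] at this
        exact_mod_cast this
      have hx : (0 : ℝ) ≤ (1 / 2) ^ j := by positivity
      rw [pow_succ]
      -- A trial succeeds with probability at least `1/2`, so the expected loss `(hi - lo) / 2 ^ j`
      -- is at least halved. If `lo = hi` nothing depends on the pivot and no assumption on good
      -- pivots is needed.
      rcases hlo.lt_or_eq with hl | hl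
      · have := hAc hl
        have h1 : 0 ≤ (hi - lo) * (1 / 2) ^ j := mul_nonneg (by linarith) hx
        rw [← hAB]
        nlinarith
      · rw [hl, ← hAB]
        apply le_of_eq; ring

open Classical in
-- Here `lo` is the value of abandoning the level and `hi` the value of going on with the peeled
-- list. A good pivot has rank at least `r / 8`, so at most `7 * r / 8` points remain.
theorem ok_peelCmd {E : Env} {m : Mem} (hE : E.Holds m) {ℓ r i : ℕ} (hsp : m.nat 8 0 = ℓ)
    (hV : E.Valid m ℓ) (h4 : m.nat 4 ℓ = r) (hr : 0 < r) (h6 : m.nat 6 ℓ = i) {T : ℕ}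
    {Q : Mem → Prop} {K : List Cmd} {lo hi : ℝ} (hlo : lo ≤ hi)
    (hc : lo < hi → r ≤ 2 * ((E.view m ℓ).R.toFinset.filter fun p =>
      E.data.GoodPivot (E.view m ℓ) p).card)
    (hbad : ∀ m', Frame [8, 10, 11, 16, 17, 18, 19, 28, 29, 30, 31, 33] [6, 7, 8] m m' →
      m'.nat 8 0 = ℓ - 1 → Ok T Q lo K m')
    (hgood : ∀ m' p, E.data.GoodPivot (E.view m ℓ) p →
      Frame [3, 4, 5, 6, 10, 11, 16, 17, 18, 19, 28, 29, 30, 31, 32, 33] [4, 6, 7, 8] m m' →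
      E.Same ℓ m m' → E.view m' ℓ = E.data.peel (E.view m ℓ) p → 8 * m'.nat 4 ℓ ≤ 7 * r →
      m'.nat 5 ℓ = 0 → m'.nat 6 ℓ = i + 1 → Ok T Q hi K m') :
    Ok (r * (E.d * 20 + 40) + (i + 3) * (r * 8 + 16) + r * 10 + 40 + T) Q
      (hi - (hi - lo) * (1 / 2) ^ (i + 3)) (peelCmd :: K) m := by
  have hw := tri_weigh hE hsp hV
  rw [h4] at hw
  refine (ok_seq (hw _ ((i + 3) * (r * 8 + 16) + 1 + (r * 10 + 20 + T) + 1 + 1 + 1 + 1 + 1) _ _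
    fun m₁ hm₁ => ?_)).mono_time (by omega)
  obtain ⟨hf₁, hw₁⟩ := hm₁
  set m₂ := (m₁.setNat 29 0 0).setNat 30 0 0 with hm₂
  refine ok_seq (ok_setNat (m' := m₁.setNat 29 0 0) rfl (ok_seq (ok_setNat (m' := m₂) rfl (ok_seq ?_))))
  have hf₂ : Frame [10, 11, 16, 17, 18, 19, 28, 29, 30, 31, 33] [6, 7, 8] m m₂ :=
    (((Frame.refl _ _ m).trans hf₁ (by decide) (by decide)).setNat (by decide) _ _).setNat (by decide) _ _
  have hf₁₂ : Frame [29, 30] [] m₁ m₂ :=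
    ((Frame.refl _ _ m₁).setNat (by decide) _ _).setNat (by decide) _ _
  refine ok_pivotLoop hr hlo hc (hE.frame hf₂) (by rw [hf₂.1 8 (by decide), hsp])
    (hV.congr (view_frame hf₂ ℓ) (by rw [hf₂.1 4 (by decide)])) (view_frame hf₂ ℓ) (hw₁.frame hf₁₂)
    (by rw [hf₂.1 4 (by decide), h4]) (by rw [hf₂.1 6 (by decide), h6])
    (by rw [hm₂]; simp [Mem.nat_setNat]) (by rw [hm₂]; simp [Mem.nat_setNat]) ?_ ?_
  · intro m₃ hf₃ h29
    have hf' := hf₂.trans hf₃ (by decide) (by decide)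
    have hb : ¬ (Test.natLe (.lit 1) (sc 29)).Holds m₃ := by
      simp only [Test.Holds, NExp.eval, sc, h29]; omega
    have e8 : m₃.nat 8 0 = ℓ := by rw [hf'.1 8 (by decide), hsp]
    refine (ok_ite_false hb (ok_setNat rfl (hbad _ ?_ ?_))).mono_time (by omega)
    · exact ((Frame.refl _ _ m).trans hf' (by decide) (by decide)).setNat (by decide) _ _
    · simp [Mem.nat_setNat, NExp.eval, sc, e8]
  · intro m₃ hf₃ h29 hp hgp
    have hf' := hf₂.trans hf₃ (by decide) (by decide)
    have hb : (Test.natLe (.lit 1) (sc 29)).Holds m₃ := by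
      simp only [Test.Holds, NExp.eval, sc, h29]; omega
    have hv := view_frame (E := E) hf' ℓ
    have e4 : m₃.nat 4 ℓ = r := by rw [hf'.1 4 (by decide), h4]
    have hflt := tri_filterLoop (hE.frame hf') (by rw [hf'.1 8 (by decide), hsp])
      (hV.congr hv (by rw [hf'.1 4 (by decide)])) (by rw [hv]; exact (hw₁.frame hf₁₂).frame hf₃)
      (by rw [hv]; exact hp)
    rw [e4] at hflt
    refine (ok_ite_true hb (hflt _ T _ _ fun m₄ hm₄ => ?_)).mono_time (by omega)
    obtain ⟨hf₄, hs, hpv, hcnt, h5, h6'⟩ := hm₄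
    rw [hv] at hpv hcnt
    refine hgood m₄ _ hgp (((Frame.refl _ _ m).trans hf' (by decide) (by decide)).trans hf₄ (by decide)
      (by decide)) ((same_frame hf' ℓ).trans hs) hpv ?_ h5 (by rw [h6', hf'.1 6 (by decide), h6])
    have := hgp.2.1
    rw [hV.card, h4] at this
    omega

/-- One lucky outcome among `N` passes on a fraction `1 / N` of its advantage `δ`. It is applied to
the guesses of the center and of the coordinate. -/
theorem le_average {N : ℕ} (hN : 0 < N) {f : ℕ → ℝ} {lo δ : ℝ} (hf : ∀ k < N, lo ≤ f k) {k₀ : ℕ}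
    (hk₀ : k₀ < N) (h : lo + δ ≤ f k₀) : lo + δ / N ≤ (∑ k ∈ Finset.range N, f k) / N := by
  have hNR : (0 : ℝ) < N := by exact_mod_cast hN
  rw [le_div_iff₀ hNR, add_mul, div_mul_cancel₀ _ hNR.ne']
  have hm : k₀ ∈ Finset.range N := Finset.mem_range.2 hk₀
  rw [← Finset.add_sum_erase _ _ hm]
  have : ∑ k ∈ (Finset.range N).erase k₀, lo ≤ ∑ k ∈ (Finset.range N).erase k₀, f k :=
    Finset.sum_le_sum fun k hk => hf k (Finset.mem_range.1 (Finset.mem_of_mem_erase hk))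
  rw [Finset.sum_const, Finset.card_erase_of_mem hm, Finset.card_range, nsmul_eq_mul,
    Nat.cast_sub hN, Nat.cast_one] at this
  linarith

theorem le_average_fintype {ι : Type*} [Fintype ι] {f : ι → ℝ} {lo : ℝ} (hι : 0 < Fintype.card ι)
    (hf : ∀ k, lo ≤ f k) : lo ≤ (∑ k, f k) / (Fintype.card ι : ℝ) := by
  have hNR : (0 : ℝ) < Fintype.card ι := by exact_mod_cast hι
  rw [le_div_iff₀ hNR]
  calc lo * Fintype.card ι = ∑ _k : ι, lo := by simp [mul_comm]
    _ ≤ _ := Finset.sum_le_sum fun k _ => hf k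

open Classical in
/-- The tuples of positions that are good, compared to the good tuples of points of `A`. -/
theorem card_good_positions {r s a : ℕ} (g : ℕ → ℕ) (A : Finset ℕ)
    (hA : A ⊆ (Finset.range r).image g) (hr : r ≤ a * A.card) (good : (Fin s → ℕ) → Prop)
    (h : A.card ^ s ≤ 2 * (Finset.univ.filter fun σ : Fin s → A => good fun i => (σ i : ℕ)).card) :
    r ^ s ≤ 2 * a ^ s * (Finset.univ.filter fun τ : Fin s → Fin r => good fun i => g (τ i)).card := by
  have hex : ∀ x : A, ∃ k : Fin r, g k = x := fun x => by
    obtain ⟨k, hk, e⟩ := Finset.mem_image.1 (hA x.2)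
    exact ⟨⟨k, Finset.mem_range.1 hk⟩, e⟩
  choose pos hpos using hex
  have hinj : Function.Injective pos := fun x y e => Subtype.ext (by rw [← hpos x, ← hpos y, e])
  have hle : (Finset.univ.filter fun σ : Fin s → A => good fun i => (σ i : ℕ)).card ≤
      (Finset.univ.filter fun τ : Fin s → Fin r => good fun i => g (τ i)).card := by
    refine Finset.card_le_card_of_injOn (fun σ i => pos (σ i)) (fun σ hσ => ?_) ?_
    · have := (Finset.mem_filter.1 hσ).2
      simpa [hpos] using this
    · intro σ _ σ' _ e
      funext i
      exact hinj (congrFun e i)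
  calc r ^ s ≤ (a * A.card) ^ s := Nat.pow_le_pow_left hr s
    _ = a ^ s * A.card ^ s := mul_pow _ _ _
    _ ≤ a ^ s * (2 * (Finset.univ.filter fun τ : Fin s → Fin r => good fun i => g (τ i)).card) :=
      Nat.mul_le_mul_left _ (h.trans (Nat.mul_le_mul_left _ hle))
    _ = _ := by ring

open Classical in
-- The probability of a good child is the product of `1/2` for the center, `1 / (2 * Δ + 1)` for the
-- coordinate, `a ^ (-64 * q)` for all sample points to lie in `A`, and `1/2` for a good sample from
-- `A`.
theorem ok_pushCmd {E : Env} {m : Mem} (hE : E.Holds m) {ℓ r a : ℕ} (hsp : m.nat 8 0 = ℓ)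
    (hV : E.Valid m ℓ) (h4 : m.nat 4 ℓ = r) (hr : 0 < r) (ha : 0 < a) {T : ℕ}
    {Q : Mem → Prop} {K : List Cmd} {lo hi : ℝ} (hlo : lo ≤ hi)
    (good : ℕ → ℕ → (Fin (64 * E.q) → ℕ) → Prop)
    (hc : lo < hi → ∃ t < 2, ∃ h ≤ 2 * E.Δ, ∃ A ⊆ (E.view m ℓ).R.toFinset, r ≤ a * A.card ∧
      A.card ^ (64 * E.q) ≤
        2 * (Finset.univ.filter fun σ : Fin (64 * E.q) → A => good t h fun i => (σ i : ℕ)).card)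
    (hK : ∀ (m' : Mem) (t h : ℕ) (σ : Fin (64 * E.q) → ℕ),
      Frame [3, 4, 5, 6, 7, 8, 9, 10, 11, 12, 13, 14, 15, 16, 33] [3, 4, 7] m m' → E.Same ℓ m m' →
      m'.nat 8 0 = ℓ + 1 → E.view m' ℓ = E.view m ℓ → m'.nat 4 ℓ = r → m'.nat 5 ℓ = 1 →
      m'.nat 6 ℓ = m.nat 6 ℓ → E.view m' (ℓ + 1) = E.data.learn (E.view m ℓ) t h σ →
      m'.nat 4 (ℓ + 1) = r → m'.nat 5 (ℓ + 1) = 0 → m'.nat 6 (ℓ + 1) = 0 →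
      Ok T Q (if good t h σ then hi else lo) K m') :
    Ok (r * 4 + E.d * 12 + 27 + (E.q * 256 + 8) + (E.d * (E.q * 512 + 30) + 5) + T) Q
      (lo + (hi - lo) * (1 / (2 * (2 * E.Δ + 1) * (2 * a ^ (64 * E.q))))) (pushCmd :: K) m := by
  have hcp := tri_copyCmd hE hsp hV
  rw [h4] at hcp
  refine (ok_seq (hcp _ (E.q * 256 + 8 + (E.d * (E.q * 512 + 30) + 5 + T) + 1) _ _
    fun m₁ hm₁ => ok_seq ?_)).mono_time (by omega)
  obtain ⟨hf₁, hs₁, h8₁, hv₁, h4₁, h5₁, h6₁, hw₁, h4₁', h5₁', h6₁'⟩ := hm₁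
  have hE₁ := hE.frame hf₁
  set g := fun k => m₁.nat 3 ((ℓ + 1) * E.n + k) with hg
  have hV₁ : E.Valid m₁ (ℓ + 1) := hV.congr hw₁ (by rw [h4₁', h4])
  have hRg : (E.view m ℓ).R.toFinset = (Finset.range r).image g := by
    rw [← hw₁, hV₁.R_eq, h4₁']
    ext x; simp [hg]
  refine (ok_drawCmd hE₁ (r := r) h8₁ h4₁' hr
    (fun t h τ => if good t h fun i => g (τ i) then hi else lo) ?_).mono le_rfl ?_
  · intro t ht h hh τ m₂ hf₂ h13 h14 h9
    refine tri_learnCmd (hE₁.frame hf₂) (ℓ := ℓ + 1) (by rw [hf₂.1 8 (by decide), h8₁]) h13 ht h14 _ _ _ _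
      fun m₃ hm₃ => ?_
    obtain ⟨hf₃, hs₃, hv₃⟩ := hm₃
    have hsmp : E.sample m₂ (ℓ + 1) = fun i => g (τ i) := by
      funext i
      simp only [sample, hg, h9 i]
      rw [hf₂.1 3 (by decide)]
    rw [hsmp, view_frame hf₂ (ℓ + 1), hw₁] at hv₃
    have hf₂₃ : Frame [7, 9, 10, 11, 12, 13, 14, 15, 16, 33] [3, 7] m₁ m₃ :=
      ((Frame.refl _ _ m₁).trans hf₂ (by decide) (by decide)).trans hf₃ (by decide) (by decide)
    have hs : E.Same (ℓ + 1) m₁ m₃ := (same_frame hf₂ (ℓ + 1)).trans hs₃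
    have hsl := hs ℓ (Nat.lt_succ_self ℓ)
    refine hK m₃ t h _ ?_ (hs₁.trans (hs.mono (Nat.le_succ ℓ))) ?_ ?_ ?_ ?_ ?_ hv₃ ?_ ?_ ?_
    · exact ((Frame.refl _ _ m).trans hf₁ (by decide) (by decide)).trans hf₂₃ (by decide) (by decide)
    · rw [hf₂₃.1 8 (by decide), h8₁]
    · rw [hsl.1, hv₁]
    · rw [hf₂₃.1 4 (by decide), h4₁]
    · rw [hf₂₃.1 5 (by decide), h5₁]
    · rw [hf₂₃.1 6 (by decide), h6₁]
    · rw [hf₂₃.1 4 (by decide), h4₁']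
    · rw [hf₂₃.1 5 (by decide), h5₁']
    · rw [hf₂₃.1 6 (by decide), h6₁']
  · have hcard : (Fintype.card (Fin (64 * E.q) → Fin r) : ℝ) = (r : ℝ) ^ (64 * E.q) := by simp
    have hrR : (0 : ℝ) < (r : ℝ) ^ (64 * E.q) := by positivity
    have hge (t h : ℕ) : lo ≤ (∑ τ : Fin (64 * E.q) → Fin r,
        if good t h fun i => g (τ i) then hi else lo) / (r : ℝ) ^ (64 * E.q) := by
      rw [← hcard]
      refine le_average_fintype ?_ fun τ => ?_
      · have : (0 : ℝ) < Fintype.card (Fin (64 * E.q) → Fin r) := by rw [hcard]; exact hrR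
        exact_mod_cast this
      · split_ifs <;> linarith
    have hge' (t : ℕ) : lo ≤ (∑ h ∈ Finset.range (2 * E.Δ + 1), (∑ τ : Fin (64 * E.q) → Fin r,
        if good t h fun i => g (τ i) then hi else lo) / (r : ℝ) ^ (64 * E.q)) / (2 * E.Δ + 1 : ℕ) := by
      have := le_average (N := 2 * E.Δ + 1) (by omega) (δ := 0) (fun h _ => hge t h) (k₀ := 0) (by omega)
        (by rw [add_zero]; exact hge t 0)
      rwa [zero_div, add_zero] at this
    rcases hlo.lt_or_eq with hl | hl
    · obtain ⟨t, ht, h, hh, A, hA, hrA, hgA⟩ := hc hl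
      have hcnt := card_good_positions g A (hRg ▸ hA) hrA (good t h) hgA
      set N := (Finset.univ.filter fun τ : Fin (64 * E.q) → Fin r => good t h fun i => g (τ i)).card
        with hN
      have hcnt' : (r : ℝ) ^ (64 * E.q) ≤ 2 * a ^ (64 * E.q) * N := by exact_mod_cast hcnt
      have haR : (0 : ℝ) < 2 * (a : ℝ) ^ (64 * E.q) := by positivity
      have key : lo + (hi - lo) * (1 / (2 * (a : ℝ) ^ (64 * E.q))) ≤ (∑ τ : Fin (64 * E.q) → Fin r,
          if good t h fun i => g (τ i) then hi else lo) / (r : ℝ) ^ (64 * E.q) := by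
        have hsum : (∑ τ : Fin (64 * E.q) → Fin r, if good t h fun i => g (τ i) then hi else lo) =
            lo * (r : ℝ) ^ (64 * E.q) + (hi - lo) * N := by
          have : ∀ τ : Fin (64 * E.q) → Fin r, (if good t h fun i => g (τ i) then hi else lo) =
              lo + (hi - lo) * (if good t h fun i => g (τ i) then 1 else 0) := fun τ => by
            split_ifs <;> ring
          rw [Finset.sum_congr rfl fun τ _ => this τ, Finset.sum_add_distrib, ← Finset.mul_sum,
            Finset.sum_boole, Finset.sum_const, Finset.card_univ, nsmul_eq_mul, hcard, mul_comm lo]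
        rw [hsum, add_div, mul_div_cancel_right₀ _ hrR.ne', mul_div_assoc]
        have : 1 / (2 * (a : ℝ) ^ (64 * E.q)) ≤ N / (r : ℝ) ^ (64 * E.q) := by
          rw [div_le_div_iff₀ haR hrR]; linarith
        have h0 : 0 ≤ hi - lo := by linarith
        have := mul_le_mul_of_nonneg_left this h0
        linarith
      have h1 := le_average (N := 2 * E.Δ + 1) (by omega) (fun h _ => hge t h) (k₀ := h) (by omega) key
      have h2 := le_average (N := 2) (by omega) (fun t _ => hge' t) (k₀ := t) ht h1
      refine le_trans (le_of_eq ?_) h2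
      push_cast
      field_simp
    · have := le_average (N := 2) (by omega) (δ := 0) (fun t _ => hge' t) (k₀ := 0) (by omega)
        (by rw [add_zero]; exact hge' 0)
      rw [zero_div, add_zero] at this
      refine le_trans (le_of_eq ?_) this
      rw [hl]; ring

/-! ### The search -/

/-- The state at the head of the main loop. -/
structure Node (E : Env) (ℓ : ℕ) (m : Mem) : Prop where
  holds : E.Holds m
  sp : m.nat 8 0 = ℓ
  valid : E.Valid m ℓ
  sound : E.data.Sound E.n (E.view m ℓ)
  best : E.BestSound m

/-- What the work on the levels from `ℓ` on preserves. -/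
structure Prog (E : Env) (ℓ : ℕ) (m m' : Mem) : Prop where
  same : E.Same ℓ m m'
  count : m'.nat 24 = m.nat 24 ∧ m'.nat 26 = m.nat 26
  good : ∀ tgt, GoodBest tgt m → GoodBest tgt m'

theorem Prog.trans {E : Env} {ℓ : ℕ} {m m' m'' : Mem} (h : E.Prog ℓ m m') (h' : E.Prog ℓ m' m'') :
    E.Prog ℓ m m'' :=
  ⟨h.same.trans h'.same, ⟨h'.count.1.trans h.count.1, h'.count.2.trans h.count.2⟩,
    fun tgt hg => h'.good tgt (h.good tgt hg)⟩

theorem Prog.mono {E : Env} {ℓ ℓ' : ℕ} {m m' : Mem} (h : E.Prog ℓ m m') (hl : ℓ' ≤ ℓ) :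
    E.Prog ℓ' m m' := ⟨h.same.mono hl, h.count, h.good⟩

theorem Prog.of_frame {E : Env} {ℓ : ℕ} {m m' : Mem} (hs : E.Same ℓ m m') {F G : List ℕ}
    (hf : Frame F G m m') (h24 : 24 ∉ F := by decide) (h26 : 26 ∉ F := by decide)
    (h27 : 27 ∉ F := by decide) (h5 : 5 ∉ G := by decide) : E.Prog ℓ m m' :=
  ⟨hs, ⟨hf.1 24 h24, hf.1 26 h26⟩, fun _ => (goodBest_frame hf h27 h5).2⟩

/-- The level `ℓ` of the search has been left. -/
structure Done (E : Env) (ℓ : ℕ) (m m' : Mem) : Prop where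
  holds : E.Holds m'
  sp : m'.nat 8 0 = ℓ - 1
  best : E.BestSound m'
  prog : E.Prog ℓ m m'

theorem Prog.done {E : Env} {ℓ : ℕ} {m m' m'' : Mem} (h : E.Prog ℓ m m') (h' : E.Done ℓ m' m'') :
    E.Done ℓ m m'' := ⟨h'.holds, h'.sp, h'.best, h.trans h'.prog⟩

open Classical in
/-- The target of the search belongs to the instance. -/
structure Fits (E : Env) (G : Goal) : Prop where
  q_eq : G.q = E.q
  miss_eq : G.Δ = E.Δ
  one_le_q : 1 ≤ E.q
  one_le_miss : 1 ≤ E.Δ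
  one_le_d : 1 ≤ E.d
  label : ∀ x, G.l x < 2
  few : ∀ x < E.n, ((Finset.range E.d).filter fun j => ¬ E.data.pr x j).card ≤ E.Δ

/-- A lower bound for the probability of a good push. -/
noncomputable def pushProb (E : Env) : ℝ := 1 / ((4096 * E.Δ * E.q : ℕ) : ℝ) ^ (64 * E.q + 1)

/-- The first factor accounts for the pivot searches from round `i` on, as `2 ^ (-(i + 2))` is the
sum of the failure probabilities `2 ^ (-(i' + 3))` over `i' ≥ i`. The second accounts for `k`
learning moves. -/
noncomputable def winProb (E : Env) (k i : ℕ) : ℝ := (1 - (1 / 2) ^ (i + 2)) * E.pushProb ^ k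

def unit (E : Env) : ℕ := 100 * E.d * E.q

def time (E : Env) (k r i : ℕ) : ℕ := E.unit * 64 ^ (k + 1) * (r * (i + 15) + 1)

/-! ### Estimates for the success probability and the time of the search. -/

theorem pushProb_pos {E : Env} (hq : 1 ≤ E.q) (hΔ : 1 ≤ E.Δ) : 0 < E.pushProb := by
  unfold pushProb; positivity

theorem pushProb_le_one {E : Env} (hq : 1 ≤ E.q) (hΔ : 1 ≤ E.Δ) : E.pushProb ≤ 1 := by
  unfold pushProb
  have : (1 : ℝ) ≤ ((4096 * E.Δ * E.q : ℕ) : ℝ) := by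
    exact_mod_cast Nat.one_le_iff_ne_zero.2 (by positivity)
  exact (div_le_one (by positivity)).2 (one_le_pow₀ this)

/-- The factor `3/4` is the loss `1 - 2 ^ (-2)` to pivot searches at a fresh level. The extra factor
of `4096 * Δ * q` in `pushProb` absorbs it, together with the two guesses and the bad half of the
samples. -/
theorem pushProb_le {E : Env} (hq : 1 ≤ E.q) (hΔ : 1 ≤ E.Δ) :
    E.pushProb ≤ 3 / 4 * (1 / (2 * (2 * E.Δ + 1) * (2 * ((4096 * E.Δ * E.q : ℕ) : ℝ) ^ (64 * E.q)))) := by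
  unfold pushProb
  have hq' : (1 : ℝ) ≤ E.q := by exact_mod_cast hq
  have hΔ' : (1 : ℝ) ≤ E.Δ := by exact_mod_cast hΔ
  set a : ℝ := ((4096 * E.Δ * E.q : ℕ) : ℝ) with ha
  have ha' : 16 * (2 * E.Δ + 1 : ℝ) ≤ a := by
    rw [ha]; push_cast; nlinarith
  have hpos : 0 < a := by linarith
  have hp : 0 < a ^ (64 * E.q) := by positivity
  rw [mul_one_div, div_le_div_iff₀ (by positivity) (by positivity), pow_succ]
  nlinarith

theorem winProb_nonneg {E : Env} (hq : 1 ≤ E.q) (hΔ : 1 ≤ E.Δ) (k i : ℕ) : 0 ≤ E.winProb k i :=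
  mul_nonneg (sub_nonneg.2 (pow_le_one₀ (by norm_num) (by norm_num)))
    (pow_nonneg (pushProb_pos hq hΔ).le _)

theorem winProb_le {E : Env} (hq : 1 ≤ E.q) (hΔ : 1 ≤ E.Δ) (k i : ℕ) :
    E.winProb k i ≤ E.pushProb ^ k := by
  have h1 := pow_nonneg (pushProb_pos hq hΔ).le k
  have : (0 : ℝ) ≤ (1 / 2) ^ (i + 2) := by positivity
  unfold winProb
  nlinarith

theorem winProb_le_one {E : Env} (hq : 1 ≤ E.q) (hΔ : 1 ≤ E.Δ) (k i : ℕ) : E.winProb k i ≤ 1 :=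
  (winProb_le hq hΔ k i).trans (pow_le_one₀ (pushProb_pos hq hΔ).le (pushProb_le_one hq hΔ))

/-- With `x = 2 ^ (-(i + 3))` this is `1 - 2 * x ≤ (1 - x) ^ 2`. -/
theorem winProb_peel {E : Env} (hq : 1 ≤ E.q) (hΔ : 1 ≤ E.Δ) (k i : ℕ) :
    E.winProb k i ≤ E.winProb k (i + 1) * (1 - (1 / 2) ^ (i + 3)) := by
  have h1 := pow_nonneg (pushProb_pos hq hΔ).le k
  unfold winProb
  have : (1 / 2 : ℝ) ^ (i + 2) = 2 * (1 / 2) ^ (i + 3) := by ring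
  rw [this, show i + 1 + 2 = i + 3 from rfl]
  set x : ℝ := (1 / 2) ^ (i + 3)
  nlinarith [mul_nonneg h1 (sq_nonneg x)]

/-- The recursion for the time of a level: the child search, opening it, one peeling, and the rest
of the level with at most `7 * r / 8` points. The shift `15` leaves `64 * (i + 15) - 56 * (i + 16) =
8 * i + 64` units of `B * r`, enough for the child (at most `16`) and the overheads. -/
theorem time_push {E : Env} (hq : 1 ≤ E.q) (hd : 1 ≤ E.d) {B r r' i : ℕ} (hr : 1 ≤ r)
    (hr' : 8 * r' ≤ 7 * r) (hB : E.unit ≤ B) :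
    B * (r * 15 + 1) + (r * 4 + E.d * 12 + 27 + (E.q * 256 + 8) + (E.d * (E.q * 512 + 30) + 5)) +
      (r * (E.d * 20 + 40) + (i + 3) * (r * 8 + 16) + r * 10 + 40) + 10 +
      B * 64 * (r' * (i + 1 + 15) + 1) ≤ B * 64 * (r * (i + 15) + 1) := by
  have hD : 1 ≤ E.d * E.q := Nat.mul_pos hd hq
  have hM : 1 ≤ E.d * E.q * r := Nat.mul_pos hD hr
  have h1 : r ≤ E.d * E.q * r := Nat.le_mul_of_pos_left _ hD
  have h2 : E.d * E.q ≤ E.d * E.q * r := Nat.le_mul_of_pos_right _ hr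
  have h3 : E.d ≤ E.d * E.q * r := (Nat.le_mul_of_pos_right _ hq).trans h2
  have h4 : E.q ≤ E.d * E.q * r := (Nat.le_mul_of_pos_left _ hd).trans h2
  have h5 : E.d * r ≤ E.d * E.q * r := Nat.mul_le_mul_right _ (Nat.le_mul_of_pos_right _ hq)
  have h6 : 100 * (E.d * E.q * r) ≤ B * r := by
    have := Nat.mul_le_mul_right r hB
    unfold unit at this
    linarith
  have h7 : B ≤ B * r := Nat.le_mul_of_pos_right _ hr
  have h8 : 8 * (B * r') ≤ 7 * (B * r) := by nlinarith
  have h9 : 8 * (B * r' * i) ≤ 7 * (B * r * i) := by nlinarith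
  have h10 : 100 * (E.d * E.q * r * i) ≤ B * r * i := by nlinarith
  have h11 : r * i ≤ E.d * E.q * r * i := Nat.mul_le_mul_right _ h1
  have h12 : i ≤ E.d * E.q * r * i := Nat.le_mul_of_pos_left _ hM
  nlinarith

/-! ### The recursive analysis of the search. -/

theorem ok_leaf {E : Env} {ℓ : ℕ} {m : Mem} (hℓ : 1 ≤ ℓ) (hN : E.Node ℓ m) (h4 : m.nat 4 ℓ = 0)
    {T : ℕ} {Q : Mem → Prop} {K : List Cmd} {e : ℝ}
    (hK : ∀ m', E.Done ℓ m m' → (∀ tgt, (E.view m ℓ).b ≤ tgt → GoodBest tgt m') →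
      Ok T Q e (searchLoop :: K) m') :
    Ok (E.d * 8 + 17 + T) Q e (searchLoop :: K) m := by
  have hR : (E.view m ℓ).R = [] := by rw [hN.valid.R_eq, h4]; rfl
  have hb : (Test.natLe (.lit 1) (sc 8)).Holds m := by
    simpa only [Test.Holds, NExp.eval, sc, hN.sp] using hℓ
  have hb' : (Test.natLe rlen (.lit 0)).Holds m := by
    simp [Test.Holds, NExp.eval, rlen, sc, hN.sp, h4]
  refine (ok_loop_true hb (ok_ite_true hb' (tri_leafCmd hN.holds hN.sp hR hN.sound hN.best _ T _ _
    fun m' hm' => ?_))).mono_time (by omega)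
  obtain ⟨h1, h2, h3, h4, h5, h6⟩ := hm'
  exact hK m' ⟨h1, h3, h4, h2, ⟨h5.1 24 (by decide), h5.1 26 (by decide)⟩, fun tgt h => h6 tgt (.inl h)⟩
    fun tgt h => h6 tgt (.inr h)

open Classical in
/-- The value of a search that succeeds with probability `w` if `p` holds and otherwise goes on with
the value `v`. -/
noncomputable def gain (p : Prop) (w v : ℝ) : ℝ := if p then v + (1 - v) * w else v

theorem gain_one (p : Prop) (w : ℝ) : gain p w 1 = 1 := by
  unfold gain; split_ifs <;> ring

theorem le_gain {p : Prop} {w v : ℝ} (hw : 0 ≤ w) (hv : v ≤ 1) : v ≤ gain p w v := by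
  unfold gain
  split_ifs
  · nlinarith
  · exact le_rfl

theorem gain_le_one {p : Prop} {w v : ℝ} (hw : w ≤ 1) (hv : v ≤ 1) : gain p w v ≤ 1 := by
  unfold gain
  split_ifs
  · nlinarith
  · exact hv

open Classical in
-- If the node is on track and nothing can be learned, a good pivot keeps it on track, and only the
-- failure of the pivot search costs probability. Otherwise the bound is just `v`, which abandoning
-- and peeling both guarantee.
theorem ok_peelPhase {E : Env} {G : Goal} {tgt : ℝ} (hF : E.Fits G) {ℓ r i k : ℕ} {m : Mem}
    (hℓ : 1 ≤ ℓ) (hN : E.Node ℓ m) (h4 : m.nat 4 ℓ = r) (hr : 0 < r) (h6 : m.nat 6 ℓ = i)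
    (hpeel : ¬ (m.nat 5 ℓ = 0 ∧ ℓ ≤ 4 * E.Δ + 2)) {T : ℕ} {Q : Mem → Prop} {K : List Cmd} {v : ℝ}
    (hv : v ≤ 1)
    (hrec : ∀ m₁, E.Node ℓ m₁ → E.Prog ℓ m m₁ → 8 * m₁.nat 4 ℓ ≤ 7 * r → m₁.nat 5 ℓ = 0 →
      m₁.nat 6 ℓ = i + 1 → Ok T Q (gain (∃ f, E.data.OnTrack G tgt f k (E.view m₁ ℓ))
        (E.winProb k (i + 1)) v) (searchLoop :: K) m₁)
    (hK : ∀ m', E.Done ℓ m m' → Ok T Q v (searchLoop :: K) m') :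
    Ok (r * (E.d * 20 + 40) + (i + 3) * (r * 8 + 16) + r * 10 + 43 + T) Q
      (gain (∃ f, E.data.OnTrack G tgt f k (E.view m ℓ) ∧ ¬ E.data.Learnable G f (E.view m ℓ))
        (E.winProb k i) v) (searchLoop :: K) m := by
  set p : Prop := ∃ f, E.data.OnTrack G tgt f k (E.view m ℓ) ∧ ¬ E.data.Learnable G f (E.view m ℓ)
    with hp
  have hq := hF.one_le_q
  have hΔ := hF.one_le_miss
  have hb : (Test.natLe (.lit 1) (sc 8)).Holds m := by
    simpa only [Test.Holds, NExp.eval, sc, hN.sp] using hℓ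
  have hb' : ¬ (Test.natLe rlen (.lit 0)).Holds m := by
    simp only [Test.Holds, NExp.eval, rlen, sc, hN.sp, h4]; omega
  have hb'' : ¬ (Test.and (.natLe (.get 5 (sc 8)) (.lit 0)) (.natLe (sc 8) (sc 23))).Holds m := by
    simp only [Test.Holds, NExp.eval, sc, hN.sp, hN.holds.K_eq]; omega
  have hw0 := winProb_nonneg hq hΔ k (i + 1)
  have hlo : v ≤ gain p (E.winProb k (i + 1)) v := le_gain hw0 hv
  refine (ok_loop_true hb (ok_ite_false hb' (ok_ite_false hb'' (ok_peelCmd hN.holds hN.sp hN.valid h4 hr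
    h6 (T := T) hlo ?_ ?_ ?_)))).mono (by omega) ?_
  · intro hlt
    have hp' : p := by
      by_contra hp'
      rw [gain, if_neg hp'] at hlt
      exact lt_irrefl _ hlt
    obtain ⟨f, hT, hL⟩ := hp'
    have := Data.card_goodPivot hT hF.label (hF.miss_eq ▸ hΔ) (hF.q_eq ▸ hq) hL
      (by rw [hN.valid.card, h4]; exact hr)
    rw [hN.valid.card, h4] at this
    exact this
  · intro m' hf h8
    exact hK m' ⟨hN.holds.frame hf, h8, hN.best.frame hf, Prog.of_frame (same_frame hf ℓ) hf⟩
  · intro m' x hx hf hs hvw hle h5 h6'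
    have hNode : E.Node ℓ m' := by
      refine ⟨hN.holds.frame hf, by rw [hf.1 8 (by decide), hN.sp], ⟨?_, ?_, ?_⟩, ?_, hN.best.frame hf⟩
      · rw [hvw]; exact hN.valid.nodup.filter _
      · intro y hy
        rw [hvw] at hy
        exact hN.valid.lt y (List.mem_of_mem_filter hy)
      · have := hN.valid.len_le; omega
      · rw [hvw]; exact hN.sound.peel x
    refine (hrec m' hNode (Prog.of_frame hs hf) hle h5 h6').mono le_rfl ?_
    by_cases hp' : p
    · obtain ⟨f, hT, hL⟩ := hp'
      have : ∃ f, E.data.OnTrack G tgt f k (E.view m' ℓ) :=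
        ⟨f, by rw [hvw]; exact hT.peel hF.label (hF.miss_eq ▸ hΔ) (hF.q_eq ▸ hq) hL hx⟩
      rw [gain, gain, if_pos this]
      split_ifs
      · exact le_rfl
      · nlinarith
    · conv_lhs => rw [gain, if_neg hp']
      exact le_gain hw0 hv
  · have h1 := winProb_peel hq hΔ k i
    unfold gain
    split_ifs
    · nlinarith
    · simp

theorem time_mono {E : Env} {k r r' i : ℕ} (h : r ≤ r') : E.time k r i ≤ E.time k r' i := by
  unfold time; gcongr

open Classical in
/-- The specification of the search from the level `ℓ`, at which `k` more levels are possible. -/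
def Explores (E : Env) (G : Goal) (tgt : ℝ) (k : ℕ) : Prop :=
  ∀ (r ℓ i : ℕ) (m : Mem), ℓ + k = 4 * E.Δ + 3 → 1 ≤ ℓ → E.Node ℓ m → m.nat 4 ℓ = r →
    m.nat 5 ℓ = 0 → m.nat 6 ℓ = i → ∀ (T : ℕ) (Q : Mem → Prop) (K : List Cmd) (v : ℝ), v ≤ 1 →
    (∀ m', E.Done ℓ m m' → Ok T Q (if GoodBest tgt m' then 1 else v) (searchLoop :: K) m') →
    Ok (E.time k r i + T) Q (gain (∃ f, E.data.OnTrack G tgt f k (E.view m ℓ)) (E.winProb k i) v)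
      (searchLoop :: K) m

open Classical in
theorem exists_learn_view {E : Env} {G : Goal} {tgt : ℝ} (hF : E.Fits G) {k ℓ r : ℕ} {m : Mem}
    (hV : E.Valid m ℓ) (h4 : m.nat 4 ℓ = r) {f : ℕ → Prop}
    (hT : E.data.OnTrack G tgt f k (E.view m ℓ)) (hL : E.data.Learnable G f (E.view m ℓ)) :
    ∃ t < 2, ∃ h ≤ 2 * E.Δ, ∃ A ⊆ (E.view m ℓ).R.toFinset, r ≤ 4096 * E.Δ * E.q * A.card ∧
      A.card ^ (64 * E.q) ≤ 2 * (Finset.univ.filter fun σ : Fin (64 * E.q) → A =>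
        1 ≤ k ∧ ∃ f', E.data.OnTrack G tgt f' (k - 1)
          (E.data.learn (E.view m ℓ) t h fun i => (σ i : ℕ))).card := by
  have hex := hT.exists_learn (hF.q_eq ▸ hF.one_le_q)
    (fun x hx => hF.miss_eq ▸ hF.few x (hV.lt x hx)) hL
  rw [hF.q_eq, hF.miss_eq, hV.card, h4] at hex
  exact hex

/-- If one can learn, then a good sample exists, and it lowers the measure. Thus the depth limit
never prevents a learning move that is needed. -/
theorem one_le_of_learnable {E : Env} {G : Goal} {tgt : ℝ} (hF : E.Fits G) {k ℓ r : ℕ} {m : Mem}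
    (hV : E.Valid m ℓ) (h4 : m.nat 4 ℓ = r) (hr : 0 < r) {f : ℕ → Prop}
    (hT : E.data.OnTrack G tgt f k (E.view m ℓ)) (hL : E.data.Learnable G f (E.view m ℓ)) : 1 ≤ k := by
  classical
  obtain ⟨t, -, h, -, A, -, hrA, hA⟩ := exists_learn_view hF hV h4 hT hL
  have hA0 : 0 < A.card := Nat.pos_of_ne_zero fun h0 => by rw [h0] at hrA; omega
  have := Nat.pow_pos (n := 64 * E.q) hA0
  have hne : 0 < (Finset.univ.filter fun σ : Fin (64 * E.q) → A =>
      1 ≤ k ∧ ∃ f', E.data.OnTrack G tgt f' (k - 1)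
        (E.data.learn (E.view m ℓ) t h fun i => (σ i : ℕ))).card := by omega
  obtain ⟨σ, hσ⟩ := Finset.card_pos.1 hne
  exact (Finset.mem_filter.1 hσ).2.1

open Classical in
-- A double recursion: on the remaining depth for the child, and on the number of unassigned points
-- for the peeled list. After the child has been explored the level is intact, so its peeling phase
-- follows with some value `v'`, and the child is analyzed with `v'` as the value of what comes
-- after it. Being on track, the node profits either from the child (if one can learn) or from the
-- peeling phase.
theorem explores_of_pred {E : Env} {G : Goal} {tgt : ℝ} (hF : E.Fits G) (k : ℕ)
    (hpred : ∀ k', k = k' + 1 → E.Explores G tgt k') : E.Explores G tgt k := by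
  have hq := hF.one_le_q
  have hΔ := hF.one_le_miss
  have hd := hF.one_le_d
  have hlow : ∀ (v : ℝ) (m' : Mem), v ≤ 1 → v ≤ if GoodBest tgt m' then 1 else v := fun v m' hv => by
    split_ifs
    · exact hv
    · exact le_rfl
  intro r
  induction r using Nat.strong_induction_on with
  | _ r ih => ?_
  intro ℓ i m hk hℓ hN h4 h5 h6 T Q K v hv hK
  have hw0 := winProb_nonneg hq hΔ k i
  have hw1 := winProb_le_one hq hΔ k i
  rcases Nat.eq_zero_or_pos r with hr | hr
  · refine (ok_leaf hℓ hN (h4.trans hr) (T := T) fun m' hD hb => (hK m' hD).mono le_rfl ?_).mono_time ?_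
    · unfold gain
      split_ifs with h1 h2
      · nlinarith
      · obtain ⟨f, hf⟩ := h1
        refine absurd (hb tgt (hf.le_of_nil ?_)) h2
        rw [hN.valid.R_eq, h4, hr]; rfl
      · exact hv
      · exact le_rfl
    · rw [hr, time, unit]
      have : 1 ≤ 64 ^ k := Nat.one_le_pow _ _ (by norm_num)
      have h1 : E.d ≤ E.d * E.q := Nat.le_mul_of_pos_right _ hq
      have h2 : E.d * E.q ≤ E.d * E.q * 64 ^ k := Nat.le_mul_of_pos_right _ this
      rw [pow_succ]
      nlinarith
  set X := E.time k (7 * r / 8) (i + 1) with hX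
  set Tp := r * (E.d * 20 + 40) + (i + 3) * (r * 8 + 16) + r * 10 + 43 with hTp
  have phase : ∀ m₂, E.Node ℓ m₂ → E.Prog ℓ m m₂ → m₂.nat 4 ℓ = r → m₂.nat 6 ℓ = i →
      E.view m₂ ℓ = E.view m ℓ → ¬ (m₂.nat 5 ℓ = 0 ∧ ℓ ≤ 4 * E.Δ + 2) →
      Ok (Tp + (X + T)) Q (if GoodBest tgt m₂ then 1 else
        gain (∃ f, E.data.OnTrack G tgt f k (E.view m ℓ) ∧ ¬ E.data.Learnable G f (E.view m ℓ))
        (E.winProb k i) v) (searchLoop :: K) m₂ := by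
    intro m₂ hN₂ hP₂ h4₂ h6₂ hv₂ hpeel
    have main : ∀ v', v' ≤ 1 →
        (∀ m', E.Done ℓ m₂ m' → Ok T Q (if GoodBest tgt m' then 1 else v') (searchLoop :: K) m') →
        Ok (Tp + (X + T)) Q
          (gain (∃ f, E.data.OnTrack G tgt f k (E.view m ℓ) ∧ ¬ E.data.Learnable G f (E.view m ℓ))
          (E.winProb k i) v') (searchLoop :: K) m₂ := by
      intro v' hv' hK'
      rw [← hv₂]
      refine ok_peelPhase hF hℓ hN₂ h4₂ hr h6₂ hpeel hv' ?_ fun m' hD =>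
        (hK' m' hD).mono (by omega) (hlow v' m' hv')
      intro m₃ hN₃ hP₃ hle h5₃ h6₃
      refine (ih (m₃.nat 4 ℓ) (by omega) ℓ (i + 1) m₃ hk hℓ hN₃ rfl h5₃ h6₃ T Q K v' hv' fun m' hD =>
        hK' m' (hP₃.done hD)).mono_time ?_
      have := time_mono (E := E) (k := k) (i := i + 1) (r := m₃.nat 4 ℓ) (r' := 7 * r / 8) (by omega)
      omega
    -- A good solution found in the child is never lost. The rest is then analyzed with value `1`,
    -- which `gain` preserves.
    by_cases hg : GoodBest tgt m₂
    · rw [if_pos hg]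
      refine (main 1 le_rfl fun m' hD => (hK m' (hP₂.done hD)).mono le_rfl ?_).mono le_rfl ?_
      · rw [ite_self, if_pos (hD.prog.good tgt hg)]
      · rw [gain_one]
    · rw [if_neg hg]
      exact main v hv fun m' hD => hK m' (hP₂.done hD)
  have hsplit : (∃ f, E.data.OnTrack G tgt f k (E.view m ℓ)) →
      ¬ (∃ f, E.data.OnTrack G tgt f k (E.view m ℓ) ∧ E.data.Learnable G f (E.view m ℓ)) →
      ∃ f, E.data.OnTrack G tgt f k (E.view m ℓ) ∧ ¬ E.data.Learnable G f (E.view m ℓ) := by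
    rintro ⟨f, hf⟩ hn
    exact ⟨f, hf, fun hL => hn ⟨f, hf, hL⟩⟩
  have hr' : 8 * (7 * r / 8) ≤ 7 * r := by omega
  rcases k with _ | k
  · refine (phase m hN ⟨Same.refl _ _ _, ⟨rfl, rfl⟩, fun _ => id⟩ h4 h6 rfl (by omega)).mono ?_ ?_
    · have := time_push hq hd (i := i) hr hr' (B := E.unit) le_rfl
      simp only [hX, hTp, time, zero_add, pow_one]
      omega
    -- At the maximal depth no child is opened, and none is needed.
    · have hn : ¬ (∃ f, E.data.OnTrack G tgt f 0 (E.view m ℓ) ∧ E.data.Learnable G f (E.view m ℓ)) := by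
        rintro ⟨f, hf, hL⟩
        have := one_le_of_learnable hF hN.valid h4 hr hf hL
        omega
      have hle : gain (∃ f, E.data.OnTrack G tgt f 0 (E.view m ℓ)) (E.winProb 0 i) v ≤
          gain (∃ f, E.data.OnTrack G tgt f 0 (E.view m ℓ) ∧ ¬ E.data.Learnable G f (E.view m ℓ))
            (E.winProb 0 i) v := by
        by_cases h1 : ∃ f, E.data.OnTrack G tgt f 0 (E.view m ℓ)
        · rw [gain, gain, if_pos h1, if_pos (hsplit h1 hn)]
        · conv_lhs => rw [gain, if_neg h1]
          exact le_gain hw0 hv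
      refine hle.trans ?_
      split_ifs
      · exact gain_le_one hw1 hv
      · exact le_rfl
  · set v' := gain (∃ f, E.data.OnTrack G tgt f (k + 1) (E.view m ℓ) ∧
      ¬ E.data.Learnable G f (E.view m ℓ)) (E.winProb (k + 1) i) v with hv'
    set p₁ : Prop := ∃ f, E.data.OnTrack G tgt f (k + 1) (E.view m ℓ) ∧
      E.data.Learnable G f (E.view m ℓ) with hp₁
    have hv'1 : v' ≤ 1 := gain_le_one hw1 hv
    have hvv' : v ≤ v' := le_gain hw0 hv
    have hu0 := winProb_nonneg hq hΔ k 0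
    have hb : (Test.natLe (.lit 1) (sc 8)).Holds m := by
      simpa only [Test.Holds, NExp.eval, sc, hN.sp] using hℓ
    have hb' : ¬ (Test.natLe rlen (.lit 0)).Holds m := by
      simp only [Test.Holds, NExp.eval, rlen, sc, hN.sp, h4]; omega
    have hb'' : (Test.and (.natLe (.get 5 (sc 8)) (.lit 0)) (.natLe (sc 8) (sc 23))).Holds m := by
      simp only [Test.Holds, NExp.eval, sc, hN.sp, hN.holds.K_eq, h5]; omega
    refine (ok_loop_true hb (ok_ite_false hb' (ok_ite_true hb'' (ok_pushCmd hN.holds hN.sp hN.valid h4 hr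
      (a := 4096 * E.Δ * E.q) (by positivity) (T := E.time k r 0 + (Tp + (X + T)))
      (lo := v') (hi := gain p₁ (E.winProb k 0) v') (le_gain hu0 hv'1)
      (fun t h σ => 1 ≤ k + 1 ∧ ∃ f', E.data.OnTrack G tgt f' (k + 1 - 1)
        (E.data.learn (E.view m ℓ) t h σ)) ?_ ?_)))).mono ?_ ?_
    · intro hlt
      have hp' : p₁ := by
        by_contra hp'
        rw [gain, if_neg hp'] at hlt
        exact lt_irrefl _ hlt
      obtain ⟨f, hT, hL⟩ := hp'
      obtain ⟨t, ht, h, hh, A, hA, hrA, hcA⟩ := exists_learn_view hF hN.valid h4 hT hL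
      refine ⟨t, ht, h, hh, A, hA, hrA, ?_⟩
      convert hcA
    · intro m₁ t h σ hf hs h8 hvw a4 a5 a6 hvw' c4 c5 c6
      have hP₁ : E.Prog ℓ m m₁ := Prog.of_frame hs hf
      have hN₁ : E.Node (ℓ + 1) m₁ := by
        refine ⟨hN.holds.frame hf, h8, ⟨?_, ?_, ?_⟩, ?_, hN.best.frame hf⟩
        · rw [hvw']; exact hN.valid.nodup
        · rw [hvw']; exact hN.valid.lt
        · rw [c4, ← h4]; exact hN.valid.len_le
        · rw [hvw']; exact hN.sound.learn t h σ
      refine (hpred k rfl r (ℓ + 1) 0 m₁ (by omega) (by omega) hN₁ c4 c5 c6 (Tp + (X + T)) Q K v' hv'1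
        fun m₂ hD => ?_).mono le_rfl ?_
      · obtain ⟨e1, e2, e3, e4⟩ := hD.prog.same ℓ (Nat.lt_succ_self ℓ)
        have hvw₂ : E.view m₂ ℓ = E.view m ℓ := e1.trans hvw
        refine phase m₂ ⟨hD.holds, hD.sp, hN.valid.congr hvw₂ ?_, ?_, hD.best⟩
          (hP₁.trans (hD.prog.mono (Nat.le_succ ℓ))) ?_ ?_ hvw₂ ?_
        · rw [e2, a4, h4]
        · rw [hvw₂]; exact hN.sound
        · rw [e2, a4]
        · rw [e4, a6, h6]
        · rw [e3, a5]; omega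
      · rw [hvw']
        simp only [Nat.add_sub_cancel, Nat.le_add_left, true_and]
        by_cases hg : ∃ f', E.data.OnTrack G tgt f' k (E.data.learn (E.view m ℓ) t h σ)
        · rw [if_pos hg, gain, gain, if_pos hg]
          split_ifs
          · exact le_rfl
          · nlinarith
        · rw [if_neg hg, gain, if_neg hg]
    · have := time_push hq hd (i := i) hr hr' (B := E.unit * 64 ^ (k + 1))
        (Nat.le_mul_of_pos_right _ (by positivity))
      simp only [hX, hTp, time, zero_add]
      rw [pow_succ 64 (k + 1), ← mul_assoc E.unit]
      omega
    · by_cases h1 : p₁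
      · have hpush := pushProb_le hq hΔ
        set pp : ℝ := 1 / (2 * (2 * E.Δ + 1) * (2 * ((4096 * E.Δ * E.q : ℕ) : ℝ) ^ (64 * E.q)))
        -- The child starts with round `0`, so its factor for pivot searches is `3/4`; the
        -- definition of `pushProb` includes this loss.
        have hw : E.winProb (k + 1) i ≤ E.winProb k 0 * pp := by
          refine (winProb_le hq hΔ (k + 1) i).trans ?_
          have h0 := pow_nonneg (pushProb_pos hq hΔ).le k
          unfold winProb
          rw [pow_succ]
          nlinarith
        conv_rhs => rw [gain, if_pos h1]
        have hle : v + (1 - v) * E.winProb (k + 1) i ≤ v' + (1 - v') * (E.winProb k 0 * pp) := by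
          nlinarith [mul_le_mul_of_nonneg_left hw (sub_nonneg.2 hv'1),
            mul_nonneg (sub_nonneg.2 hvv') (sub_nonneg.2 hw1)]
        have hge : gain (∃ f, E.data.OnTrack G tgt f (k + 1) (E.view m ℓ)) (E.winProb (k + 1) i) v ≤
            v + (1 - v) * E.winProb (k + 1) i := by
          unfold gain
          split_ifs
          · exact le_rfl
          · nlinarith
        refine hge.trans (hle.trans (le_of_eq ?_))
        ring
      · conv_rhs => rw [gain, if_neg h1]
        rw [sub_self, zero_mul, add_zero]
        by_cases h2 : ∃ f, E.data.OnTrack G tgt f (k + 1) (E.view m ℓ)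
        · rw [hv', gain, gain, if_pos h2, if_pos (hsplit h2 h1)]
        · rw [gain, if_neg h2]; exact hvv'

theorem explores {E : Env} {G : Goal} {tgt : ℝ} (hF : E.Fits G) (k : ℕ) : E.Explores G tgt k := by
  induction k with
  | zero => exact explores_of_pred hF 0 fun k' h => by omega
  | succ k ih =>
    refine explores_of_pred hF (k + 1) fun k' h => ?_
    obtain rfl : k = k' := by omega
    exact ih

/-! ### The whole program -/

/-- A bound for the time of one search from scratch. -/
def searchTime (E : Env) : ℕ := E.n * 4 + E.d * 8 + 30 + E.time (4 * E.Δ + 2) E.n 0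

open Classical in
-- A search followed by something of value `v` has value `v + (1 - v) * P`. Starting from value `0`
-- after the last search, `j` searches reach `1 - (1 - P) ^ j`.
theorem ok_outerLoop {E : Env} {G : Goal} {tgt : ℝ} (hF : E.Fits G)
    (htgt : (1 + 1 / (4 * G.q)) * ((1 + 1 / (4 * G.q)) *
      ∑ x ∈ Finset.range E.n, E.data.cst (G.c (G.l x)) x) ≤ tgt)
    {T : ℕ} {Q : Mem → Prop} {K : List Cmd} {N : ℕ}
    (hK : ∀ m', E.Holds m' → E.BestSound m' → Ok T Q (if GoodBest tgt m' then 1 else 0) K m')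
    (j : ℕ) : ∀ m, E.Holds m → E.BestSound m → m.nat 24 0 = N → m.nat 26 0 + j = N →
    Ok (j * E.searchTime + 1 + T) Q
      (if GoodBest tgt m then 1 else 1 - (1 - E.winProb (4 * E.Δ + 2) 0) ^ j) (outerLoop :: K) m := by
  have hq := hF.one_le_q
  have hΔ := hF.one_le_miss
  set P := E.winProb (4 * E.Δ + 2) 0 with hP
  have hP0 : 0 ≤ P := winProb_nonneg hq hΔ _ _
  have hP1 : P ≤ 1 := winProb_le_one hq hΔ _ _
  induction j with
  | zero =>
    intro m hE hB h24 h26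
    have hb : ¬ (Test.natLe (.add (sc 26) (.lit 1)) (sc 24)).Holds m := by
      simp only [Test.Holds, NExp.eval, sc, h24]; omega
    refine (ok_loop_false hb (hK m hE hB)).mono (by omega) ?_
    simp
  | succ j ih =>
    intro m hE hB h24 h26
    have hb : (Test.natLe (.add (sc 26) (.lit 1)) (sc 24)).Holds m := by
      simp only [Test.Holds, NExp.eval, sc, h24]; omega
    have main : ∀ v ≤ 1, (∀ m', E.Prog 0 m m' → E.Holds m' → E.BestSound m' → m'.nat 8 0 = 0 →
        Ok (j * E.searchTime + 1 + T + 1 + 1) Q (if GoodBest tgt m' then 1 else v)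
          (searchLoop :: setv 26 (.add (sc 26) (.lit 1)) :: outerLoop :: K) m') →
        Ok ((j + 1) * E.searchTime + 1 + T) Q (v + (1 - v) * P) (outerLoop :: K) m := by
      intro v hv hK'
      refine (ok_loop_true hb (ok_seq (tri_startCmd hE _ (E.time (4 * E.Δ + 2) E.n 0 +
        (j * E.searchTime + 1 + T + 1 + 1) + 1) _ _ fun m₁ hm₁ => ?_))).mono_time ?_
      · obtain ⟨hf, h8, ⟨u, hu⟩, h4, h5, h6⟩ := hm₁
        have hN : E.Node 1 m₁ := by
          refine ⟨hE.frame hf, h8, ⟨?_, ?_, h4.le⟩, ?_, hB.frame hf⟩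
          · rw [hu]; exact List.nodup_range
          · rw [hu]; exact fun x hx => List.mem_range.1 hx
          · rw [hu]; exact Data.sound_start _ _ _
        have hP₁ : E.Prog 0 m m₁ := Prog.of_frame (fun i hi => absurd hi (Nat.not_lt_zero i)) hf
        refine ok_seq ((explores (G := G) (tgt := tgt) hF (4 * E.Δ + 2) E.n 1 0 m₁ (by omega) le_rfl hN h4
          h5 h6 _ Q (setv 26 (.add (sc 26) (.lit 1)) :: outerLoop :: K) v hv fun m' hD =>
          hK' m' (hP₁.trans (hD.prog.mono (Nat.zero_le _))) hD.holds hD.best hD.sp).mono le_rfl ?_)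
        have : ∃ f, E.data.OnTrack G tgt f (4 * E.Δ + 2) (E.view m₁ 1) := by
          rw [hu, ← hF.miss_eq]
          exact ⟨_, Data.onTrack_start _ G _ _ _ htgt⟩
        rw [gain, if_pos this]
      · have : (j + 1) * E.searchTime = j * E.searchTime +
            (E.n * 4 + E.d * 8 + 30 + E.time (4 * E.Δ + 2) E.n 0) := by
          rw [Nat.succ_mul, searchTime]
        omega
    have next : ∀ v, ∀ m', E.Prog 0 m m' → E.Holds m' → E.BestSound m' → m'.nat 8 0 = 0 →
        (v ≤ if GoodBest tgt m' then 1 else 1 - (1 - P) ^ j) →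
        Ok (j * E.searchTime + 1 + T + 1 + 1) Q v
          (searchLoop :: setv 26 (.add (sc 26) (.lit 1)) :: outerLoop :: K) m' := by
      intro v m' hp hE' hB' h8 hv
      have hb' : ¬ (Test.natLe (.lit 1) (sc 8)).Holds m' := by
        simp only [Test.Holds, NExp.eval, sc, h8]; omega
      have h26' : m'.nat 26 0 = m.nat 26 0 := by rw [hp.count.2]
      have h24' : m'.nat 24 0 = N := by rw [hp.count.1, h24]
      have hf : Frame [26] [] m' (m'.setNat 26 0 (m.nat 26 0 + 1)) :=
        (Frame.refl _ _ m').setNat (by decide) _ _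
      refine ok_loop_false hb' (ok_setNat (m' := m'.setNat 26 0 (m.nat 26 0 + 1)) ?_ ((ih _ (hE'.frame hf)
        (hB'.frame hf) ?_ ?_).mono le_rfl ?_))
      · simp [NExp.eval, sc, h26']
      · simp [Mem.nat_setNat, h24']
      · simp [Mem.nat_setNat]; omega
      · rw [goodBest_frame hf]; exact hv
    by_cases hg : GoodBest tgt m
    · rw [if_pos hg]
      refine (main 1 le_rfl fun m' hp hE' hB' h8 => ?_).mono le_rfl (by simp)
      rw [ite_self]
      refine next 1 m' hp hE' hB' h8 ?_
      rw [if_pos (hp.good tgt hg)]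
    · rw [if_neg hg]
      have h1 : 0 ≤ (1 - P) ^ j := pow_nonneg (by linarith) _
      refine (main (1 - (1 - P) ^ j) (by linarith) fun m' hp hE' hB' h8 =>
        next _ m' hp hE' hB' h8 le_rfl).mono le_rfl (le_of_eq ?_)
      rw [pow_succ]; ring

open Classical in
/-- The output: the labels are those of the nearest centers, and the cost is at most `tgt`. -/
def Labeled (E : Env) (tgt : ℝ) (m : Mem) : Prop :=
  (∀ i < E.n, m.nat 2 i = if E.data.cst (E.out m 0) i ≤ E.data.cst (E.out m 1) i then 0 else 1) ∧
    E.outCost m ≤ tgt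

/-- The number of searches. -/
def rounds (E : Env) : ℕ := (4096 * E.Δ * E.q) ^ ((64 * E.q + 1) * (4 * E.Δ + 2) + 1)

/-- The number of rounds is at least `1 / P`. Bernoulli gives `(1 + P) ^ N ≥ 2`, and `(1 - P) ^ N *
(1 + P) ^ N ≤ 1`. -/
theorem half_le_of_rounds {E : Env} (hq : 1 ≤ E.q) (hΔ : 1 ≤ E.Δ) :
    1 / 2 ≤ 1 - (1 - E.winProb (4 * E.Δ + 2) 0) ^ E.rounds := by
  set P := E.winProb (4 * E.Δ + 2) 0 with hP
  have hP0 : 0 ≤ P := winProb_nonneg hq hΔ _ _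
  have hP1 : P ≤ 1 := winProb_le_one hq hΔ _ _
  have hN : 1 ≤ (E.rounds : ℝ) * P := by
    have ha : (4096 : ℝ) ≤ ((4096 * E.Δ * E.q : ℕ) : ℝ) := by
      have : 1 ≤ E.Δ * E.q := Nat.mul_pos hΔ hq
      exact_mod_cast (by nlinarith : 4096 ≤ 4096 * E.Δ * E.q)
    rw [hP, winProb, pushProb, rounds, Nat.cast_pow]
    set a : ℝ := ((4096 * E.Δ * E.q : ℕ) : ℝ)
    have hpos : 0 < a ^ ((64 * E.q + 1) * (4 * E.Δ + 2)) := by positivity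
    rw [div_pow (1 : ℝ) (a ^ _), one_pow, ← pow_mul, pow_succ]
    have : a ^ ((64 * E.q + 1) * (4 * E.Δ + 2)) * a * ((1 - (1 / 2) ^ (0 + 2)) *
        (1 / a ^ ((64 * E.q + 1) * (4 * E.Δ + 2)))) = 3 / 4 * a := by
      field_simp
      norm_num
    rw [this]; linarith
  have hb := one_add_mul_le_pow (a := P) (by linarith) E.rounds
  have hx : 0 ≤ (1 - P) ^ E.rounds := pow_nonneg (by linarith) _
  have hprod : (1 - P) ^ E.rounds * (1 + P) ^ E.rounds ≤ 1 := by
    rw [← mul_pow]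
    exact pow_le_one₀ (by nlinarith) (by nlinarith)
  nlinarith

/-- A bound for the time of the whole program. -/
def totalTime (E : Env) : ℕ :=
  E.q * 2 + (64 * E.q + 1) * (4 * E.Δ + 2) * 4 + E.rounds * E.searchTime +
    E.n * (E.d * 10 + 20) + 30

theorem ok_clusterProg {E : Env} {G : Goal} {tgt : ℝ} (hF : E.Fits G)
    (htgt : (1 + 1 / (4 * G.q)) * ((1 + 1 / (4 * G.q)) *
      ∑ x ∈ Finset.range E.n, E.data.cst (G.c (G.l x)) x) ≤ tgt) {m : Mem} {ε : ℝ}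
    (h0 : m.nat 0 0 = E.n) (h1 : m.nat 0 1 = E.d) (h2 : m.nat 0 2 = E.Δ) (hD : m.nat 1 = E.D)
    (hV : m.real 1 = E.V) (he : m.real 0 0 = ε) (hq1 : 1 ≤ E.q * ε)
    (hmin : ∀ k < E.q, 1 ≤ k → k * ε < 1) (h27 : m.nat 27 0 = 0) :
    Ok E.totalTime (E.Labeled tgt) (1 / 2) [clusterProg] m := by
  classical
  refine (ok_seq (tri_paramCmd h0 h1 h2 he hF.one_le_q hq1 hmin _ (E.rounds * E.searchTime + 1 +
    (E.n * (E.d * 10 + 20) + 3) + 1 + 1 + 1) _ _ fun m₁ hm₁ => ?_)).mono_time ?_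
  · obtain ⟨hf, hE, h24⟩ := hm₁
    have hE₁ : E.Holds m₁ := by rw [hD, hV] at hE; exact hE
    have hf₂ : Frame [26] [] m₁ (m₁.setNat 26 0 0) := (Frame.refl _ _ m₁).setNat (by decide) _ _
    refine ok_seq (ok_setNat (m' := m₁.setNat 26 0 0) rfl (ok_seq ((ok_outerLoop hF htgt (N := E.rounds) ?_
      E.rounds _ (hE₁.frame hf₂) ?_ ?_ ?_).mono le_rfl ?_)))
    · intro m' hE' hB'
      refine tri_labelCmd hE' _ 0 _ _ fun m'' hm'' => ok_nil ?_ ?_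
      · split_ifs <;> norm_num
      · split_ifs with hg
        · left
          obtain ⟨hr, hl⟩ := hm''
          have ho : E.out m'' = E.out m' := by
            funext t j; simp only [out, hr]
          refine ⟨?_, ?_⟩
          · rw [ho]; exact hl
          · unfold outCost
            rw [ho]
            exact (hB' hg.1).trans hg.2
        · right; exact le_rfl
    · intro h
      simp only [Mem.nat_setNat] at h
      rw [hf.1 27 (by decide), h27] at h
      simp at h
    · simp [Mem.nat_setNat, h24, rounds]
    · simp [Mem.nat_setNat]
    · split_ifs
      · norm_num
      · exact half_le_of_rounds hF.one_le_q hF.one_le_miss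
  · simp only [totalTime]
    omega

end Env
/-! ### The instance in the memory -/

/-- For a fixed partition the coordinates decouple, and the mean of the present entries is optimal
in each. The optimum over all clusterings thus reduces to finitely many partitions. -/
theorem Data.exists_best_centers (I : Data) (n : ℕ) (L : ℕ → ℕ) (hL : ∀ x, L x < 2) :
    ∃ C : ℕ → ℕ → ℝ, ∀ C' : ℕ → ℕ → ℝ, ∑ x ∈ Finset.range n, I.cst (C (L x)) x ≤
      ∑ x ∈ Finset.range n, I.cst (C' (L x)) x := by
  classical
  set A : ℕ → Finset ℕ := fun t => (Finset.range n).filter fun x => L x = t with hA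
  have key (C : ℕ → ℕ → ℝ) : ∑ x ∈ Finset.range n, I.cst (C (L x)) x =
      ∑ t ∈ Finset.range 2, ∑ j ∈ Finset.range I.d, I.coordCost (A t) j (C t j) := by
    rw [← Finset.sum_fiberwise_of_maps_to (s := Finset.range n) (t := Finset.range 2) (g := L)
      fun x _ => Finset.mem_range.2 (hL x)]
    refine Finset.sum_congr rfl fun t _ => ?_
    simp only [Data.coordCost, Data.having, Finset.sum_filter (s := A t)]
    rw [Finset.sum_comm]
    refine Finset.sum_congr rfl fun x hx => ?_
    rw [(Finset.mem_filter.1 hx).2, Data.cst]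
  refine ⟨fun t j => I.avg (A t) j, fun C' => ?_⟩
  rw [key fun t j => I.avg (A t) j, key C']
  exact Finset.sum_le_sum fun t _ => Finset.sum_le_sum fun j _ => I.coordCost_avg_le _ _ _

/-- The instance given by the points `P`. -/
noncomputable def inputEnv {n d : ℕ} (Δ q : ℕ) (ε : ℝ) (P : Fin n → HPoint d) : Env :=
  ⟨n, d, Δ, q, (inputMem Δ ε P).nat 1, (inputMem Δ ε P).real 1⟩

section Input

variable {n d : ℕ} (Δ q : ℕ) (ε : ℝ) (P : Fin n → HPoint d)

theorem entry_lt (i : Fin n) (j : Fin d) : (i : ℕ) * d + j < n * d := Env.row_lt i.2 j.2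

theorem divNat_entry (i : Fin n) (j : Fin d) (h : (i : ℕ) * d + j < n * d) :
    (⟨(i : ℕ) * d + j, h⟩ : Fin (n * d)).divNat = i := by
  have hd : 0 < d := j.pos
  ext
  rw [Fin.coe_divNat]
  simp only
  rw [mul_comm, Nat.mul_add_div hd, Nat.div_eq_of_lt j.2, add_zero]

theorem modNat_entry (i : Fin n) (j : Fin d) (h : (i : ℕ) * d + j < n * d) :
    (⟨(i : ℕ) * d + j, h⟩ : Fin (n * d)).modNat = j := by
  ext
  rw [Fin.coe_modNat]
  simp only
  rw [mul_comm, Nat.mul_add_mod, Nat.mod_eq_of_lt j.2]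

theorem inputEnv_pr (i : Fin n) (j : Fin d) :
    (inputEnv Δ q ε P).data.pr i j ↔ (P i j).isSome := by
  simp only [inputEnv, Env.data, inputMem, one_ne_zero, if_false, if_true, dif_pos (entry_lt i j),
    divNat_entry, modNat_entry]
  split_ifs with h <;> simp [h]

theorem inputEnv_v (i : Fin n) (j : Fin d) : (inputEnv Δ q ε P).data.v i j = (P i j).getD 0 := by
  simp only [inputEnv, Env.data, inputMem, one_ne_zero, if_false, if_true, dif_pos (entry_lt i j),
    divNat_entry, modNat_entry]

theorem inputEnv_cst (c : ℕ → ℝ) (i : Fin n) :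
    (inputEnv Δ q ε P).data.cst c i =
      distOn Finset.univ (P i) (complete fun j : Fin d => c j) ^ 2 := by
  classical
  rw [distOn, Real.sq_sqrt (Finset.sum_nonneg fun _ _ => sq_nonneg _), Data.cst]
  change ∑ j ∈ Finset.range d, _ = _
  rw [Finset.sum_range]
  refine Finset.sum_congr rfl fun j _ => ?_
  have h1 := inputEnv_pr Δ q ε P i j
  have h2 := inputEnv_v Δ q ε P i j
  cases h : P i j with
  | none =>
    rw [if_neg (by rw [h1, h]; simp)]
    simp [entryDist]
  | some a =>
    rw [if_pos (by rw [h1, h]; simp), h2, h]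
    simp [entryDist, complete]

theorem clusterCost_eq (l : Fin n → Fin 2) (c : ℕ → ℕ → ℝ) :
    clusterCost P l (fun t j => c t j) = ∑ i, (inputEnv Δ q ε P).data.cst (c (l i)) i := by
  classical
  rw [clusterCost, ← Finset.sum_fiberwise Finset.univ l]
  refine Finset.sum_congr rfl fun t _ => Finset.sum_congr rfl fun i hi => ?_
  rw [(Finset.mem_filter.1 hi).2, inputEnv_cst]

/-- The optimum is attained. -/
theorem exists_optimal : ∃ (L : ℕ → ℕ) (C : ℕ → ℕ → ℝ), (∀ x, L x < 2) ∧
    ∑ x ∈ Finset.range n, (inputEnv Δ q ε P).data.cst (C (L x)) x ≤ opt 2 P := by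
  classical
  set ext : (Fin n → Fin 2) → ℕ → ℕ := fun l x => if h : x < n then l ⟨x, h⟩ else 0 with hext
  have hlt (l : Fin n → Fin 2) (x : ℕ) : ext l x < 2 := by
    simp only [hext]
    split_ifs
    · exact (l _).2
    · norm_num
  choose C hC using fun l => (inputEnv Δ q ε P).data.exists_best_centers n (ext l) (hlt l)
  obtain ⟨l, -, hl⟩ := Finset.exists_min_image (Finset.univ : Finset (Fin n → Fin 2))
    (fun l => ∑ x ∈ Finset.range n, (inputEnv Δ q ε P).data.cst (C l (ext l x)) x)
    Finset.univ_nonempty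
  refine ⟨ext l, C l, hlt l, le_ciInf fun p => ?_⟩
  set c : ℕ → ℕ → ℝ := fun t j => if h : t < 2 ∧ j < d then p.2 ⟨t, h.1⟩ ⟨j, h.2⟩ else 0 with hc
  have hp : p.2 = fun (t : Fin 2) (j : Fin d) => c t j := by
    funext t j
    simp only [hc]
    rw [dif_pos ⟨t.2, j.2⟩]
  refine (hl p.1 (Finset.mem_univ _)).trans ((hC p.1 c).trans (le_of_eq ?_))
  rw [hp, clusterCost_eq Δ q ε, Finset.sum_range]
  refine Finset.sum_congr rfl fun i _ => ?_
  simp [hext]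

theorem isApproxOutput_of_labeled {tgt : ℝ} {m : Mem} (h : (inputEnv Δ q ε P).Labeled tgt m)
    (ht : tgt ≤ (1 + ε) * opt 2 P) : IsApproxOutput ε P m := by
  classical
  set I := (inputEnv Δ q ε P).data with hI
  set o := (inputEnv Δ q ε P).out m with ho
  refine ⟨fun i => if I.cst (o 0) i ≤ I.cst (o 1) i then 0 else 1, fun i => ?_, ?_⟩
  · refine (h.1 i i.2).trans ?_
    simp only [← hI, ← ho]
    split_ifs <;> rfl
  · refine le_trans (le_of_eq ?_) (h.2.trans ht)
    have := clusterCost_eq Δ q ε P (fun i => if I.cst (o 0) i ≤ I.cst (o 1) i then 0 else 1)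
      (fun t j => m.real 2 (t * d + j))
    refine this.trans ?_
    rw [Env.outCost]
    change _ = ∑ x ∈ Finset.range n, _
    rw [Finset.sum_range]
    refine Finset.sum_congr rfl fun i _ => ?_
    by_cases hle : I.cst (o 0) i ≤ I.cst (o 1) i
    · rw [if_pos hle, min_eq_left hle]; rfl
    · rw [if_neg hle, min_eq_right (not_le.1 hle).le]; rfl

open Classical in
theorem inputEnv_few (hP : ∀ i, IsMissing Δ (P i)) (x : ℕ) (hx : x < n) :
    ((Finset.range d).filter fun j => ¬ (inputEnv Δ q ε P).data.pr x j).card ≤ Δ := by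
  refine le_trans (le_of_eq ?_) (hP ⟨x, hx⟩)
  symm
  refine Finset.card_bij (fun j _ => (j : ℕ)) (fun j hj => ?_) (fun _ _ _ _ h => Fin.ext h) fun j hj => ?_
  · have := inputEnv_pr Δ q ε P ⟨x, hx⟩ j
    simp only [Finset.mem_filter, Finset.mem_univ, true_and] at hj
    rw [Finset.mem_filter, Finset.mem_range]
    refine ⟨j.2, fun h => ?_⟩
    have := this.1 h
    simp_all
  · rw [Finset.mem_filter, Finset.mem_range] at hj
    refine ⟨⟨j, hj.1⟩, ?_, rfl⟩
    have := inputEnv_pr Δ q ε P ⟨x, hx⟩ ⟨j, hj.1⟩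
    simp only [Finset.mem_filter, Finset.mem_univ, true_and]
    have h2 : ¬ (P ⟨x, hx⟩ ⟨j, hj.1⟩).isSome := fun h => hj.2 (this.2 h)
    simpa using h2

end Input

/-! ### The running time -/

/-- The number of searches dominates, with an exponent of at most `391 * q * Δ`. One search takes
about `a ^ (4 * Δ + 4) * d * n`, and constant factors are absorbed by further powers of `a ≥ 4096`.
-/
theorem Env.totalTime_le (E : Env) (hq : 1 ≤ E.q) (hΔ : 1 ≤ E.Δ) (hd : 1 ≤ E.d) (hn : 1 ≤ E.n) :
    E.totalTime ≤ (4096 * E.Δ * E.q) ^ (400 * (E.q * E.Δ)) * (E.d * E.n) := by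
  have hqΔ : 1 ≤ E.q * E.Δ := Nat.mul_pos hq hΔ
  have hdn : 1 ≤ E.d * E.n := Nat.mul_pos hd hn
  have hq' : E.q ≤ E.q * E.Δ := Nat.le_mul_of_pos_right _ hΔ
  have hΔ' : E.Δ ≤ E.q * E.Δ := Nat.le_mul_of_pos_left _ hq
  have hd' : E.d ≤ E.d * E.n := Nat.le_mul_of_pos_right _ hn
  have hn' : E.n ≤ E.d * E.n := Nat.le_mul_of_pos_left _ hd
  set a := 4096 * E.Δ * E.q with ha
  have ha' : a = 4096 * (E.q * E.Δ) := by rw [ha]; ring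
  have ha1 : 4096 ≤ a := by omega
  have hpow {x y : ℕ} (h : x ≤ y) : a ^ x ≤ a ^ y := Nat.pow_le_pow_right (by omega) h
  have h1 : E.time (4 * E.Δ + 2) E.n 0 ≤ a ^ (4 * E.Δ + 4) * (E.d * E.n) := by
    have h64 : 64 ^ (4 * E.Δ + 2 + 1) ≤ a ^ (4 * E.Δ + 3) := Nat.pow_le_pow_left (by omega) _
    calc E.time (4 * E.Δ + 2) E.n 0
        ≤ 100 * E.d * E.q * a ^ (4 * E.Δ + 3) * (16 * E.n) := by
          unfold time unit
          exact Nat.mul_le_mul (Nat.mul_le_mul_left _ h64) (by omega)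
      _ = 1600 * E.q * (a ^ (4 * E.Δ + 3) * (E.d * E.n)) := by ring
      _ ≤ a * (a ^ (4 * E.Δ + 3) * (E.d * E.n)) := Nat.mul_le_mul_right _ (by omega)
      _ = _ := by rw [pow_succ a (4 * E.Δ + 3)]; ring
  have h2 : E.searchTime ≤ 2 * a ^ (4 * E.Δ + 4) * (E.d * E.n) := by
    have : a ≤ a ^ (4 * E.Δ + 4) := Nat.le_self_pow (by omega) _
    have h42 : 42 * (E.d * E.n) ≤ a ^ (4 * E.Δ + 4) * (E.d * E.n) := Nat.mul_le_mul_right _ (by omega)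
    unfold searchTime
    linarith
  have h3 : E.rounds ≤ a ^ (391 * (E.q * E.Δ)) := hpow (by nlinarith)
  set e := 391 * (E.q * E.Δ) + (4 * E.Δ + 4) with he
  have h4 : E.rounds * E.searchTime ≤ 2 * a ^ e * (E.d * E.n) := by
    refine (Nat.mul_le_mul h3 h2).trans (le_of_eq ?_)
    rw [he, pow_add]; ring
  have h5 : E.q * 2 + (64 * E.q + 1) * (4 * E.Δ + 2) * 4 ≤ a := by nlinarith
  have h6 : a ≤ a ^ e := Nat.le_self_pow (by omega) _
  have h7 : a ^ e ≤ a ^ e * (E.d * E.n) := Nat.le_mul_of_pos_right _ hdn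
  have h8 : 60 * (E.d * E.n) ≤ a ^ e * (E.d * E.n) := Nat.mul_le_mul_right _ (by omega)
  have h9 : E.n * (E.d * 10 + 20) + 30 ≤ 60 * (E.d * E.n) := by nlinarith
  calc E.totalTime ≤ 4 * (a ^ e * (E.d * E.n)) := by unfold totalTime; linarith
    _ ≤ a * (a ^ e * (E.d * E.n)) := Nat.mul_le_mul_right _ (by omega)
    _ = a ^ (e + 1) * (E.d * E.n) := by rw [pow_succ]; ring
    _ ≤ _ := Nat.mul_le_mul_right _ (hpow (by omega))

theorem exponent_bound {Δ q : ℕ} {ε : ℝ} (hΔ : 1 ≤ Δ) (hq : 1 ≤ q) (hε : 0 < ε)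
    (hmin : ∀ k < q, 1 ≤ k → k * ε < 1) :
    400 * (q * Δ : ℝ) * Real.log (4096 * Δ * q) ≤ 20000 * Real.log 2 *
      (1 + max ((Δ : ℝ) ^ 4 * Real.log Δ) ((Δ : ℝ) / ε * Real.log (1 / ε))) := by
  have hΔR : (1 : ℝ) ≤ Δ := by exact_mod_cast hΔ
  have hqR : (1 : ℝ) ≤ q := by exact_mod_cast hq
  have hlΔ : 0 ≤ Real.log Δ := Real.log_nonneg hΔR
  have hlq : 0 ≤ Real.log q := Real.log_nonneg hqR
  have hl2 : 0.69 < Real.log 2 := lt_trans (by norm_num) Real.log_two_gt_d9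
  have hl2' : Real.log 2 < 0.7 := lt_trans Real.log_two_lt_d9 (by norm_num)
  have hlog : Real.log (4096 * Δ * q) ≤ 9 + Real.log Δ + Real.log q := by
    rw [Real.log_mul (by positivity) (by positivity), Real.log_mul (by positivity) (by positivity),
      show (4096 : ℝ) = 2 ^ 12 by norm_num, Real.log_pow]
    push_cast
    linarith
  set M := max ((Δ : ℝ) ^ 4 * Real.log Δ) ((Δ : ℝ) / ε * Real.log (1 / ε)) with hM
  have hM1 : (Δ : ℝ) ^ 4 * Real.log Δ ≤ M := le_max_left _ _
  have hM2 : (Δ : ℝ) / ε * Real.log (1 / ε) ≤ M := le_max_right _ _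
  have hM0 : 0 ≤ M := le_trans (by positivity) hM1
  have hcube : (Δ : ℝ) ≤ (Δ : ℝ) ^ 4 := le_self_pow₀ hΔR (by norm_num)
  have hsq : (Δ : ℝ) ^ 2 ≤ (Δ : ℝ) ^ 4 := pow_le_pow_right₀ hΔR (by norm_num)
  have main : (q * Δ : ℝ) ≤ 3 * (1 + M) ∧ (q * Δ : ℝ) * Real.log Δ ≤ 3 * (1 + M) ∧
      (q * Δ : ℝ) * Real.log q ≤ 3 * (1 + M) := by
    -- For `q ≤ 2` the term with `1 / ε` may be useless, as its logarithm can be negative; the term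
    -- with `Δ` and the `1` suffice. For `q ≥ 3`, minimality gives `q - 1 ≤ 1 / ε`, and `q ≤ (q - 1)
    -- ^ 2` transfers the bound to the logarithms.
    rcases Nat.lt_or_ge q 3 with h | h
    · have hq2 : (q : ℝ) ≤ 2 := by exact_mod_cast (by omega : q ≤ 2)
      have hlq2 : Real.log q ≤ 1 := (Real.log_le_log (by linarith) hq2).trans (by linarith)
      have h1 : (q * Δ : ℝ) ≤ 2 * Δ := by nlinarith
      have h2 : 2 * (Δ : ℝ) ≤ 3 * (1 + M) := by
        rcases hΔ.lt_or_eq with hΔ2 | hΔ1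
        · have htwo : (2 : ℝ) ≤ Δ := by exact_mod_cast hΔ2
          have hl : Real.log 2 ≤ Real.log Δ := Real.log_le_log (by norm_num) htwo
          have : (Δ : ℝ) * 0.69 ≤ (Δ : ℝ) ^ 4 * Real.log Δ :=
            mul_le_mul hcube (by linarith) (by norm_num) (by positivity)
          linarith
        · rw [← hΔ1]; push_cast; linarith
      refine ⟨h1.trans h2, ?_, ?_⟩
      · have := mul_le_mul_of_nonneg_right h1 hlΔ
        have := mul_le_mul_of_nonneg_right hcube hlΔ
        linarith
      · have : (q * Δ : ℝ) * Real.log q ≤ (q * Δ : ℝ) * 1 :=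
          mul_le_mul_of_nonneg_left hlq2 (by positivity)
        linarith
    · have h3R : (3 : ℝ) ≤ q := by exact_mod_cast h
      have hk := hmin (q - 1) (by omega) (by omega)
      rw [Nat.cast_sub hq, Nat.cast_one] at hk
      have hinv : (q : ℝ) - 1 ≤ 1 / ε := by rw [le_div_iff₀ hε]; exact hk.le
      have hl1 : Real.log (q - 1) ≤ Real.log (1 / ε) := Real.log_le_log (by linarith) hinv
      have hl3 : Real.log q ≤ 2 * Real.log (q - 1) := by
        have := Real.log_le_log (x := (q : ℝ)) (y := ((q : ℝ) - 1) ^ 2) (by linarith) (by nlinarith)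
        rwa [Real.log_pow, Nat.cast_ofNat] at this
      have hlq1 : 1 ≤ Real.log q := by
        rw [Real.le_log_iff_exp_le (by linarith)]
        exact (Real.exp_one_lt_d9.le.trans (by norm_num)).trans h3R
      have hkey : (q * Δ : ℝ) * Real.log q ≤ 3 * M := by
        have h1 : (2 / 3 * q : ℝ) * (Real.log q / 2) ≤ 1 / ε * Real.log (1 / ε) :=
          mul_le_mul (by linarith) (by linarith) (by positivity) (by positivity)
        have h2 := mul_le_mul_of_nonneg_left h1 (by linarith : (0 : ℝ) ≤ Δ)
        have h3 : (Δ : ℝ) * (1 / ε * Real.log (1 / ε)) = (Δ : ℝ) / ε * Real.log (1 / ε) := by ring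
        nlinarith
      have h0 : (0 : ℝ) ≤ q * Δ := by positivity
      refine ⟨by nlinarith, ?_, by linarith⟩
      -- If `Δ ≤ q`, the logarithm of `Δ` is at most that of `q`. Otherwise `q * Δ ≤ Δ ^ 2`, and the
      -- first term of the maximum applies.
      rcases le_total Δ q with hle | hle
      · have : Real.log Δ ≤ Real.log q := Real.log_le_log (by linarith) (by exact_mod_cast hle)
        nlinarith
      · have hle' : (q : ℝ) ≤ Δ := by exact_mod_cast hle
        have h1 : (q * Δ : ℝ) ≤ (Δ : ℝ) ^ 2 := by nlinarith
        have := mul_le_mul_of_nonneg_right (h1.trans hsq) hlΔ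
        linarith
  obtain ⟨m1, m2, m3⟩ := main
  have h0 : (0 : ℝ) ≤ q * Δ := by positivity
  have := mul_le_mul_of_nonneg_left hlog h0
  nlinarith

theorem exists_accuracy {ε : ℝ} (hε : 0 < ε) :
    ∃ q : ℕ, 1 ≤ q ∧ 1 ≤ q * ε ∧ ∀ k < q, 1 ≤ k → k * ε < 1 := by
  classical
  have hex : ∃ q : ℕ, 1 ≤ q ∧ 1 ≤ q * ε := by
    obtain ⟨N, hN⟩ := exists_nat_ge (1 / ε)
    rw [div_le_iff₀ hε] at hN
    refine ⟨N, Nat.one_le_iff_ne_zero.2 fun h0 => ?_, hN⟩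
    rw [h0] at hN
    norm_num at hN
  refine ⟨Nat.find hex, (Nat.find_spec hex).1, (Nat.find_spec hex).2, fun k hk h1 => ?_⟩
  have := Nat.find_min hex hk
  exact not_le.1 fun h => this ⟨h1, h⟩

/-! ### The theorem -/

theorem ok_clusterProg_input {n d Δ q : ℕ} {ε : ℝ} (P : Fin n → HPoint d) (hΔ : 1 ≤ Δ) (hd : 1 ≤ d)
    (hP : ∀ i, IsMissing Δ (P i)) (hq : 1 ≤ q) (hq1 : 1 ≤ q * ε)
    (hmin : ∀ k < q, 1 ≤ k → k * ε < 1) :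
    ∃ tgt ≤ (1 + ε) * opt 2 P, Ok (inputEnv Δ q ε P).totalTime ((inputEnv Δ q ε P).Labeled tgt) (1 / 2)
      [clusterProg] (inputMem Δ ε P) := by
  obtain ⟨L, C, hL, hopt⟩ := exists_optimal Δ q ε P
  set S := ∑ x ∈ Finset.range n, (inputEnv Δ q ε P).data.cst (C (L x)) x with hS
  have hS0 : 0 ≤ S := Finset.sum_nonneg fun _ _ => Data.cst_nonneg _ _ _
  refine ⟨(1 + 1 / (4 * (q : ℝ))) * ((1 + 1 / (4 * (q : ℝ))) * S), ?_,
    Env.ok_clusterProg (G := ⟨q, Δ, L, C⟩)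
    ⟨rfl, rfl, hq, hΔ, hd, hL, inputEnv_few Δ q ε P hP⟩ le_rfl (ε := ε) ?_ ?_ ?_ rfl rfl ?_ hq1 hmin ?_⟩
  · have hqR : (1 : ℝ) ≤ q := by exact_mod_cast hq
    have hx : 1 / (q : ℝ) ≤ ε := by rw [div_le_iff₀ (by linarith)]; linarith
    have hx0 : 0 < 1 / (q : ℝ) := by positivity
    have hx1 : 1 / (q : ℝ) ≤ 1 := by rw [div_le_one (by linarith)]; exact hqR
    have he : 1 / (4 * (q : ℝ)) = 1 / q / 4 := by field_simp
    rw [he, ← mul_assoc]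
    refine mul_le_mul ?_ hopt hS0 (by linarith)
    -- With `x = 1 / q ≤ 1`, this is `(1 + x / 4) ^ 2 ≤ 1 + x ≤ 1 + ε`.
    nlinarith
  all_goals simp [inputMem, inputEnv]

end MissingMeans

theorem theorem4 :
    ∃ (prog : Cmd) (C : ℝ), 0 < C ∧
      ∀ (Δ d n : ℕ) (ε : ℝ) (P : Fin n → HPoint d),
        1 ≤ Δ → 1 ≤ d → 1 ≤ n → 0 < ε → (∀ i, IsMissing Δ (P i)) →
        ∃ T : ℕ,
          (T : ℝ) ≤ (2 : ℝ) ^ (C * (1 + max ((Δ : ℝ) ^ 4 * Real.log Δ)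
            ((Δ : ℝ) / ε * Real.log (1 / ε)))) * d * n ∧
          (∀ s ∈ (run prog (inputMem Δ ε P) T).support, s.Halted) ∧
          1 / 2 ≤ (run prog (inputMem Δ ε P) T).toOuterMeasure
            {s | IsApproxOutput ε P s.mem} := by
  refine ⟨clusterProg, 20000, by norm_num, fun Δ d n ε P hΔ hd hn hε hP => ?_⟩
  obtain ⟨q, hq, hq1, hmin⟩ := exists_accuracy hε
  obtain ⟨tgt, htgt, hhalt, hprob⟩ := ok_clusterProg_input P hΔ hd hP hq hq1 hmin
  refine ⟨(inputEnv Δ q ε P).totalTime, ?_, hhalt, ?_⟩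
  · have hT := (inputEnv Δ q ε P).totalTime_le hq hΔ hd hn
    have hT' : ((inputEnv Δ q ε P).totalTime : ℝ) ≤
        (4096 * Δ * q : ℝ) ^ (400 * (q * Δ)) * (d * n) := by exact_mod_cast hT
    refine hT'.trans ?_
    rw [mul_assoc _ (d : ℝ)]
    refine mul_le_mul_of_nonneg_right ?_ (by positivity)
    have hpos : (0 : ℝ) < 4096 * Δ * q := by positivity
    -- Both sides become exponentials to base `e`, so the factor `Real.log 2` appears next to
    -- `20000`, as in `exponent_bound`.
    rw [← Real.rpow_natCast, Real.rpow_def_of_pos hpos, Real.rpow_def_of_pos (zero_lt_two' ℝ), Real.exp_le_exp]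
    have := exponent_bound hΔ hq hε hmin
    push_cast
    linarith
  · have h1 : ENNReal.ofReal (1 / 2) ≤
        (run clusterProg (inputMem Δ ε P) (inputEnv Δ q ε P).totalTime).toOuterMeasure
          {s | (inputEnv Δ q ε P).Labeled tgt s.mem} :=
      (ENNReal.ofReal_le_iff_le_toReal (outer_ne_top _ _)).2 hprob
    have h2 : ENNReal.ofReal (1 / 2) = 1 / 2 := by
      rw [ENNReal.ofReal_div_of_pos (zero_lt_two' ℝ)]; simp
    rw [← h2]
    exact h1.trans ((PMF.toOuterMeasure _).mono fun s hs => isApproxOutput_of_labeled Δ q ε P hs htgt)
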